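/- Let $d\ge 1$, let $\mathbb S^d\subset\mathbb R^{d+1}$ be the unit sphere with its uniform probability measure, and let $\|\cdot\|_{L^2(\mathbb S^d)}$ be the corresponding norm. For $\ell\ge 0$ let $\lambda_\ell=\ell(\ell+d-1)$ and let $\{Y_{\ell,m}: m=1,\dots,M_{d,\ell}\}$ be an orthonormal basis of the space of spherical harmonics of degree $\ell$ (the restrictions to $\mathbb S^d$ of the homogeneous harmonic polynomials of degree $\ell$). For $\beta>0$, $f_0\in H^\beta(\mathbb S^d)$ means that $f_0\in L^2(\mathbb S^d)$ and $\sum_{\ell}\sum_{m}(1+\lambda_\ell)^{\beta}\langle f_0,Y_{\ell,m}\rangle_{L^2}^2<\infty$. **Model.** For $n\ge1$ one observes $n$ independent pairs $(x_i,y_i)$ with $y_i=f_0(x_i)+\varepsilon_i$, where the $x_i$ are uniform on $\mathbb S^d$, the $\varepsilon_i$ are $\mathcal N(0,\sigma^2)$ and independent of the design, and $\sigma>0$ is known. Let $\mathbb E_{f_0}^{(n)}$ be the expectation under the joint law of $(\boldsymbol x,\boldsymbol y)$. **Prior.** Let $\alpha>d/2$ and let $(C_\ell)_{\ell\ge0}$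 satisfy $c_1(1+\lambda_\ell)^{-\alpha}\le C_\ell\le c_2(1+\lambda_\ell)^{-\alpha}$ for all $\ell\ge 0$, with constants $c_1,c_2>0$. The truncated prior is the law of $f=\sum_{\ell\le L_n}\sum_{m}a_{\ell,m}Y_{\ell,m}$ with independent $a_{\ell,m}\sim\mathcal N(0,C_\ell)$. The truncation levels $L_n\in\mathbb N$ satisfy $k_1n^{1/(2\alpha+d)}\le L_n\le k_2 n^{1/(2\alpha+d)}$ for all large $n$, with constants $k_1,k_2>0$. **Posterior.** Let $\Pi(\cdot\mid\boldsymbol y,\boldsymbol x)$ be either of the following two posteriors, each obtained by Bayes' rule from the truncated prior: 1. the posterior for the regression likelihood $\prod_{i=1}^n\varphi(y_i;f(x_i),\sigma^2)$; 2. the posterior for the likelihood in harmonic coordinates $\prod_{\ell\le L_n}\prod_m\varphi(\hat a_{\ell,m};a_{\ell,m},\sigma^2/n)$, evaluated at the empirical coefficients $\hat a_{\ell,m}=\frac1n\sum_{i=1}^n y_iY_{\ell,m}(x_i)$. Here $\varphi(\cdot;\mu,\tau^2)$ denotes the $\mathcal N(\mu,\tau^2)$ density. **Theorem.** If $f_0\in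 H^\beta(\mathbb S^d)$ with $0<\beta\le\alpha$, then, for both posteriors, the posterior contracts around $f_0$ in $L^2(\mathbb S^d)$ at rate $\rho_n=n^{-\beta/(2\alpha+d)}$: for every sufficiently large constant $M>0$, $$\mathbb E_{f_0}^{(n)}\Big[\Pi\big(f:\ \|f-f_0\|_{L^2(\mathbb S^d)}>M\rho_n\,\big|\,\boldsymbol y,\boldsymbol x\big)\Big]\longrightarrow 0\qquad(n\to\infty).$$ -/

import Mathlib

open MeasureTheory ProbabilityTheory Filter Asymptotics
open scoped NNReal ENNReal

noncomputable section

/-- The unit sphere `S^d` in `ℝ^(d+1)`. -/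
abbrev SphereD (d : ℕ) : Type :=
  Metric.sphere (0 : EuclideanSpace ℝ (Fin (d + 1))) 1

/-- The uniform probability measure on `S^d`: the normalized surface measure. -/
def unifSphere (d : ℕ) : Measure (SphereD d) :=
  ((volume : Measure (EuclideanSpace ℝ (Fin (d + 1)))).toSphere Set.univ)⁻¹ •
    (volume : Measure (EuclideanSpace ℝ (Fin (d + 1)))).toSphere

instance unifSphere_isProbabilityMeasure (d : ℕ) : IsProbabilityMeasure (unifSphere d) := by
  refine ⟨?_⟩
  simp only [unifSphere, Measure.smul_apply, smul_eq_mul]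
  refine ENNReal.inv_mul_cancel ?_ (measure_ne_top _ _)
  rw [Ne, Measure.measure_univ_eq_zero]
  exact Measure.toSphere_ne_zero _

/-! ### Spherical harmonics -/

/-- The Laplacian `∑ i, ∂²/∂x_i²` on polynomials in `d + 1` variables. -/
def polyLaplacian (d : ℕ) :
    MvPolynomial (Fin (d + 1)) ℝ →ₗ[ℝ] MvPolynomial (Fin (d + 1)) ℝ :=
  ∑ i : Fin (d + 1),
    (MvPolynomial.pderiv (R := ℝ) i).toLinearMap ∘ₗ (MvPolynomial.pderiv (R := ℝ) i).toLinearMap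

/-- Restriction of a polynomial in `d + 1` variables to the sphere. -/
def restrictToSphere (d : ℕ) : MvPolynomial (Fin (d + 1)) ℝ →ₗ[ℝ] (SphereD d → ℝ) :=
  LinearMap.pi fun x => (MvPolynomial.aeval (R := ℝ) fun i => x.1 i).toLinearMap

/-- The space of spherical harmonics of degree `ℓ` on `S^d`: the restrictions to the sphere of
the harmonic homogeneous polynomials of degree `ℓ`. -/
def sphericalHarmonics (d ℓ : ℕ) : Submodule ℝ (SphereD d → ℝ) :=
  (MvPolynomial.homogeneousSubmodule (Fin (d + 1)) ℝ ℓ ⊓ LinearMap.ker (polyLaplacian d)).map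
    (restrictToSphere d)

/-- The multiplicity `M_{d,ℓ}`. -/
def harmonicMult (d ℓ : ℕ) : ℕ := Module.finrank ℝ (sphericalHarmonics d ℓ)

/-- The eigenvalue `λ_ℓ = ℓ (ℓ + d - 1)` of `-Δ` on `S^d` (as a real number). -/
def lbEigenvalue (d ℓ : ℕ) : ℝ := (ℓ : ℝ) * ((ℓ : ℝ) + (d : ℝ) - 1)

/-- `Y ℓ m`, `m < M_{d,ℓ}`, is for every degree `ℓ` an orthonormal basis of the space of
spherical harmonics of degree `ℓ`, with respect to the uniform probability measure. -/
structure IsHarmonicBasis (d : ℕ) (Y : (ℓ : ℕ) → Fin (harmonicMult d ℓ) → SphereD d → ℝ) :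
    Prop where
  span_eq : ∀ ℓ, Submodule.span ℝ (Set.range (Y ℓ)) = sphericalHarmonics d ℓ
  orthonormal : ∀ ℓ m m',
    ∫ x, Y ℓ m x * Y ℓ m' x ∂(unifSphere d) = if m = m' then 1 else 0

/-- The harmonic coefficient `⟨f, Y_{ℓ,m}⟩` in `L²(S^d)`. -/
def harmonicCoeff {d : ℕ} (Y : (ℓ : ℕ) → Fin (harmonicMult d ℓ) → SphereD d → ℝ)
    (f : SphereD d → ℝ) (ℓ : ℕ) (m : Fin (harmonicMult d ℓ)) : ℝ :=
  ∫ x, f x * Y ℓ m x ∂(unifSphere d)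

/-- `f ∈ H^β(S^d)`: `f` is square integrable and
`∑_ℓ ∑_m (1 + λ_ℓ)^β ⟨f, Y_{ℓ,m}⟩² < ∞`. -/
def MemSobolevSphere {d : ℕ} (Y : (ℓ : ℕ) → Fin (harmonicMult d ℓ) → SphereD d → ℝ)
    (β : ℝ) (f : SphereD d → ℝ) : Prop :=
  MemLp f 2 (unifSphere d) ∧
    Summable fun ℓ : ℕ =>
      (1 + lbEigenvalue d ℓ) ^ β * ∑ m : Fin (harmonicMult d ℓ), harmonicCoeff Y f ℓ m ^ 2

/-! ### The regression model -/

/-- The law of one observation `(x, y)`, where `y = f₀(x) + ε`, `x` is uniform on the sphere and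
`ε` is an independent `N(0, σ²)` variable. -/
def obsLaw {d : ℕ} (σ : ℝ≥0) (f₀ : SphereD d → ℝ) : Measure (SphereD d × ℝ) :=
  ((unifSphere d).prod (gaussianReal 0 (σ ^ 2))).map fun p => (p.1, f₀ p.1 + p.2)

/-- The law of `n` independent observations. -/
def dataLaw {d : ℕ} (σ : ℝ≥0) (f₀ : SphereD d → ℝ) (n : ℕ) :
    Measure (Fin n → SphereD d × ℝ) :=
  Measure.pi fun _ => obsLaw σ f₀

/-! ### Truncated prior and posteriors -/

/-- The indices `(ℓ, m)` with `0 ≤ ℓ ≤ L` and `m` ranging over `M_{d,ℓ}` values. -/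
abbrev TruncIndex (d L : ℕ) : Type := (ℓ : Fin (L + 1)) × Fin (harmonicMult d ℓ)

/-- The function in the span of the harmonics of degree at most `L` with coefficients `a`. -/
def harmonicSum {d : ℕ} (Y : (ℓ : ℕ) → Fin (harmonicMult d ℓ) → SphereD d → ℝ) {L : ℕ}
    (a : TruncIndex d L → ℝ) (x : SphereD d) : ℝ :=
  ∑ i : TruncIndex d L, a i * Y i.1 i.2 x

/-- The Gaussian prior truncated at degree `L`, in coefficient space: the `a_{ℓ,m}` are
independent with law `N(0, C_ℓ)`. -/
def truncPrior (d : ℕ) (C : ℕ → ℝ≥0) (L : ℕ) : Measure (TruncIndex d L → ℝ) :=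
  Measure.pi fun i => gaussianReal 0 (C i.1)

/-- Bayes' rule: the posterior obtained from a prior and a likelihood function. -/
def bayesPosterior {Θ : Type*} [MeasurableSpace Θ] (prior : Measure Θ) (lik : Θ → ℝ≥0∞) :
    Measure Θ :=
  (∫⁻ θ, lik θ ∂prior)⁻¹ • prior.withDensity lik

/-- The likelihood of the responses given the design: `y_i` has law `N(f(x_i), σ²)`,
independently over `i`, where `f` has coefficients `a`. -/
def regressionLik {d : ℕ} (Y : (ℓ : ℕ) → Fin (harmonicMult d ℓ) → SphereD d → ℝ) (σ : ℝ≥0)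
    {n L : ℕ} (z : Fin n → SphereD d × ℝ) (a : TruncIndex d L → ℝ) : ℝ≥0∞ :=
  ∏ i : Fin n, gaussianPDF (harmonicSum Y a (z i).1) (σ ^ 2) (z i).2

/-- The posterior given `(y, x)` in the regression model, for the truncated prior. -/
def regressionPosterior {d : ℕ} (Y : (ℓ : ℕ) → Fin (harmonicMult d ℓ) → SphereD d → ℝ)
    (σ : ℝ≥0) (C : ℕ → ℝ≥0) (L : ℕ) {n : ℕ} (z : Fin n → SphereD d × ℝ) :
    Measure (TruncIndex d L → ℝ) :=
  bayesPosterior (truncPrior d C L) (regressionLik Y σ z)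

/-- The empirical harmonic coefficient `(1/n) ∑ i, y_i Y_{ℓ,m}(x_i)`. -/
def empCoeff {d : ℕ} (Y : (ℓ : ℕ) → Fin (harmonicMult d ℓ) → SphereD d → ℝ) {n : ℕ}
    (z : Fin n → SphereD d × ℝ) (ℓ : ℕ) (m : Fin (harmonicMult d ℓ)) : ℝ :=
  (n : ℝ)⁻¹ * ∑ i : Fin n, (z i).2 * Y ℓ m (z i).1

/-- The likelihood in harmonic coordinates (Gaussian sequence model): the empirical coefficients
have laws `N(a_{ℓ,m}, σ²/n)`, independently over `(ℓ, m)`. -/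
def sequenceLik {d : ℕ} (Y : (ℓ : ℕ) → Fin (harmonicMult d ℓ) → SphereD d → ℝ) (σ : ℝ≥0)
    {n L : ℕ} (z : Fin n → SphereD d × ℝ) (a : TruncIndex d L → ℝ) : ℝ≥0∞ :=
  ∏ i : TruncIndex d L, gaussianPDF (a i) (σ ^ 2 / n) (empCoeff Y z i.1 i.2)

/-- The posterior for the truncated prior and the likelihood in harmonic coordinates, evaluated at
the empirical coefficients of the data. -/
def sequencePosterior {d : ℕ} (Y : (ℓ : ℕ) → Fin (harmonicMult d ℓ) → SphereD d → ℝ)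
    (σ : ℝ≥0) (C : ℕ → ℝ≥0) (L : ℕ) {n : ℕ} (z : Fin n → SphereD d × ℝ) :
    Measure (TruncIndex d L → ℝ) :=
  bayesPosterior (truncPrior d C L) (sequenceLik Y σ z)

/-- The set of coefficient vectors `a` with `‖f_a - f₀‖ > r` in `L²(S^d)`. -/
def farSet {d : ℕ} (Y : (ℓ : ℕ) → Fin (harmonicMult d ℓ) → SphereD d → ℝ) (L : ℕ)
    (f₀ : SphereD d → ℝ) (r : ℝ) : Set (TruncIndex d L → ℝ) :=
  {a | ENNReal.ofReal r < eLpNorm (fun x => harmonicSum Y a x - f₀ x) 2 (unifSphere d)}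

end

/-! Let `a₀` be the coefficients of f₀ up to degree L and h = a - a₀. In both models the
log-likelihood is B·h - q(h)/2 up to a constant, with q a quadratic form. The Gaussian prior only
changes B into b = B - a₀/C and adds a nonnegative term to q. If q(h) ≥ κ|h|², then in dimension D
the posterior mass of {|h|² > r} is at most 2^D exp(|b|²/κ - κr/8) (`bayesPosterior_tail_le`). The
proof compares Gaussian integrals: absorb b·h into q/4 on the tail, rescale h by 2, and bound the
normalising integral below by symmetrising h ↦ -h. No formula for the posterior mean or covariance
is needed.

Here κ = n/(2σ²) and r is of order M²ρ². Put N = n^(d/(2α+d)) and R = nρ², so that N ≤ R because β ≤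
α. It remains to see that D, |B|²/n and |a₀/C|²/n are all O(R); a large M then makes the exponent at
most -R (`tail_le_exp_neg`). The bound on a₀/C and the truncation error follow from the Sobolev
condition, and D = O(N) from a monomial count (`exists_rate_constants`).

The score B is a sum of n independent vectors w·(ψ_i(x))_i, centred in total. Since ∑ψ_i² ≤ D
pointwise, its squared norm has mean O(nD). When β = α this is already the critical order nR, so
Markov's inequality would leave a fixed positive probability. Chebyshev's inequality for the squared
norm (`measure_norm_sum_sq_gt_le`) gives probability O(1/N + 1/n), because the variance in each
direction stays bounded as D grows. It needs fourth moments, which f₀ may lack, so the weight is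
split into a bounded function plus noise and a remainder small in L², to which Markov applies. In
the regression model the remainder is the truncation error; in harmonic coordinates it is f₀ minus a
bounded cut-off, and an ε-argument finishes.

In the regression model q comes from the random Gram matrix of the design, within n/2 of n·Id in
Hilbert–Schmidt norm outside an event of probability O(D²/n). This tends to 0 because α > d/2.

The facts on spherical harmonics are obtained by integrating polynomials against a Gaussian weight:
integration by parts gives orthogonality of different degrees and the splitting of a form into a
harmonic one and a multiple of |x|². Hence the harmonics of degree at most L span the restrictions
of all polynomials of degree at most L (`IsHarmonicBasis.span_truncFamily`), from which the
pointwise bound, the dimension count and completeness are derived. -/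

noncomputable section

/-! ### The Gaussian functional on polynomials -/

section GaussFunctional

variable {κ : Type*} [Fintype κ]

/-- The moments of the (unnormalised) standard Gaussian weight on the line. -/
def gaussMoment (m : ℕ) : ℝ := ∫ t : ℝ, t ^ m * Real.exp (-(1 / 2) * t ^ 2)

lemma integrable_pow_mul_gauss (m : ℕ) :
    Integrable fun t : ℝ => t ^ m * Real.exp (-(1 / 2) * t ^ 2) := by
  have h := integrable_rpow_mul_exp_neg_mul_sq (b := 1 / 2) (by norm_num) (s := m)
    (by have : (0 : ℝ) ≤ m := m.cast_nonneg
        linarith)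
  simpa using h

/-- The derivative of t^m exp(-t²/2) has integral zero. For m = 0 the truncated m - 1 is harmless
because its coefficient vanishes. -/
lemma gaussMoment_recurrence (m : ℕ) :
    gaussMoment (m + 1) = m * gaussMoment (m - 1) := by
  have hd : ∀ t : ℝ, HasDerivAt (fun t : ℝ => t ^ m * Real.exp (-(1 / 2) * t ^ 2))
      (m * (t ^ (m - 1) * Real.exp (-(1 / 2) * t ^ 2)) -
        t ^ (m + 1) * Real.exp (-(1 / 2) * t ^ 2)) t := by
    intro t
    have h1 := hasDerivAt_pow m t
    have h2 := (((hasDerivAt_pow 2 t).const_mul (-(1 / 2) : ℝ)).exp)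
    refine (h1.fun_mul h2).congr_deriv ?_
    push_cast
    rw [pow_succ]
    ring
  have hi1 := (integrable_pow_mul_gauss (m - 1)).const_mul (m : ℝ)
  have hi2 := integrable_pow_mul_gauss (m + 1)
  have h := integral_eq_zero_of_hasDerivAt_of_integrable hd (hi1.sub hi2)
    (integrable_pow_mul_gauss m)
  rw [integral_sub hi1 hi2, integral_const_mul] at h
  unfold gaussMoment
  linarith

/-- The Gaussian weight on `ℝ^κ`. -/
def gaussWeight (x : κ → ℝ) : ℝ := ∏ i, Real.exp (-(1 / 2) * x i ^ 2)

lemma gaussWeight_pos (x : κ → ℝ) : 0 < gaussWeight x :=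
  Finset.prod_pos fun _ _ => Real.exp_pos _

lemma monomial_eval_mul_gaussWeight (s : κ →₀ ℕ) (c : ℝ) (x : κ → ℝ) :
    MvPolynomial.eval x (MvPolynomial.monomial s c) * gaussWeight x =
      c * ∏ i, (x i ^ s i * Real.exp (-(1 / 2) * x i ^ 2)) := by
  rw [MvPolynomial.eval_monomial, Finsupp.prod_fintype _ _ (by simp), gaussWeight, mul_assoc,
    Finset.prod_mul_distrib]

lemma integrable_poly_mul_gaussWeight (p : MvPolynomial κ ℝ) :
    Integrable fun x : κ → ℝ => MvPolynomial.eval x p * gaussWeight x := by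
  induction p using MvPolynomial.induction_on' with
  | monomial s c =>
    simp_rw [monomial_eval_mul_gaussWeight]
    exact (Integrable.fintype_prod (f := fun i (t : ℝ) => t ^ s i * Real.exp (-(1 / 2) * t ^ 2))
      fun i => integrable_pow_mul_gauss (s i)).const_mul c
  | add p q hp hq =>
    simp only [map_add, add_mul]
    exact hp.add hq

/-- The integral of a polynomial against the Gaussian weight. -/
def gaussFunctional : MvPolynomial κ ℝ →ₗ[ℝ] ℝ where
  toFun p := ∫ x : κ → ℝ, MvPolynomial.eval x p * gaussWeight x
  map_add' p q := by
    simp only [map_add, add_mul]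
    exact integral_add (integrable_poly_mul_gaussWeight p) (integrable_poly_mul_gaussWeight q)
  map_smul' c p := by
    simp only [MvPolynomial.smul_eval, mul_assoc, RingHom.id_apply, smul_eq_mul]
    exact integral_const_mul _ _

lemma gaussFunctional_apply (p : MvPolynomial κ ℝ) :
    gaussFunctional p = ∫ x : κ → ℝ, MvPolynomial.eval x p * gaussWeight x := rfl

lemma gaussFunctional_monomial (s : κ →₀ ℕ) (c : ℝ) :
    gaussFunctional (MvPolynomial.monomial s c) = c * ∏ i, gaussMoment (s i) := by
  rw [gaussFunctional_apply]
  simp_rw [monomial_eval_mul_gaussWeight]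
  rw [integral_const_mul]
  congr 1
  exact integral_fintype_prod_volume_eq_prod
    (fun i (t : ℝ) => t ^ s i * Real.exp (-(1 / 2) * t ^ 2))

/-- Gaussian integration by parts. -/
lemma gaussFunctional_X_mul (i : κ) (p : MvPolynomial κ ℝ) :
    gaussFunctional (MvPolynomial.X i * p) = gaussFunctional (MvPolynomial.pderiv i p) := by
  classical
  induction p using MvPolynomial.induction_on' with
  | monomial s c =>
    rw [MvPolynomial.pderiv_monomial, MvPolynomial.X, MvPolynomial.monomial_mul,
      gaussFunctional_monomial, gaussFunctional_monomial,
      ← Finset.mul_prod_erase _ _ (Finset.mem_univ i),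
      ← Finset.mul_prod_erase Finset.univ
        (fun j => gaussMoment ((s - Finsupp.single i 1 : κ →₀ ℕ) j)) (Finset.mem_univ i)]
    have h1 : ∏ j ∈ Finset.univ.erase i, gaussMoment ((Finsupp.single i 1 + s : κ →₀ ℕ) j) =
        ∏ j ∈ Finset.univ.erase i, gaussMoment (s j) :=
      Finset.prod_congr rfl fun j hj => by
        simp [(Finset.ne_of_mem_erase hj).symm]
    have h2 : ∏ j ∈ Finset.univ.erase i, gaussMoment ((s - Finsupp.single i 1 : κ →₀ ℕ) j) =
        ∏ j ∈ Finset.univ.erase i, gaussMoment (s j) :=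
      Finset.prod_congr rfl fun j hj => by
        simp [(Finset.ne_of_mem_erase hj).symm]
    rw [h1, h2]
    have h3 : (Finsupp.single i 1 + s : κ →₀ ℕ) i = s i + 1 := by simp [add_comm]
    have h4 : (s - Finsupp.single i 1 : κ →₀ ℕ) i = s i - 1 := by simp
    rw [h3, h4, gaussMoment_recurrence]
    ring
  | add p q hp hq => simp only [mul_add, map_add, hp, hq]

/-- A continuous nonnegative integrand with zero integral vanishes everywhere, and a real polynomial
vanishing everywhere is zero. -/
lemma gaussFunctional_sq_eq_zero {p : MvPolynomial κ ℝ} {w : MvPolynomial κ ℝ}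
    (hw : ∀ x : κ → ℝ, 0 ≤ MvPolynomial.eval x w)
    (h : gaussFunctional (w * p ^ 2) = 0) : w * p ^ 2 = 0 := by
  have hc : Continuous fun x : κ → ℝ => MvPolynomial.eval x (w * p ^ 2) * gaussWeight x := by
    refine (MvPolynomial.continuous_eval _).mul ?_
    unfold gaussWeight
    fun_prop
  have h0 : 0 ≤ fun x : κ → ℝ => MvPolynomial.eval x (w * p ^ 2) * gaussWeight x := by
    intro x
    have := hw x
    have := (gaussWeight_pos x).le
    simp only [Pi.zero_apply, map_mul, map_pow]
    positivity
  rw [gaussFunctional_apply,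
    integral_eq_zero_iff_of_nonneg h0 (integrable_poly_mul_gaussWeight _)] at h
  have h' := (Continuous.ae_eq_iff_eq volume hc continuous_const).1 h
  refine MvPolynomial.funext fun x => ?_
  have h1 : MvPolynomial.eval x (w * p ^ 2) * gaussWeight x = 0 := congrFun h' x
  simpa using (mul_eq_zero.1 h1).resolve_right (gaussWeight_pos x).ne'

/-- The Laplacian of a polynomial. -/
def mvLaplacian (p : MvPolynomial κ ℝ) : MvPolynomial κ ℝ :=
  ∑ i, MvPolynomial.pderiv i (MvPolynomial.pderiv i p)

/-- Euler's identity writes k·p as ∑ x_i ∂_i p; integrating each x_i by parts leaves the gradient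
pairing plus a term containing Δp = 0. -/
lemma gaussFunctional_harmonic_mul {k : ℕ} {p : MvPolynomial κ ℝ} (hp : p.IsHomogeneous k)
    (hΔ : mvLaplacian p = 0) (q : MvPolynomial κ ℝ) :
    k * gaussFunctional (p * q) =
      ∑ i, gaussFunctional (MvPolynomial.pderiv i p * MvPolynomial.pderiv i q) := by
  have h1 : (k : ℝ) * gaussFunctional (p * q) =
      ∑ i, gaussFunctional (MvPolynomial.X i * (MvPolynomial.pderiv i p * q)) := by
    rw [← smul_eq_mul, ← map_smul, ← map_sum]
    congr 1
    simp_rw [← mul_assoc]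
    rw [← Finset.sum_mul, hp.sum_X_mul_pderiv, Nat.cast_smul_eq_nsmul, smul_mul_assoc]
  have h2 : ∑ i, gaussFunctional (MvPolynomial.pderiv i (MvPolynomial.pderiv i p) * q) = 0 := by
    rw [← map_sum, ← Finset.sum_mul]
    change gaussFunctional (mvLaplacian p * q) = 0
    rw [hΔ, zero_mul, map_zero]
  rw [h1, ← add_zero (∑ i, gaussFunctional (MvPolynomial.pderiv i p * MvPolynomial.pderiv i q)),
    ← h2, ← Finset.sum_add_distrib]
  refine Finset.sum_congr rfl fun i _ => ?_
  rw [gaussFunctional_X_mul, Derivation.leibniz, map_add, smul_eq_mul, smul_eq_mul,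
    mul_comm q]

/-- The gradient pairing is symmetric, so it equals both k and l times the same number. -/
lemma gaussFunctional_harmonic_orthogonal {k l : ℕ} (hkl : k ≠ l) {p q : MvPolynomial κ ℝ}
    (hp : p.IsHomogeneous k) (hpΔ : mvLaplacian p = 0)
    (hq : q.IsHomogeneous l) (hqΔ : mvLaplacian q = 0) :
    gaussFunctional (p * q) = 0 := by
  have h1 := gaussFunctional_harmonic_mul hp hpΔ q
  have h2 := gaussFunctional_harmonic_mul hq hqΔ p
  rw [mul_comm q p] at h2
  simp_rw [mul_comm (MvPolynomial.pderiv _ q)] at h2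
  rw [← h1] at h2
  have h3 : ((l : ℝ) - k) * gaussFunctional (p * q) = 0 := by linarith
  refine (mul_eq_zero.1 h3).resolve_left ?_
  exact sub_ne_zero.2 (by exact_mod_cast hkl.symm)

lemma mvLaplacian_pderiv (i : κ) (p : MvPolynomial κ ℝ) :
    mvLaplacian (MvPolynomial.pderiv i p) = MvPolynomial.pderiv i (mvLaplacian p) := by
  unfold mvLaplacian
  rw [map_sum]
  refine Finset.sum_congr rfl fun j _ => ?_
  have hcomm : ∀ r : MvPolynomial κ ℝ, MvPolynomial.pderiv j (MvPolynomial.pderiv i r) =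
      MvPolynomial.pderiv i (MvPolynomial.pderiv j r) := by
    intro r
    -- The commutator of two derivations is a derivation, so it is enough to check it on the
    -- variables.
    have : ⁅MvPolynomial.pderiv (R := ℝ) j, MvPolynomial.pderiv (R := ℝ) i⁆ = 0 := by
      classical
      refine MvPolynomial.derivation_ext fun k => ?_
      simp only [Derivation.commutator_apply, MvPolynomial.pderiv_X, Pi.single_apply]
      split_ifs <;> simp
    have h := congrArg (fun D => D r) this
    simpa [Derivation.commutator_apply, sub_eq_zero] using h
  rw [hcomm, hcomm]

/-- The gradient identity lowers both degrees by one and keeps the first factor harmonic; after j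
steps the second factor is a constant, whose gradient is zero. Here r need not be harmonic. -/
lemma gaussFunctional_harmonic_mul_lower {j k : ℕ} (hjk : j < k) {p r : MvPolynomial κ ℝ}
    (hp : p.IsHomogeneous k) (hpΔ : mvLaplacian p = 0) (hr : r.IsHomogeneous j) :
    gaussFunctional (p * r) = 0 := by
  have hk : (k : ℝ) ≠ 0 := by
    have : k ≠ 0 := by omega
    exact_mod_cast this
  induction j generalizing k p r with
  | zero =>
    have h := gaussFunctional_harmonic_mul hp hpΔ r
    have hr' : ∀ i, MvPolynomial.pderiv i r = 0 := by
      intro i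
      have hc := MvPolynomial.totalDegree_eq_zero_iff_eq_C.1
        (Nat.le_zero.1 hr.totalDegree_le)
      rw [hc, MvPolynomial.pderiv_C]
    simp only [hr', mul_zero, map_zero, Finset.sum_const_zero] at h
    exact (mul_eq_zero.1 h).resolve_left hk
  | succ j ih =>
    have h := gaussFunctional_harmonic_mul hp hpΔ r
    have h0 : ∀ i, gaussFunctional (MvPolynomial.pderiv i p * MvPolynomial.pderiv i r) = 0 := by
      intro i
      refine ih (k := k - 1) (by omega) (hp.pderiv) ?_ (by simpa using hr.pderiv (i := i)) ?_
      · rw [mvLaplacian_pderiv, hpΔ, map_zero]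
      · have : k - 1 ≠ 0 := by omega
        exact_mod_cast this
    simp only [h0, Finset.sum_const_zero] at h
    exact (mul_eq_zero.1 h).resolve_left hk

end GaussFunctional

/-! ### The harmonic decomposition -/

/-- The polynomial `∑ i, x_i²`. -/
def normSqPoly (κ : Type*) [Fintype κ] : MvPolynomial κ ℝ := ∑ i, MvPolynomial.X i ^ 2

lemma normSqPoly_isHomogeneous (κ : Type*) [Fintype κ] : (normSqPoly κ).IsHomogeneous 2 :=
  MvPolynomial.IsHomogeneous.sum _ _ _ fun i _ => by
    simpa using (MvPolynomial.isHomogeneous_X ℝ i).pow 2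

lemma normSqPoly_ne_zero (κ : Type*) [Fintype κ] [Nonempty κ] : normSqPoly κ ≠ 0 := by
  intro h
  have := congrArg (MvPolynomial.eval fun _ : κ => (1 : ℝ)) h
  simp [normSqPoly] at this

/-- The Laplacian as a linear map. -/
def mvLaplacianₗ (κ : Type*) [Fintype κ] : MvPolynomial κ ℝ →ₗ[ℝ] MvPolynomial κ ℝ where
  toFun := mvLaplacian
  map_add' p q := by simp [mvLaplacian, Finset.sum_add_distrib]
  map_smul' c p := by simp [mvLaplacian, Finset.smul_sum]

lemma mvLaplacian_isHomogeneous {κ : Type*} [Fintype κ] {k : ℕ} {p : MvPolynomial κ ℝ}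
    (hp : p.IsHomogeneous (k + 2)) : (mvLaplacian p).IsHomogeneous k :=
  MvPolynomial.IsHomogeneous.sum _ _ _ fun i _ => by
    simpa using (hp.pderiv (i := i)).pderiv (i := i)

/-- It suffices to solve Δ(|x|² r) = Δp for r of degree k. The map r ↦ Δ(|x|² r) acts on a
finite-dimensional space, so injectivity is enough: if |x|² r is harmonic, it is orthogonal to the
lower-degree r, so |x|² r² has Gaussian integral zero and r = 0. -/
lemma exists_harmonic_add_normSq_mul {κ : Type*} [Fintype κ] [Nonempty κ] {k : ℕ}
    {p : MvPolynomial κ ℝ} (hp : p.IsHomogeneous (k + 2)) :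
    ∃ h r : MvPolynomial κ ℝ, h.IsHomogeneous (k + 2) ∧ mvLaplacian h = 0 ∧ r.IsHomogeneous k ∧
      p = h + normSqPoly κ * r := by
  let V := MvPolynomial.homogeneousSubmodule κ ℝ k
  have hV : ∀ r : V, (normSqPoly κ * r.1).IsHomogeneous (k + 2) := by
    intro r
    have := (normSqPoly_isHomogeneous κ).mul
      ((MvPolynomial.mem_homogeneousSubmodule _ _).1 r.2)
    rwa [add_comm] at this
  let T : V →ₗ[ℝ] V := LinearMap.codRestrict V
    (mvLaplacianₗ κ ∘ₗ LinearMap.mulLeft ℝ (normSqPoly κ) ∘ₗ V.subtype)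
    (fun r => (MvPolynomial.mem_homogeneousSubmodule _ _).2 (mvLaplacian_isHomogeneous (hV r)))
  have hT : Function.Injective T := by
    rw [← LinearMap.ker_eq_bot, LinearMap.ker_eq_bot']
    intro r hr
    have h0 : mvLaplacian (normSqPoly κ * r.1) = 0 := congrArg Subtype.val hr
    have h1 := gaussFunctional_harmonic_mul_lower (by omega) (hV r) h0
      ((MvPolynomial.mem_homogeneousSubmodule _ _).1 r.2)
    rw [mul_assoc, ← pow_two] at h1
    have h2 := gaussFunctional_sq_eq_zero (fun x => by
      simp only [normSqPoly, map_sum, map_pow]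
      positivity) h1
    have h3 := (mul_eq_zero.1 h2).resolve_left (normSqPoly_ne_zero κ)
    exact Subtype.ext (pow_eq_zero_iff (by norm_num) |>.1 h3)
  have : Module.Finite ℝ V := Module.Finite.iff_fg.2 (MvPolynomial.homogeneousSubmodule_fg κ ℝ k)
  obtain ⟨r, hr⟩ := (LinearMap.injective_iff_surjective.1 hT)
    ⟨mvLaplacian p, (MvPolynomial.mem_homogeneousSubmodule _ _).2 (mvLaplacian_isHomogeneous hp)⟩
  have hr' : mvLaplacian (normSqPoly κ * r.1) = mvLaplacian p := congrArg Subtype.val hr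
  refine ⟨p - normSqPoly κ * r.1, r.1, hp.sub (hV r), ?_,
    (MvPolynomial.mem_homogeneousSubmodule _ _).1 r.2, by ring⟩
  change mvLaplacianₗ κ _ = 0
  rw [map_sub]
  exact sub_eq_zero.2 hr'.symm

/-! ### Integration of polynomials over the sphere -/

lemma restrictToSphere_apply (d : ℕ) (p : MvPolynomial (Fin (d + 1)) ℝ) (x : SphereD d) :
    restrictToSphere d p x = MvPolynomial.eval (fun i => x.1 i) p := by
  simp [restrictToSphere, MvPolynomial.aeval_eq_eval]

lemma restrictToSphere_mul (d : ℕ) (p q : MvPolynomial (Fin (d + 1)) ℝ) :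
    restrictToSphere d (p * q) = restrictToSphere d p * restrictToSphere d q := by
  ext x
  simp [restrictToSphere_apply]

lemma continuous_restrictToSphere (d : ℕ) (p : MvPolynomial (Fin (d + 1)) ℝ) :
    Continuous (restrictToSphere d p) := by
  have h : restrictToSphere d p = fun x : SphereD d => MvPolynomial.eval (fun i => x.1 i) p :=
    funext fun x => restrictToSphere_apply d p x
  rw [h]
  exact (MvPolynomial.continuous_eval p).comp (by fun_prop)

lemma polyLaplacian_apply (d : ℕ) (p : MvPolynomial (Fin (d + 1)) ℝ) :
    polyLaplacian d p = mvLaplacian p := by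
  simp [polyLaplacian, mvLaplacian]

lemma eval_smul_of_isHomogeneous {κ : Type*} [Fintype κ] {k : ℕ} {p : MvPolynomial κ ℝ}
    (hp : p.IsHomogeneous k) (r : ℝ) (x : κ → ℝ) :
    MvPolynomial.eval (fun i => r * x i) p = r ^ k * MvPolynomial.eval x p := by
  rw [MvPolynomial.eval_eq', MvPolynomial.eval_eq', Finset.mul_sum]
  refine Finset.sum_congr rfl fun s hs => ?_
  have hk : ∑ i, s i = k := by
    have := hp (MvPolynomial.mem_support_iff.1 hs)
    rwa [show (1 : κ → ℕ) = fun _ => 1 from rfl, ← Finsupp.degree_eq_weight_one,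
      Finsupp.degree_eq_sum] at this
  simp_rw [mul_pow]
  rw [Finset.prod_mul_distrib, Finset.prod_pow_eq_pow_sum, hk]
  ring

lemma gaussWeight_eq_exp_norm {d : ℕ} (x : EuclideanSpace ℝ (Fin (d + 1))) :
    gaussWeight (fun i => x i) = Real.exp (-(1 / 2) * ‖x‖ ^ 2) := by
  rw [gaussWeight, ← Real.exp_sum, EuclideanSpace.norm_sq_eq, Finset.mul_sum]
  simp

/-- Positivity allows division by the radial factor in polar coordinates, so that vanishing Gaussian
integrals give vanishing sphere integrals. -/
lemma radial_moment_pos (d k : ℕ) :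
    0 < ∫ r : Set.Ioi (0 : ℝ), r.1 ^ k * Real.exp (-(1 / 2) * r.1 ^ 2)
      ∂(Measure.volumeIoiPow d) := by
  have h : ∫ r : Set.Ioi (0 : ℝ), r.1 ^ k * Real.exp (-(1 / 2) * r.1 ^ 2)
      ∂(Measure.volumeIoiPow d) =
      ∫ r in Set.Ioi (0 : ℝ), r ^ ((d + k : ℕ) : ℝ) * Real.exp (-(1 / 2) * r ^ (2 : ℝ)) := by
    simp only [Measure.volumeIoiPow, ENNReal.ofReal]
    rw [integral_withDensity_eq_integral_smul,
      integral_subtype_comap measurableSet_Ioi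
        fun a : ℝ => Real.toNNReal (a ^ d) • (a ^ k * Real.exp (-(1 / 2) * a ^ 2)),
      setIntegral_congr_fun measurableSet_Ioi fun x hx => ?_]
    · rw [NNReal.smul_def, Real.coe_toNNReal _ (pow_nonneg hx.out.le _), Real.rpow_natCast,
        pow_add, smul_eq_mul, mul_assoc, Real.rpow_two]
    · exact (measurable_subtype_coe.pow_const _).real_toNNReal
  have hq : (-1 : ℝ) < ((d + k : ℕ) : ℝ) := by
    have : (0 : ℝ) ≤ ((d + k : ℕ) : ℝ) := Nat.cast_nonneg _
    linarith
  rw [h, integral_rpow_mul_exp_neg_mul_rpow (by norm_num) hq (by norm_num)]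
  have : 0 < Real.Gamma ((((d + k : ℕ) : ℝ) + 1) / 2) := Real.Gamma_pos_of_pos (by linarith)
  positivity

/-- Polar coordinates for the Gaussian functional of a homogeneous polynomial. -/
lemma gaussFunctional_eq_mul_integral_toSphere {d k : ℕ} {p : MvPolynomial (Fin (d + 1)) ℝ}
    (hp : p.IsHomogeneous k) :
    gaussFunctional p =
      (∫ x, restrictToSphere d p x
        ∂((volume : Measure (EuclideanSpace ℝ (Fin (d + 1)))).toSphere)) *
      ∫ r : Set.Ioi (0 : ℝ), r.1 ^ k * Real.exp (-(1 / 2) * r.1 ^ 2)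
        ∂(Measure.volumeIoiPow d) := by
  let E := EuclideanSpace ℝ (Fin (d + 1))
  let F : E → ℝ := fun x => MvPolynomial.eval (fun i => x i) p * gaussWeight (fun i => x i)
  have h1 : gaussFunctional p = ∫ x : E, F x := by
    rw [gaussFunctional_apply]
    exact ((EuclideanSpace.volume_preserving_symm_measurableEquiv_toLp (Fin (d + 1))).integral_comp'
      (fun x : Fin (d + 1) → ℝ => MvPolynomial.eval x p * gaussWeight x)).symm
  -- Polar coordinates live on the complement of the origin, a null set.
  have h2 : ∫ x : E, F x = ∫ x : ({(0)}ᶜ : Set E), F x.1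
      ∂(Measure.comap Subtype.val volume) := by
    rw [integral_subtype_comap (measurableSet_singleton _).compl F, restrict_compl_singleton]
  have h3 := (volume : Measure E).measurePreserving_homeomorphUnitSphereProd.integral_comp
    (Homeomorph.measurableEmbedding _)
    (fun z : SphereD d × Set.Ioi (0 : ℝ) => F (z.2.1 • z.1.1))
  have hdim : Module.finrank ℝ E - 1 = d := by simp [E]
  have h4 : ∀ x : ({(0)}ᶜ : Set E), F x.1 =
      F (((homeomorphUnitSphereProd E x).2.1) • ((homeomorphUnitSphereProd E x).1.1)) := by
    intro x
    congr 1
    exact (congrArg Subtype.val ((homeomorphUnitSphereProd E).symm_apply_apply x)).symm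
  rw [h1, h2, integral_congr_ae (Eventually.of_forall h4), h3, hdim, ← integral_prod_mul]
  refine integral_congr_ae (Eventually.of_forall fun z => ?_)
  obtain ⟨x, r⟩ := z
  have hx : ‖x.1‖ = 1 := by simp
  have hr : ‖r.1‖ = r.1 := Real.norm_of_nonneg r.2.out.le
  simp only [F]
  rw [gaussWeight_eq_exp_norm, norm_smul, hx, mul_one, hr, restrictToSphere_apply]
  have hh : MvPolynomial.eval (fun i => (r.1 • x.1) i) p =
      r.1 ^ k * MvPolynomial.eval (fun i => x.1 i) p := by
    exact eval_smul_of_isHomogeneous hp r.1 fun i => x.1 i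
  rw [hh]
  ring

lemma integral_unifSphere (d : ℕ) (f : SphereD d → ℝ) :
    ∫ x, f x ∂(unifSphere d) =
      (((volume : Measure (EuclideanSpace ℝ (Fin (d + 1)))).toSphere Set.univ)⁻¹).toReal *
      ∫ x, f x ∂((volume : Measure (EuclideanSpace ℝ (Fin (d + 1)))).toSphere) := by
  rw [unifSphere, integral_smul_measure, smul_eq_mul]

lemma integral_unifSphere_eq_zero_of_gaussFunctional {d k : ℕ}
    {p : MvPolynomial (Fin (d + 1)) ℝ} (hp : p.IsHomogeneous k) (h : gaussFunctional p = 0) :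
    ∫ x, restrictToSphere d p x ∂(unifSphere d) = 0 := by
  rw [gaussFunctional_eq_mul_integral_toSphere hp] at h
  rw [integral_unifSphere, (mul_eq_zero.1 h).resolve_right (radial_moment_pos d k).ne', mul_zero]

lemma mem_sphericalHarmonics {d ℓ : ℕ} {f : SphereD d → ℝ} :
    f ∈ sphericalHarmonics d ℓ ↔ ∃ p : MvPolynomial (Fin (d + 1)) ℝ, p.IsHomogeneous ℓ ∧
      mvLaplacian p = 0 ∧ restrictToSphere d p = f := by
  simp only [sphericalHarmonics, Submodule.mem_map, Submodule.mem_inf, LinearMap.mem_ker,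
    MvPolynomial.mem_homogeneousSubmodule, polyLaplacian_apply, and_assoc]

lemma sphericalHarmonics_orthogonal {d k l : ℕ} (hkl : k ≠ l) {f g : SphereD d → ℝ}
    (hf : f ∈ sphericalHarmonics d k) (hg : g ∈ sphericalHarmonics d l) :
    ∫ x, f x * g x ∂(unifSphere d) = 0 := by
  obtain ⟨p, hp, hpΔ, rfl⟩ := mem_sphericalHarmonics.1 hf
  obtain ⟨q, hq, hqΔ, rfl⟩ := mem_sphericalHarmonics.1 hg
  have h := integral_unifSphere_eq_zero_of_gaussFunctional (hp.mul hq)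
    (gaussFunctional_harmonic_orthogonal hkl hp hpΔ hq hqΔ)
  simpa [restrictToSphere_mul] using h

/-! ### Truncated harmonic families -/

section Basis

variable {d : ℕ} {Y : (ℓ : ℕ) → Fin (harmonicMult d ℓ) → SphereD d → ℝ}

lemma IsHarmonicBasis.mem (hY : IsHarmonicBasis d Y) (ℓ : ℕ) (m : Fin (harmonicMult d ℓ)) :
    Y ℓ m ∈ sphericalHarmonics d ℓ := by
  rw [← hY.span_eq]
  exact Submodule.subset_span ⟨m, rfl⟩

lemma IsHarmonicBasis.continuous (hY : IsHarmonicBasis d Y) (ℓ : ℕ)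
    (m : Fin (harmonicMult d ℓ)) : Continuous (Y ℓ m) := by
  obtain ⟨p, -, -, h⟩ := mem_sphericalHarmonics.1 (hY.mem ℓ m)
  rw [← h]
  exact continuous_restrictToSphere d p

lemma IsHarmonicBasis.integral_mul (hY : IsHarmonicBasis d Y)
    (i j : (ℓ : ℕ) × Fin (harmonicMult d ℓ)) [Decidable (i = j)] :
    ∫ x, Y i.1 i.2 x * Y j.1 j.2 x ∂(unifSphere d) = if i = j then 1 else 0 := by
  obtain ⟨k, m⟩ := i
  obtain ⟨l, m'⟩ := j
  by_cases hkl : k = l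
  · subst hkl
    rw [hY.orthonormal]
    simp
  · rw [sphericalHarmonics_orthogonal hkl (hY.mem k m) (hY.mem l m'), if_neg]
    intro h
    exact hkl (congrArg Sigma.fst h)

/-- The harmonics of degree at most `L`, as a family indexed by `TruncIndex d L`. -/
def truncFamily (Y : (ℓ : ℕ) → Fin (harmonicMult d ℓ) → SphereD d → ℝ) (L : ℕ)
    (i : TruncIndex d L) : SphereD d → ℝ := Y i.1 i.2

lemma IsHarmonicBasis.truncFamily_integral_mul (hY : IsHarmonicBasis d Y) (L : ℕ)
    (i j : TruncIndex d L) :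
    ∫ x, truncFamily Y L i x * truncFamily Y L j x ∂(unifSphere d) = if i = j then 1 else 0 := by
  classical
  have h := hY.integral_mul ⟨i.1, i.2⟩ ⟨j.1, j.2⟩
  simp only [truncFamily]
  rw [h]
  congr 1
  obtain ⟨⟨k, hk⟩, m⟩ := i
  obtain ⟨⟨l, hl⟩, m'⟩ := j
  simp

lemma IsHarmonicBasis.continuous_truncFamily (hY : IsHarmonicBasis d Y) (L : ℕ)
    (i : TruncIndex d L) : Continuous (truncFamily Y L i) := hY.continuous _ _

lemma IsHarmonicBasis.sphericalHarmonics_le_span (hY : IsHarmonicBasis d Y) {ℓ L : ℕ}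
    (h : ℓ ≤ L) : sphericalHarmonics d ℓ ≤ Submodule.span ℝ (Set.range (truncFamily Y L)) := by
  rw [← hY.span_eq]
  refine Submodule.span_mono ?_
  rintro _ ⟨m, rfl⟩
  exact ⟨⟨⟨ℓ, Nat.lt_succ_of_le h⟩, m⟩, rfl⟩

lemma restrictToSphere_normSqPoly_mul (p : MvPolynomial (Fin (d + 1)) ℝ) :
    restrictToSphere d (normSqPoly (Fin (d + 1)) * p) = restrictToSphere d p := by
  ext x
  have hx : ‖x.1‖ = 1 := by simp
  have h : ∑ i, x.1 i ^ 2 = 1 := by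
    have := EuclideanSpace.norm_sq_eq x.1
    rw [hx] at this
    simpa using this.symm
  simp [restrictToSphere_apply, normSqPoly, h]

/-- Each use of the decomposition peels off a harmonic form; the factor |x|² is 1 on the sphere, so
what remains has degree k - 2. -/
lemma IsHarmonicBasis.restrict_homogeneous_mem_span (hY : IsHarmonicBasis d Y) {L : ℕ} (k : ℕ)
    (hk : k ≤ L) (p : MvPolynomial (Fin (d + 1)) ℝ) (hp : p.IsHomogeneous k) :
    restrictToSphere d p ∈ Submodule.span ℝ (Set.range (truncFamily Y L)) := by
  induction k using Nat.strong_induction_on generalizing p with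
  | _ k ih =>
    rcases Nat.lt_or_ge k 2 with h2 | h2
    -- Forms of degree 0 or 1 are harmonic, since their first derivatives are constants.
    · refine hY.sphericalHarmonics_le_span hk (mem_sphericalHarmonics.2 ⟨p, hp, ?_, rfl⟩)
      refine Finset.sum_eq_zero fun i _ => ?_
      have h0 : (MvPolynomial.pderiv i p).IsHomogeneous 0 := by
        have := hp.pderiv (i := i)
        rwa [show k - 1 = 0 by omega] at this
      rw [MvPolynomial.totalDegree_eq_zero_iff_eq_C.1 (Nat.le_zero.1 h0.totalDegree_le),
        MvPolynomial.pderiv_C]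
    · obtain ⟨j, rfl⟩ := Nat.exists_eq_add_of_le' h2
      obtain ⟨h, r, hh, hΔ, hr, rfl⟩ := exists_harmonic_add_normSq_mul hp
      rw [map_add, restrictToSphere_normSqPoly_mul]
      exact Submodule.add_mem _
        (hY.sphericalHarmonics_le_span hk (mem_sphericalHarmonics.2 ⟨h, hh, hΔ, rfl⟩))
        (ih j (by omega) (by omega) r hr)

/-- In this description the span is visibly invariant under isometries, has a countable set of
monomial generators of bounded degree, and exhausts the polynomials as L grows. -/
lemma IsHarmonicBasis.span_truncFamily (hY : IsHarmonicBasis d Y) (L : ℕ) :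
    Submodule.span ℝ (Set.range (truncFamily Y L)) =
      (MvPolynomial.restrictTotalDegree (Fin (d + 1)) ℝ L).map (restrictToSphere d) := by
  refine le_antisymm (Submodule.span_le.2 ?_) ?_
  · rintro _ ⟨i, rfl⟩
    obtain ⟨p, hp, -, h⟩ := mem_sphericalHarmonics.1 (hY.mem i.1 i.2)
    refine ⟨p, ?_, h⟩
    simp only [SetLike.mem_coe, MvPolynomial.mem_restrictTotalDegree]
    exact hp.totalDegree_le.trans (Nat.lt_succ_iff.1 i.1.2)
  · rintro _ ⟨p, hp, rfl⟩
    simp only [SetLike.mem_coe, MvPolynomial.mem_restrictTotalDegree] at hp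
    rw [← MvPolynomial.sum_homogeneousComponent p, map_sum]
    refine Submodule.sum_mem _ fun k hk => ?_
    exact hY.restrict_homogeneous_mem_span k
      ((Nat.lt_succ_iff.1 (Finset.mem_range.1 hk)).trans hp) _
      (MvPolynomial.homogeneousComponent_isHomogeneous k p)

end Basis

/-! ### Rotation invariance -/

/-- The action of a linear isometry on the sphere. -/
def sphereIsometry {d : ℕ}
    (e : EuclideanSpace ℝ (Fin (d + 1)) ≃ₗᵢ[ℝ] EuclideanSpace ℝ (Fin (d + 1)))
    (x : SphereD d) : SphereD d := ⟨e x.1, by simp⟩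

lemma continuous_sphereIsometry {d : ℕ}
    (e : EuclideanSpace ℝ (Fin (d + 1)) ≃ₗᵢ[ℝ] EuclideanSpace ℝ (Fin (d + 1))) :
    Continuous (sphereIsometry e) :=
  (e.continuous.comp continuous_subtype_val).subtype_mk _

-- The surface measure of s is proportional to the volume of the cone over s, and a linear isometry
-- maps cones to cones and preserves volume.
open scoped Pointwise in
lemma measurePreserving_sphereIsometry {d : ℕ}
    (e : EuclideanSpace ℝ (Fin (d + 1)) ≃ₗᵢ[ℝ] EuclideanSpace ℝ (Fin (d + 1))) :
    MeasurePreserving (sphereIsometry e) (unifSphere d) (unifSphere d) := by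
  have hm : Measurable (sphereIsometry e) := (continuous_sphereIsometry e).measurable
  refine ⟨hm, Measure.ext fun s hs => ?_⟩
  rw [Measure.map_apply hm hs]
  simp only [unifSphere, Measure.smul_apply, smul_eq_mul]
  congr 1
  rw [Measure.toSphere_apply' _ (hm hs), Measure.toSphere_apply' _ hs]
  congr 1
  rw [← (e.measurePreserving).measure_preimage_emb e.toHomeomorph.measurableEmbedding
    (Set.Ioo (0 : ℝ) 1 • (Subtype.val '' s))]
  congr 1
  ext y
  simp only [Set.mem_smul, Set.mem_image, Set.mem_preimage, Subtype.exists, exists_and_right,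
    exists_eq_right]
  constructor
  · rintro ⟨r, hr, z, ⟨hz, hzs⟩, rfl⟩
    exact ⟨r, hr, e z, ⟨by simpa using hz, hzs⟩, (map_smul e r z).symm⟩
  · rintro ⟨r, hr, z, ⟨hz, hzs⟩, hy⟩
    refine ⟨r, hr, e.symm z, ⟨by simpa using hz, ?_⟩, ?_⟩
    · simpa [sphereIsometry] using hzs
    · rw [← map_smul, hy, e.symm_apply_apply]

/-! ### Orthonormal families on the sphere -/

section Ortho

variable {d : ℕ} {ι : Type*} [Fintype ι] [DecidableEq ι] {ψ : ι → SphereD d → ℝ}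

lemma integrable_of_continuous {f : SphereD d → ℝ} (hf : Continuous f) :
    Integrable f (unifSphere d) :=
  hf.integrable_of_hasCompactSupport (HasCompactSupport.of_compactSpace f)

lemma integral_sum_mul_ortho (hc : ∀ i, Continuous (ψ i))
    (ho : ∀ i j, ∫ x, ψ i x * ψ j x ∂(unifSphere d) = if i = j then 1 else 0)
    (a : ι → ℝ) (j : ι) :
    ∫ x, (∑ i, a i * ψ i x) * ψ j x ∂(unifSphere d) = a j := by
  simp_rw [Finset.sum_mul, mul_assoc]
  rw [integral_finsetSum]
  swap
  · exact fun i _ => integrable_of_continuous (continuous_const.mul ((hc i).mul (hc j)))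
  simp_rw [integral_const_mul, ho]
  simp

lemma integral_sq_sum_ortho (hc : ∀ i, Continuous (ψ i))
    (ho : ∀ i j, ∫ x, ψ i x * ψ j x ∂(unifSphere d) = if i = j then 1 else 0)
    (a : ι → ℝ) :
    ∫ x, (∑ i, a i * ψ i x) ^ 2 ∂(unifSphere d) = ∑ i, a i ^ 2 := by
  have h : ∀ x, (∑ i, a i * ψ i x) ^ 2 = ∑ j, a j * ((∑ i, a i * ψ i x) * ψ j x) := by
    intro x
    rw [pow_two, Finset.mul_sum]
    exact Finset.sum_congr rfl fun j _ => by ring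
  simp_rw [h]
  have hs : Continuous fun x => ∑ i, a i * ψ i x :=
    continuous_finsetSum _ fun i _ => continuous_const.mul (hc i)
  rw [integral_finsetSum]
  swap
  · exact fun j _ => integrable_of_continuous (continuous_const.mul (hs.mul (hc j)))
  simp_rw [integral_const_mul, integral_sum_mul_ortho hc ho, pow_two]

lemma linearIndependent_of_ortho (hc : ∀ i, Continuous (ψ i))
    (ho : ∀ i j, ∫ x, ψ i x * ψ j x ∂(unifSphere d) = if i = j then 1 else 0) :
    LinearIndependent ℝ ψ := by
  rw [Fintype.linearIndependent_iff]
  intro a ha j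
  rw [← integral_sum_mul_ortho hc ho a j]
  have : ∀ x, ∑ i, a i * ψ i x = 0 := fun x => by
    simpa using congrFun ha x
  simp [this]

/-- If the span of a finite orthonormal family is invariant under all reflections, then its
Christoffel function is constant. -/
lemma sum_sq_le_card_of_invariant (hc : ∀ i, Continuous (ψ i))
    (ho : ∀ i j, ∫ x, ψ i x * ψ j x ∂(unifSphere d) = if i = j then 1 else 0)
    (hinv : ∀ e : EuclideanSpace ℝ (Fin (d + 1)) ≃ₗᵢ[ℝ] EuclideanSpace ℝ (Fin (d + 1)),
      ∀ f ∈ Submodule.span ℝ (Set.range ψ),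
        f ∘ sphereIsometry e ∈ Submodule.span ℝ (Set.range ψ))
    (x : SphereD d) : ∑ i, ψ i x ^ 2 ≤ Fintype.card ι := by
  have key : ∀ x y : SphereD d, ∑ i, ψ i x ^ 2 ≤ ∑ i, ψ i y ^ 2 := by
    intro x y
    -- Since |x| = |y|, the reflection in the hyperplane orthogonal to y - x sends y to x.
    let e := (Submodule.span ℝ {y.1 - x.1})ᗮ.reflection
    have he : sphereIsometry e y = x := by
      apply Subtype.ext
      exact Submodule.reflection_sub (by simp)
    -- The reproducing kernel of the span at x. Its rotate f ∘ e has the same L² norm and takes at y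
    -- the value f(x) = ∑ ψ_i(x)²; Cauchy–Schwarz at y then compares the kernel on the diagonal at x
    -- and y.
    let f : SphereD d → ℝ := fun z => ∑ i, ψ i x * ψ i z
    have hf : f ∈ Submodule.span ℝ (Set.range ψ) := by
      have : f = ∑ i, ψ i x • ψ i := by
        ext z
        simp [f]
      rw [this]
      exact Submodule.sum_mem _ fun i _ =>
        Submodule.smul_mem _ _ (Submodule.subset_span ⟨i, rfl⟩)
    obtain ⟨c, hc'⟩ := (Submodule.mem_span_range_iff_exists_fun ℝ).1 (hinv e f hf)
    have hc'' : ∀ z, f (sphereIsometry e z) = ∑ i, c i * ψ i z := fun z => by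
      have := congrFun hc' z
      simpa using this.symm
    have h1 : ∑ i, c i ^ 2 = ∑ i, ψ i x ^ 2 := by
      rw [← integral_sq_sum_ortho hc ho c, ← integral_sq_sum_ortho hc ho fun i => ψ i x]
      simp_rw [← hc'']
      have hfc : Continuous fun z => f z ^ 2 :=
        (continuous_finsetSum _ fun i _ => continuous_const.mul (hc i)).pow 2
      have hmap := integral_map (μ := unifSphere d)
        (measurePreserving_sphereIsometry e).measurable.aemeasurable
        (f := fun z => f z ^ 2) hfc.aestronglyMeasurable
      rw [(measurePreserving_sphereIsometry e).map_eq] at hmap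
      exact hmap.symm
    have h2 : ∑ i, ψ i x ^ 2 = ∑ i, c i * ψ i y := by
      rw [← hc'' y, he]
      simp [f, pow_two]
    have h3 := Finset.sum_mul_sq_le_sq_mul_sq Finset.univ c fun i => ψ i y
    rw [← h2, h1, pow_two] at h3
    rcases (Finset.sum_nonneg fun i _ => sq_nonneg (ψ i x) :
      0 ≤ ∑ i, ψ i x ^ 2).eq_or_lt with h0 | h0
    · rw [← h0]
      positivity
    · exact le_of_mul_le_mul_left h3 h0
  -- Averaging the comparison over y replaces the right-hand side by the dimension.
  have h1 : ∫ y, ∑ i, ψ i y ^ 2 ∂(unifSphere d) = Fintype.card ι := by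
    rw [integral_finsetSum]
    swap
    · exact fun i _ => integrable_of_continuous ((hc i).pow 2)
    simp_rw [pow_two, ho]
    simp
  have h2 : ∫ _, ∑ i, ψ i x ^ 2 ∂(unifSphere d) ≤ ∫ y, ∑ i, ψ i y ^ 2 ∂(unifSphere d) :=
    integral_mono (integrable_const _)
      (integrable_of_continuous (continuous_finsetSum _ fun i _ => (hc i).pow 2)) (key x)
  simpa [h1] using h2

end Ortho

/-! ### Pointwise bound and dimension of the truncated harmonic space -/

section Basis

variable {d : ℕ} {Y : (ℓ : ℕ) → Fin (harmonicMult d ℓ) → SphereD d → ℝ}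

lemma IsHarmonicBasis.comp_isometry_mem_span (hY : IsHarmonicBasis d Y) (L : ℕ)
    (e : EuclideanSpace ℝ (Fin (d + 1)) ≃ₗᵢ[ℝ] EuclideanSpace ℝ (Fin (d + 1)))
    {f : SphereD d → ℝ} (hf : f ∈ Submodule.span ℝ (Set.range (truncFamily Y L))) :
    f ∘ sphereIsometry e ∈ Submodule.span ℝ (Set.range (truncFamily Y L)) := by
  have hspan := hf
  rw [hY.span_truncFamily] at hspan
  obtain ⟨p, hp, rfl⟩ := hspan
  simp only [SetLike.mem_coe, MvPolynomial.mem_restrictTotalDegree] at hp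
  -- The coordinates of e as linear forms: composing with e is substituting g, which preserves the
  -- degree of homogeneous polynomials.
  let g : Fin (d + 1) → MvPolynomial (Fin (d + 1)) ℝ := fun i =>
    ∑ j, MvPolynomial.C ((e (EuclideanSpace.single j 1)) i) * MvPolynomial.X j
  have hg : ∀ i, (g i).IsHomogeneous 1 := fun i =>
    MvPolynomial.IsHomogeneous.sum _ _ _ fun j _ => by
      simpa using (MvPolynomial.isHomogeneous_C (Fin (d + 1)) _).mul
        (MvPolynomial.isHomogeneous_X ℝ j)
  have heval : ∀ q : MvPolynomial (Fin (d + 1)) ℝ,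
      restrictToSphere d q ∘ sphereIsometry e =
        restrictToSphere d (MvPolynomial.aeval g q) := by
    intro q
    ext x
    have hx : ∀ i, (e x.1) i = MvPolynomial.eval (fun i => x.1 i) (g i) := by
      intro i
      have h1 : x.1 = ∑ j, x.1 j • EuclideanSpace.single j (1 : ℝ) := by
        ext k
        simp [Finset.sum_apply, Pi.single_apply]
      conv_lhs => rw [h1, map_sum]
      simp [g, mul_comm]
    rw [Function.comp_apply, restrictToSphere_apply, restrictToSphere_apply,
      MvPolynomial.aeval_def, MvPolynomial.eval_eval₂]
    have hfun : (fun i => (sphereIsometry e x).1 i) =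
        fun i => MvPolynomial.eval (fun i => x.1 i) (g i) := funext hx
    rw [hfun]
    exact DFunLike.congr_fun (MvPolynomial.ringHom_ext (f := MvPolynomial.eval _)
      (g := MvPolynomial.eval₂Hom _ _) (by simp) (by simp)) q
  rw [heval, ← MvPolynomial.sum_homogeneousComponent p, map_sum, map_sum]
  refine Submodule.sum_mem _ fun k hk => ?_
  refine hY.restrict_homogeneous_mem_span k
      ((Nat.lt_succ_iff.1 (Finset.mem_range.1 hk)).trans hp) _ ?_
  simpa using (MvPolynomial.homogeneousComponent_isHomogeneous k p).aeval g hg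

/-- Pointwise bound from the addition formula. -/
lemma IsHarmonicBasis.sum_sq_truncFamily_le (hY : IsHarmonicBasis d Y) (L : ℕ) (x : SphereD d) :
    ∑ i, truncFamily Y L i x ^ 2 ≤ Fintype.card (TruncIndex d L) :=
  sum_sq_le_card_of_invariant (hY.continuous_truncFamily L) (hY.truncFamily_integral_mul L)
    (fun e _ hf => hY.comp_isometry_mem_span L e hf) x

/-- Monomials of degree at most one in the first variable. -/
def reducedMonomial (d L : ℕ) (s : Fin 2 × (Fin d → Fin (L + 1))) (x : SphereD d) : ℝ :=
  x.1 0 ^ (s.1 : ℕ) * ∏ i, x.1 i.succ ^ (s.2 i : ℕ)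

/-- On the sphere x_0² = 1 - ∑ x_l², so two powers of x_0 can be traded for the other variables
without raising the total degree. -/
lemma monomial_mem_span_reducedMonomial (L k : ℕ) (s : Fin d → ℕ) (hs : k + ∑ i, s i ≤ L) :
    (fun x : SphereD d => x.1 0 ^ k * ∏ i, x.1 i.succ ^ s i) ∈
      Submodule.span ℝ (Set.range (reducedMonomial d L)) := by
  induction k using Nat.strong_induction_on generalizing s with
  | _ k ih =>
    rcases Nat.lt_or_ge k 2 with h2 | h2
    · refine Submodule.subset_span ⟨(⟨k, h2⟩, fun i => ⟨s i, ?_⟩), rfl⟩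
      have := Finset.single_le_sum (f := s) (fun _ _ => Nat.zero_le _) (Finset.mem_univ i)
      omega
    · obtain ⟨j, rfl⟩ := Nat.exists_eq_add_of_le' h2
      have h : (fun x : SphereD d => x.1 0 ^ (j + 2) * ∏ i, x.1 i.succ ^ s i) =
          (fun x : SphereD d => x.1 0 ^ j * ∏ i, x.1 i.succ ^ s i) -
          ∑ l : Fin d, fun x : SphereD d =>
            x.1 0 ^ j * ∏ i, x.1 i.succ ^ (s + Pi.single l 2 : Fin d → ℕ) i := by
        ext x
        have hx : ‖x.1‖ = 1 := by simp
        have h1 : x.1 0 ^ 2 = 1 - ∑ l : Fin d, x.1 l.succ ^ 2 := by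
          have := EuclideanSpace.norm_sq_eq x.1
          rw [hx, Fin.sum_univ_succ] at this
          simp only [Real.norm_eq_abs, sq_abs] at this
          linarith
        have h3 : ∀ l : Fin d, ∏ i, x.1 i.succ ^ (s + Pi.single l 2 : Fin d → ℕ) i =
            x.1 l.succ ^ 2 * ∏ i, x.1 i.succ ^ s i := by
          intro l
          simp only [Pi.add_apply, pow_add, Finset.prod_mul_distrib]
          rw [mul_comm]
          congr 1
          rw [Finset.prod_eq_single l] <;> simp +contextual
        simp only [Pi.sub_apply, Finset.sum_apply, h3]
        rw [pow_add, h1, ← Finset.mul_sum, ← Finset.sum_mul]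
        ring
      rw [h]
      refine Submodule.sub_mem _ (ih j (by omega) s (by omega))
        (Submodule.sum_mem _ fun l _ => ih j (by omega) _ ?_)
      simp only [Pi.add_apply, Finset.sum_add_distrib, Finset.sum_pi_single', Finset.mem_univ,
        if_true]
      omega

/-- The family is linearly independent inside the span of the reduced monomials: two choices for the
exponent of x_0 and L + 1 for each of the d others. -/
lemma IsHarmonicBasis.card_truncIndex_le (hY : IsHarmonicBasis d Y) (L : ℕ) :
    Fintype.card (TruncIndex d L) ≤ 2 * (L + 1) ^ d := by
  have hli := linearIndependent_of_ortho (hY.continuous_truncFamily L)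
    (hY.truncFamily_integral_mul L)
  rw [← finrank_span_eq_card hli]
  have hle : Submodule.span ℝ (Set.range (truncFamily Y L)) ≤
      Submodule.span ℝ (Set.range (reducedMonomial d L)) := by
    rw [hY.span_truncFamily]
    rintro _ ⟨p, hp, rfl⟩
    simp only [SetLike.mem_coe, MvPolynomial.mem_restrictTotalDegree] at hp
    have : restrictToSphere d p = ∑ s ∈ p.support, p.coeff s •
        fun x : SphereD d => x.1 0 ^ s 0 * ∏ i : Fin d, x.1 i.succ ^ s i.succ := by
      ext x
      rw [restrictToSphere_apply, MvPolynomial.eval_eq']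
      simp [Fin.prod_univ_succ]
    rw [this]
    refine Submodule.sum_mem _ fun s hs => Submodule.smul_mem _ _
      (monomial_mem_span_reducedMonomial L (s 0) (fun i => s i.succ) ?_)
    have h := (MvPolynomial.le_totalDegree hs).trans hp
    rwa [Finsupp.sum_fintype _ _ (by simp), Fin.sum_univ_succ] at h
  have hfin : (Set.range (reducedMonomial d L)).finrank ℝ ≤ _ :=
    finrank_range_le_card (reducedMonomial d L)
  have : Module.Finite ℝ (Submodule.span ℝ (Set.range (reducedMonomial d L))) :=
    Module.Finite.span_of_finite ℝ (Set.finite_range _)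
  refine (Submodule.finrank_mono hle).trans (hfin.trans ?_)
  simp

end Basis

/-! ### Completeness of the spherical harmonics -/

section Complete

variable {d : ℕ} {Y : (ℓ : ℕ) → Fin (harmonicMult d ℓ) → SphereD d → ℝ}

/-- The members of a harmonic basis as continuous functions. -/
def harmonicC (hY : IsHarmonicBasis d Y) (i : (ℓ : ℕ) × Fin (harmonicMult d ℓ)) :
    C(SphereD d, ℝ) := ⟨Y i.1 i.2, hY.continuous i.1 i.2⟩

/-- Polynomials as continuous functions on the sphere. -/
def polyOnSphere (d : ℕ) : MvPolynomial (Fin (d + 1)) ℝ →ₐ[ℝ] C(SphereD d, ℝ) :=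
  MvPolynomial.aeval fun i => ⟨fun x => x.1 i, by fun_prop⟩

lemma polyOnSphere_apply (p : MvPolynomial (Fin (d + 1)) ℝ) (x : SphereD d) :
    polyOnSphere d p x = restrictToSphere d p x := by
  rw [restrictToSphere_apply]
  induction p using MvPolynomial.induction_on with
  | C a => simp [polyOnSphere]
  | add p q hp hq => simp [hp, hq]
  | mul_X p i hp =>
    rw [map_mul, map_mul, ContinuousMap.mul_apply, hp]
    simp [polyOnSphere]

lemma polyOnSphere_range_separatesPoints (d : ℕ) :
    (polyOnSphere d).range.SeparatesPoints := by
  intro x y hxy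
  obtain ⟨i, hi⟩ : ∃ i, x.1 i ≠ y.1 i := by
    by_contra! h
    exact hxy (Subtype.ext (by ext i; exact h i))
  refine ⟨polyOnSphere d (MvPolynomial.X i), ⟨_, ⟨_, rfl⟩, rfl⟩, ?_⟩
  simpa [polyOnSphere] using hi

lemma IsHarmonicBasis.polyOnSphere_mem_span (hY : IsHarmonicBasis d Y)
    (p : MvPolynomial (Fin (d + 1)) ℝ) :
    polyOnSphere d p ∈ Submodule.span ℝ (Set.range (harmonicC hY)) := by
  have h : restrictToSphere d p ∈ Submodule.span ℝ (Set.range (truncFamily Y p.totalDegree)) := by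
    rw [hY.span_truncFamily]
    exact ⟨p, by simp [MvPolynomial.mem_restrictTotalDegree], rfl⟩
  obtain ⟨c, hc⟩ := (Submodule.mem_span_range_iff_exists_fun ℝ).1 h
  have h' : polyOnSphere d p = ∑ i : TruncIndex d p.totalDegree, c i • harmonicC hY ⟨i.1, i.2⟩ := by
    ext x
    rw [polyOnSphere_apply, ← hc]
    simp [harmonicC, truncFamily, ContinuousMap.sum_apply]
  rw [h']
  exact Submodule.sum_mem _ fun i _ => Submodule.smul_mem _ _ (Submodule.subset_span ⟨_, rfl⟩)

/-- Stone–Weierstrass for the algebra of polynomials, whose coordinates separate points. -/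
lemma IsHarmonicBasis.span_harmonicC_closure (hY : IsHarmonicBasis d Y) :
    (Submodule.span ℝ (Set.range (harmonicC hY))).topologicalClosure = ⊤ := by
  have h := ContinuousMap.subalgebra_topologicalClosure_eq_top_of_separatesPoints _
    (polyOnSphere_range_separatesPoints d)
  have hle : Subalgebra.toSubmodule (polyOnSphere d).range ≤
      Submodule.span ℝ (Set.range (harmonicC hY)) := by
    rintro _ ⟨p, rfl⟩
    exact hY.polyOnSphere_mem_span p
  refine top_le_iff.1 (le_trans ?_ (Submodule.topologicalClosure_mono hle))
  exact (congrArg Subalgebra.toSubmodule h).ge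

/-- The members of a harmonic basis as elements of `L²`. -/
def harmonicLp (hY : IsHarmonicBasis d Y) (i : (ℓ : ℕ) × Fin (harmonicMult d ℓ)) :
    Lp ℝ 2 (unifSphere d) :=
  ContinuousMap.toLp 2 (unifSphere d) ℝ (harmonicC hY i)

/-- Uniform density passes to L² because continuous functions are dense there. -/
lemma IsHarmonicBasis.span_harmonicLp_closure (hY : IsHarmonicBasis d Y) :
    (Submodule.span ℝ (Set.range (harmonicLp hY))).topologicalClosure = ⊤ := by
  have h := (ContinuousMap.toLp_denseRange ℝ (unifSphere d) ℝ
    (ENNReal.ofNat_ne_top (n := 2))).topologicalClosure_map_submodule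
      hY.span_harmonicC_closure
  rw [Submodule.map_span, ← Set.range_comp] at h
  exact h

lemma IsHarmonicBasis.orthonormal_harmonicLp (hY : IsHarmonicBasis d Y) :
    Orthonormal ℝ (harmonicLp hY) := by
  classical
  rw [orthonormal_iff_ite]
  intro i j
  simp only [harmonicLp]
  rw [ContinuousMap.inner_toLp]
  rw [← hY.integral_mul i j]
  refine integral_congr_ae (Eventually.of_forall fun x => ?_)
  simp [harmonicC, mul_comm]

/-- Parseval's identity, grouped by degree. -/
lemma IsHarmonicBasis.hasSum_sq_harmonicCoeff (hY : IsHarmonicBasis d Y) {f : SphereD d → ℝ}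
    (hf : MemLp f 2 (unifSphere d)) :
    HasSum (fun ℓ => ∑ m, harmonicCoeff Y f ℓ m ^ 2) (∫ x, f x ^ 2 ∂(unifSphere d)) := by
  let b := HilbertBasis.mk hY.orthonormal_harmonicLp hY.span_harmonicLp_closure.ge
  have hb : ∀ i, b i = harmonicLp hY i := fun i => by simp [b]
  have hcoef : ∀ i : (ℓ : ℕ) × Fin (harmonicMult d ℓ),
      inner ℝ (b i) (hf.toLp f) = harmonicCoeff Y f i.1 i.2 := by
    intro i
    rw [hb, L2.inner_def, harmonicCoeff]
    refine integral_congr_ae ?_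
    filter_upwards [hf.coeFn_toLp, ContinuousMap.coeFn_toLp (p := 2) (𝕜 := ℝ) (unifSphere d)
      (harmonicC hY i)] with x hx hx'
    rw [hx, harmonicLp, hx']
    simp [harmonicC]
  have hself : inner ℝ (hf.toLp f) (hf.toLp f) = ∫ x, f x ^ 2 ∂(unifSphere d) := by
    rw [L2.inner_def]
    refine integral_congr_ae ?_
    filter_upwards [hf.coeFn_toLp] with x hx
    rw [hx]
    simp [pow_two]
  have h := b.hasSum_inner_mul_inner (hf.toLp f) (hf.toLp f)
  rw [hself] at h
  have hsq : (fun i => inner ℝ (hf.toLp f) (b i) * inner ℝ (b i) (hf.toLp f)) =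
      fun i => harmonicCoeff Y f i.1 i.2 ^ 2 := by
    ext i
    rw [real_inner_comm, hcoef, pow_two]
  rw [hsq] at h
  exact h.sigma fun ℓ => hasSum_fintype _

end Complete

/-! ### The truncation error -/

section Truncation

variable {d : ℕ} {Y : (ℓ : ℕ) → Fin (harmonicMult d ℓ) → SphereD d → ℝ}

/-- The coefficients of `f` up to degree `L`. -/
def truncCoeff (Y : (ℓ : ℕ) → Fin (harmonicMult d ℓ) → SphereD d → ℝ) (L : ℕ)
    (f : SphereD d → ℝ) (i : TruncIndex d L) : ℝ := harmonicCoeff Y f i.1 i.2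

lemma memLp_of_continuous {f : SphereD d → ℝ} (hf : Continuous f) (p : ℝ≥0∞) :
    MemLp f p (unifSphere d) :=
  hf.memLp_of_hasCompactSupport (HasCompactSupport.of_compactSpace f)

lemma IsHarmonicBasis.continuous_harmonicSum (hY : IsHarmonicBasis d Y) {L : ℕ}
    (a : TruncIndex d L → ℝ) : Continuous (harmonicSum Y a) :=
  continuous_finsetSum _ fun i _ => continuous_const.mul (hY.continuous i.1 i.2)

lemma lbEigenvalue_nonneg (hd : 1 ≤ d) (ℓ : ℕ) : 0 ≤ lbEigenvalue d ℓ := by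
  have : (1 : ℝ) ≤ d := by exact_mod_cast hd
  have h0 : (0 : ℝ) ≤ ℓ := ℓ.cast_nonneg
  exact mul_nonneg h0 (by linarith)

lemma lbEigenvalue_mono (hd : 1 ≤ d) {k l : ℕ} (h : k ≤ l) :
    lbEigenvalue d k ≤ lbEigenvalue d l := by
  have h1 : (1 : ℝ) ≤ d := by exact_mod_cast hd
  have h0 : (0 : ℝ) ≤ k := k.cast_nonneg
  have h2 : (k : ℝ) ≤ l := by exact_mod_cast h
  unfold lbEigenvalue
  exact mul_le_mul h2 (by linarith) (by linarith) (by linarith)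

lemma IsHarmonicBasis.harmonicCoeff_sub_harmonicSum (hY : IsHarmonicBasis d Y)
    {f : SphereD d → ℝ} (hf : MemLp f 2 (unifSphere d)) (L ℓ : ℕ) (m : Fin (harmonicMult d ℓ)) :
    harmonicCoeff Y (fun x => f x - harmonicSum Y (truncCoeff Y L f) x) ℓ m =
      if ℓ ≤ L then 0 else harmonicCoeff Y f ℓ m := by
  classical
  have hi1 : Integrable (fun x => f x * Y ℓ m x) (unifSphere d) :=
    hf.integrable_mul (memLp_of_continuous (hY.continuous ℓ m) 2)
  have hi2 : Integrable (fun x => harmonicSum Y (truncCoeff Y L f) x * Y ℓ m x) (unifSphere d) :=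
    integrable_of_continuous ((hY.continuous_harmonicSum _).mul (hY.continuous ℓ m))
  have h1 : harmonicCoeff Y (fun x => f x - harmonicSum Y (truncCoeff Y L f) x) ℓ m =
      harmonicCoeff Y f ℓ m -
        ∫ x, harmonicSum Y (truncCoeff Y L f) x * Y ℓ m x ∂(unifSphere d) := by
    simp only [harmonicCoeff, sub_mul]
    exact integral_sub hi1 hi2
  rw [h1]
  split_ifs with h
  · have := integral_sum_mul_ortho (hY.continuous_truncFamily L) (hY.truncFamily_integral_mul L)
      (truncCoeff Y L f) ⟨⟨ℓ, Nat.lt_succ_of_le h⟩, m⟩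
    simp only [truncFamily] at this
    simp only [harmonicSum]
    rw [this]
    simp [truncCoeff]
  · simp only [harmonicSum, Finset.sum_mul, mul_assoc]
    rw [integral_finsetSum]
    · rw [Finset.sum_eq_zero, sub_zero]
      intro i _
      rw [integral_const_mul, sphericalHarmonics_orthogonal _ (hY.mem _ _) (hY.mem _ _), mul_zero]
      have := Nat.lt_succ_iff.1 i.1.2
      omega
    · exact fun i _ => integrable_of_continuous
        (continuous_const.mul ((hY.continuous _ _).mul (hY.continuous _ _)))

/-- By Parseval only degrees ℓ > L contribute, and there (1 + λ_ℓ)^β ≥ (1 + λ_L)^β. -/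
lemma IsHarmonicBasis.integral_sq_sub_harmonicSum_le (hY : IsHarmonicBasis d Y) (hd : 1 ≤ d)
    {β : ℝ} (hβ : 0 < β) {f : SphereD d → ℝ} (hf : MemSobolevSphere Y β f) (L : ℕ) :
    ∫ x, (f x - harmonicSum Y (truncCoeff Y L f) x) ^ 2 ∂(unifSphere d) ≤
      (1 + lbEigenvalue d L) ^ (-β) * ∑' ℓ : ℕ,
        (1 + lbEigenvalue d ℓ) ^ β * ∑ m : Fin (harmonicMult d ℓ), harmonicCoeff Y f ℓ m ^ 2 := by
  obtain ⟨hf2, hs⟩ := hf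
  have hg : MemLp (fun x => f x - harmonicSum Y (truncCoeff Y L f) x) 2 (unifSphere d) :=
    hf2.sub (memLp_of_continuous (hY.continuous_harmonicSum _) 2)
  refine hasSum_le (fun ℓ => ?_) (hY.hasSum_sq_harmonicCoeff hg) (hs.hasSum.mul_left _)
  simp_rw [hY.harmonicCoeff_sub_harmonicSum hf2]
  have hpos : ∀ ℓ, 0 < 1 + lbEigenvalue d ℓ := fun ℓ => by
    have := lbEigenvalue_nonneg hd ℓ
    linarith
  have hS : 0 ≤ ∑ m : Fin (harmonicMult d ℓ), harmonicCoeff Y f ℓ m ^ 2 :=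
    Finset.sum_nonneg fun _ _ => sq_nonneg _
  split_ifs with h
  · have := (hpos ℓ).le
    have := (hpos L).le
    simp only [ne_eq, OfNat.ofNat_ne_zero, not_false_eq_true, zero_pow, Finset.sum_const_zero]
    positivity
  · rw [← mul_assoc]
    refine le_mul_of_one_le_left hS ?_
    rw [Real.rpow_neg (hpos L).le, inv_mul_eq_div, one_le_div (Real.rpow_pos_of_pos (hpos L) _)]
    exact Real.rpow_le_rpow (hpos L).le
      (by have := lbEigenvalue_mono hd (not_le.1 h).le; linarith) hβ.le

/-- Weighted bound for the low-degree coefficients of a Sobolev function. -/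
lemma sum_weight_truncCoeff_le (hd : 1 ≤ d)
    {β γ : ℝ} (hγ : β ≤ γ) {f : SphereD d → ℝ} (hf : MemSobolevSphere Y β f) (L : ℕ) :
    ∑ i : TruncIndex d L, (1 + lbEigenvalue d i.1) ^ γ * truncCoeff Y L f i ^ 2 ≤
      (1 + lbEigenvalue d L) ^ (γ - β) * ∑' ℓ : ℕ,
        (1 + lbEigenvalue d ℓ) ^ β * ∑ m : Fin (harmonicMult d ℓ), harmonicCoeff Y f ℓ m ^ 2 := by
  have hpos : ∀ ℓ, 0 < 1 + lbEigenvalue d ℓ := fun ℓ => by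
    have := lbEigenvalue_nonneg hd ℓ
    linarith
  rw [Fintype.sum_sigma]
  have h1 : ∀ ℓ : Fin (L + 1), ∑ m : Fin (harmonicMult d ℓ),
      (1 + lbEigenvalue d ℓ) ^ γ * truncCoeff Y L f ⟨ℓ, m⟩ ^ 2 ≤
      (1 + lbEigenvalue d L) ^ (γ - β) * ((1 + lbEigenvalue d ℓ) ^ β *
        ∑ m : Fin (harmonicMult d ℓ), harmonicCoeff Y f ℓ m ^ 2) := by
    intro ℓ
    rw [← Finset.mul_sum, ← mul_assoc]
    refine mul_le_mul_of_nonneg_right ?_ (Finset.sum_nonneg fun _ _ => sq_nonneg _)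
    have : (1 + lbEigenvalue d ℓ) ^ γ =
        (1 + lbEigenvalue d ℓ) ^ (γ - β) * (1 + lbEigenvalue d ℓ) ^ β := by
      rw [← Real.rpow_add (hpos ℓ)]
      ring_nf
    rw [this]
    refine mul_le_mul_of_nonneg_right ?_ (Real.rpow_nonneg (hpos ℓ).le _)
    exact Real.rpow_le_rpow (hpos ℓ).le
      (by have := lbEigenvalue_mono hd (Nat.lt_succ_iff.1 ℓ.2); linarith) (by linarith)
  refine (Finset.sum_le_sum fun ℓ _ => h1 ℓ).trans ?_
  rw [← Finset.mul_sum]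
  refine mul_le_mul_of_nonneg_left ?_ (Real.rpow_nonneg (hpos L).le _)
  rw [Fin.sum_univ_eq_sum_range (fun ℓ : ℕ => (1 + lbEigenvalue d ℓ) ^ β *
        ∑ m : Fin (harmonicMult d ℓ), harmonicCoeff Y f ℓ m ^ 2) (L + 1)]
  refine hf.2.sum_le_tsum _ fun ℓ _ => ?_
  have := (hpos ℓ).le
  positivity

end Truncation

/-! ### Moments of sums of independent centred vectors -/

section IID

variable {Z : Type*} [MeasurableSpace Z] {μ : Measure Z} [IsProbabilityMeasure μ]
variable {H : Type*} [NormedAddCommGroup H] [InnerProductSpace ℝ H] [CompleteSpace H]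

lemma lintegral_pi_succ {n : ℕ} {F : Z → (Fin n → Z) → ℝ≥0∞}
    (hF : Measurable (Function.uncurry F)) :
    ∫⁻ z : Fin (n + 1) → Z, F (z 0) (fun i => z i.succ) ∂(Measure.pi fun _ => μ) =
      ∫⁻ z', ∫⁻ z₀, F z₀ z' ∂μ ∂(Measure.pi fun _ => μ) := by
  have h := measurePreserving_piFinSuccAbove (fun _ : Fin (n + 1) => μ) 0
  refine (h.lintegral_comp hF).trans (lintegral_prod_symm' _ hF)

lemma integral_norm_add_sq_le {U : Z → H} (hU : MemLp U 2 μ)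
    (h0 : ∫ z, U z ∂μ = 0) (s : H) :
    Integrable (fun z => ‖s + U z‖ ^ 2) μ ∧
      ∫ z, ‖s + U z‖ ^ 2 ∂μ = ‖s‖ ^ 2 + ∫ z, ‖U z‖ ^ 2 ∂μ := by
  have hi : Integrable U μ := hU.integrable (by norm_num)
  have hi1 : Integrable (fun z => inner ℝ s (U z)) μ := hi.const_inner s
  have hi2 : Integrable (fun z => ‖U z‖ ^ 2) μ := hU.integrable_norm_pow (by norm_num)
  have hz : ∫ z, inner ℝ s (U z) ∂μ = 0 := by rw [integral_inner hi, h0, inner_zero_right]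
  simp_rw [norm_add_sq_real]
  have hi3 : Integrable (fun z => ‖s‖ ^ 2 + 2 * inner ℝ s (U z)) μ :=
    (integrable_const _).add (hi1.const_mul 2)
  refine ⟨hi3.add hi2, ?_⟩
  rw [integral_add hi3 hi2, integral_add (integrable_const _) (hi1.const_mul 2),
    integral_const_mul, hz]
  simp

/-- One martingale step: 2⟨s, U⟩ + (‖U‖² - μ₂) is the centred increment of the squared norm when U
is added to a partial sum s. The cross term with x vanishes; the factor 8τ‖s‖² sees U only through
its variance in the direction s. -/
lemma integral_centered_step_le {U : Z → H} (hU : MemLp U 4 μ)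
    (h0 : ∫ z, U z ∂μ = 0) {τ : ℝ} (hτ : ∀ s : H, ∫ z, inner ℝ s (U z) ^ 2 ∂μ ≤ τ * ‖s‖ ^ 2)
    (s : H) (x : ℝ) :
    let μ₂ := ∫ z, ‖U z‖ ^ 2 ∂μ
    Integrable (fun z => (x + (2 * inner ℝ s (U z) + (‖U z‖ ^ 2 - μ₂))) ^ 2) μ ∧
    ∫ z, (x + (2 * inner ℝ s (U z) + (‖U z‖ ^ 2 - μ₂))) ^ 2 ∂μ ≤
      x ^ 2 + (8 * (τ * ‖s‖ ^ 2) + 2 * ∫ z, ‖U z‖ ^ 4 ∂μ) := by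
  intro μ₂
  have hU2 : MemLp U 2 μ := hU.mono_exponent (by norm_num)
  have hi : Integrable U μ := hU.integrable (by norm_num)
  have hin : Integrable (fun z => inner ℝ s (U z)) μ := hi.const_inner s
  have hi2 : Integrable (fun z => ‖U z‖ ^ 2) μ := hU2.integrable_norm_pow (by norm_num)
  have hi4 : Integrable (fun z => ‖U z‖ ^ 4) μ := hU.integrable_norm_pow (by norm_num)
  have hz : ∫ z, inner ℝ s (U z) ∂μ = 0 := by rw [integral_inner hi, h0, inner_zero_right]
  have hin2 : Integrable (fun z => inner ℝ s (U z) ^ 2) μ :=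
    (hU2.const_inner s).integrable_sq
  have hc : Integrable (fun z => ‖U z‖ ^ 2 - μ₂) μ := hi2.sub (integrable_const _)
  have hc2 : Integrable (fun z => (‖U z‖ ^ 2 - μ₂) ^ 2) μ := by
    have : ∀ z, (‖U z‖ ^ 2 - μ₂) ^ 2 = ‖U z‖ ^ 4 - 2 * μ₂ * ‖U z‖ ^ 2 + μ₂ ^ 2 :=
      fun z => by ring
    simp_rw [this]
    exact (hi4.sub (hi2.const_mul _)).add (integrable_const _)
  have hξ : Integrable (fun z => 2 * inner ℝ s (U z) + (‖U z‖ ^ 2 - μ₂)) μ :=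
    (hin.const_mul 2).add hc
  have hmc : AEStronglyMeasurable (fun z => ‖U z‖ ^ 2 - μ₂) μ := hc.aestronglyMeasurable
  have hξ2 : Integrable (fun z => (2 * inner ℝ s (U z) + (‖U z‖ ^ 2 - μ₂)) ^ 2) μ := by
    have h1 : MemLp (fun z => inner ℝ s (U z)) 2 μ := hU2.const_inner s
    have h2 : MemLp (fun z => ‖U z‖ ^ 2 - μ₂) 2 μ := (memLp_two_iff_integrable_sq hmc).2 hc2
    exact ((h1.const_mul 2).add h2).integrable_sq
  have hEξ : ∫ z, (2 * inner ℝ s (U z) + (‖U z‖ ^ 2 - μ₂)) ∂μ = 0 := by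
    rw [integral_add (hin.const_mul 2) hc, integral_const_mul, hz,
      integral_sub hi2 (integrable_const _)]
    simp [μ₂]
  have hEc : ∫ z, (‖U z‖ ^ 2 - μ₂) ^ 2 ∂μ ≤ ∫ z, ‖U z‖ ^ 4 ∂μ := by
    have : ∀ z, (‖U z‖ ^ 2 - μ₂) ^ 2 = (‖U z‖ ^ 4 - 2 * μ₂ * ‖U z‖ ^ 2) + μ₂ ^ 2 :=
      fun z => by ring
    simp_rw [this]
    have hi' : Integrable (fun z => ‖U z‖ ^ 4 - 2 * μ₂ * ‖U z‖ ^ 2) μ :=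
      hi4.sub (hi2.const_mul _)
    rw [integral_add hi' (integrable_const _), integral_sub hi4 (hi2.const_mul _), integral_const_mul]
    have h1 : ∫ z, ‖U z‖ ^ 2 ∂μ = μ₂ := rfl
    rw [h1]
    simp only [integral_const, probReal_univ, smul_eq_mul, one_mul]
    nlinarith [sq_nonneg μ₂]
  have hEξ2 : ∫ z, (2 * inner ℝ s (U z) + (‖U z‖ ^ 2 - μ₂)) ^ 2 ∂μ ≤
      8 * (τ * ‖s‖ ^ 2) + 2 * ∫ z, ‖U z‖ ^ 4 ∂μ := by
    have h1 : ∫ z, (2 * inner ℝ s (U z) + (‖U z‖ ^ 2 - μ₂)) ^ 2 ∂μ ≤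
        ∫ z, (8 * inner ℝ s (U z) ^ 2 + 2 * (‖U z‖ ^ 2 - μ₂) ^ 2) ∂μ := by
      refine integral_mono hξ2 ((hin2.const_mul 8).add (hc2.const_mul 2)) fun z => ?_
      dsimp only
      nlinarith [sq_nonneg (2 * inner ℝ s (U z) - (‖U z‖ ^ 2 - μ₂))]
    rw [integral_add (hin2.const_mul 8) (hc2.const_mul 2), integral_const_mul,
      integral_const_mul] at h1
    linarith [hτ s]
  have hexp : ∀ z, (x + (2 * inner ℝ s (U z) + (‖U z‖ ^ 2 - μ₂))) ^ 2 =
      (x ^ 2 + 2 * x * (2 * inner ℝ s (U z) + (‖U z‖ ^ 2 - μ₂))) +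
        (2 * inner ℝ s (U z) + (‖U z‖ ^ 2 - μ₂)) ^ 2 := fun z => by ring
  simp_rw [hexp]
  have hi5 : Integrable (fun z => x ^ 2 + 2 * x * (2 * inner ℝ s (U z) + (‖U z‖ ^ 2 - μ₂))) μ :=
    (integrable_const _).add (hξ.const_mul _)
  refine ⟨hi5.add hξ2, ?_⟩
  rw [integral_add hi5 hξ2, integral_add (integrable_const _) (hξ.const_mul _),
    integral_const_mul, hEξ]
  simpa using hEξ2

variable [MeasurableSpace H] [BorelSpace H] [SecondCountableTopology H]

/-- Induction on n by integrating out one coordinate. Working with `lintegral` removes the need for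
integrability on the product space. -/
lemma lintegral_norm_sum_sq_le {U : Z → H} (hm : Measurable U) (hU : MemLp U 2 μ)
    (h0 : ∫ z, U z ∂μ = 0) (n : ℕ) :
    ∫⁻ z : Fin n → Z, ENNReal.ofReal (‖∑ i, U (z i)‖ ^ 2) ∂(Measure.pi fun _ => μ) ≤
      ENNReal.ofReal (n * ∫ z, ‖U z‖ ^ 2 ∂μ) := by
  have hμ2 : 0 ≤ ∫ z, ‖U z‖ ^ 2 ∂μ := integral_nonneg fun _ => sq_nonneg _
  induction n with
  | zero => simp
  | succ n ih =>
    simp_rw [Fin.sum_univ_succ]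
    rw [lintegral_pi_succ (F := fun z₀ z' => ENNReal.ofReal (‖U z₀ + ∑ i, U (z' i)‖ ^ 2))
      (by unfold Function.uncurry; fun_prop)]
    have h : ∀ z' : Fin n → Z, ∫⁻ z₀, ENNReal.ofReal (‖U z₀ + ∑ i, U (z' i)‖ ^ 2) ∂μ =
        ENNReal.ofReal (‖∑ i, U (z' i)‖ ^ 2) + ENNReal.ofReal (∫ z, ‖U z‖ ^ 2 ∂μ) := by
      intro z'
      obtain ⟨hi, he⟩ := integral_norm_add_sq_le hU h0 (∑ i, U (z' i))
      simp_rw [add_comm (U _)]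
      rw [← ofReal_integral_eq_lintegral_ofReal hi (Eventually.of_forall fun _ => sq_nonneg _), he,
        ENNReal.ofReal_add (sq_nonneg _) hμ2]
    simp_rw [h]
    rw [lintegral_add_right _ measurable_const, lintegral_const, measure_univ, mul_one]
    refine (add_le_add_left ih _).trans ?_
    rw [← ENNReal.ofReal_add (by positivity) hμ2]
    refine le_of_eq (congrArg _ ?_)
    push_cast
    ring

/-- The centred squared norms form a martingale, so the second moments of the increments add up; the
mean of ‖s‖² in each increment is controlled by `lintegral_norm_sum_sq_le`. -/
lemma lintegral_sq_norm_sum_sq_sub_le {U : Z → H} (hm : Measurable U) (hU : MemLp U 4 μ)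
    (h0 : ∫ z, U z ∂μ = 0) {τ : ℝ} (hτ0 : 0 ≤ τ)
    (hτ : ∀ s : H, ∫ z, inner ℝ s (U z) ^ 2 ∂μ ≤ τ * ‖s‖ ^ 2) (n : ℕ) :
    ∫⁻ z : Fin n → Z, ENNReal.ofReal ((‖∑ i, U (z i)‖ ^ 2 - n * ∫ z, ‖U z‖ ^ 2 ∂μ) ^ 2)
        ∂(Measure.pi fun _ => μ) ≤
      ENNReal.ofReal (n * (8 * τ * (n * ∫ z, ‖U z‖ ^ 2 ∂μ) + 2 * ∫ z, ‖U z‖ ^ 4 ∂μ)) := by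
  have hU2 : MemLp U 2 μ := hU.mono_exponent (by norm_num)
  set μ₂ := ∫ z, ‖U z‖ ^ 2 ∂μ with hμ₂
  set m₄ := ∫ z, ‖U z‖ ^ 4 ∂μ with hm₄
  have hμ2 : 0 ≤ μ₂ := integral_nonneg fun _ => sq_nonneg _
  have hm4 : 0 ≤ m₄ := integral_nonneg fun _ => by positivity
  induction n with
  | zero => simp
  | succ n ih =>
    have hstep : ∀ z : Fin (n + 1) → Z, (‖∑ i, U (z i)‖ ^ 2 - (n + 1 : ℕ) * μ₂) =
        (‖∑ i : Fin n, U (z i.succ)‖ ^ 2 - n * μ₂) +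
          (2 * inner ℝ (∑ i : Fin n, U (z i.succ)) (U (z 0)) + (‖U (z 0)‖ ^ 2 - μ₂)) := by
      intro z
      rw [Fin.sum_univ_succ, add_comm (U (z 0)), norm_add_sq_real]
      push_cast
      ring
    simp_rw [hstep]
    rw [lintegral_pi_succ (F := fun z₀ z' => ENNReal.ofReal
      (((‖∑ i : Fin n, U (z' i)‖ ^ 2 - n * μ₂) +
          (2 * inner ℝ (∑ i : Fin n, U (z' i)) (U z₀) + (‖U z₀‖ ^ 2 - μ₂))) ^ 2))
      (by unfold Function.uncurry; fun_prop)]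
    have h : ∀ z' : Fin n → Z, ∫⁻ z₀, ENNReal.ofReal
        (((‖∑ i : Fin n, U (z' i)‖ ^ 2 - n * μ₂) +
          (2 * inner ℝ (∑ i : Fin n, U (z' i)) (U z₀) + (‖U z₀‖ ^ 2 - μ₂))) ^ 2) ∂μ ≤
        ENNReal.ofReal ((‖∑ i, U (z' i)‖ ^ 2 - n * μ₂) ^ 2) +
          (ENNReal.ofReal (8 * τ) * ENNReal.ofReal (‖∑ i, U (z' i)‖ ^ 2) +
            ENNReal.ofReal (2 * m₄)) := by
      intro z'
      obtain ⟨hi, he⟩ := integral_centered_step_le hU h0 hτ (∑ i, U (z' i))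
        (‖∑ i : Fin n, U (z' i)‖ ^ 2 - n * μ₂)
      rw [← ofReal_integral_eq_lintegral_ofReal hi (Eventually.of_forall fun _ => sq_nonneg _),
        ← ENNReal.ofReal_mul (by positivity), ← ENNReal.ofReal_add (by positivity) (by positivity),
        ← ENNReal.ofReal_add (by positivity) (by positivity)]
      exact ENNReal.ofReal_le_ofReal (he.trans_eq (by ring))
    refine (lintegral_mono h).trans ?_
    rw [lintegral_add_left (by fun_prop), lintegral_add_left (by fun_prop),
      lintegral_const_mul _ (by fun_prop), lintegral_const, measure_univ, mul_one]
    refine (add_le_add ih (add_le_add_left (mul_le_mul_right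
      (lintegral_norm_sum_sq_le hm hU2 h0 n) _) _)).trans ?_
    rw [← ENNReal.ofReal_mul (by positivity), ← ENNReal.ofReal_add (by positivity) (by positivity),
        ← ENNReal.ofReal_add (by positivity) (by positivity)]
    refine ENNReal.ofReal_le_ofReal ?_
    push_cast
    -- This is exactly the slack: (n + 1)² - (n² + n) = n + 1.
    have : 0 ≤ 8 * τ * μ₂ * (n + 1) := by positivity
    nlinarith

/-- Chebyshev bound for the squared norm of a sum of independent centred vectors. -/
lemma measure_norm_sum_sq_gt_le {U : Z → H} (hm : Measurable U) (hU : MemLp U 4 μ)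
    (h0 : ∫ z, U z ∂μ = 0) {τ : ℝ} (hτ0 : 0 ≤ τ)
    (hτ : ∀ s : H, ∫ z, inner ℝ s (U z) ^ 2 ∂μ ≤ τ * ‖s‖ ^ 2) (n : ℕ) {t : ℝ} (ht : 0 < t) :
    (Measure.pi fun _ : Fin n => μ)
        {z | n * ∫ z, ‖U z‖ ^ 2 ∂μ + t < ‖∑ i, U (z i)‖ ^ 2} ≤
      ENNReal.ofReal
        (n * (8 * τ * (n * ∫ z, ‖U z‖ ^ 2 ∂μ) + 2 * ∫ z, ‖U z‖ ^ 4 ∂μ) / t ^ 2) := by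
  have h := lintegral_sq_norm_sum_sq_sub_le hm hU h0 hτ0 hτ n
  rw [ENNReal.ofReal_div_of_pos (by positivity)]
  refine le_trans ?_ (ENNReal.div_le_div_right h _)
  refine le_trans (measure_mono ?_) (meas_ge_le_lintegral_div
    (Measurable.aemeasurable (by fun_prop))
    (by simpa using ht.ne') ENNReal.ofReal_ne_top)
  intro z hz
  simp only [Set.mem_ofPred_eq] at hz ⊢
  refine ENNReal.ofReal_le_ofReal (pow_le_pow_left₀ ht.le ?_ 2)
  linarith

/-- Markov bound for the squared norm of a sum of independent centred vectors. -/
lemma measure_norm_sum_sq_ge_le {U : Z → H} (hm : Measurable U) (hU : MemLp U 2 μ)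
    (h0 : ∫ z, U z ∂μ = 0) (n : ℕ) {t : ℝ} (ht : 0 < t) :
    (Measure.pi fun _ : Fin n => μ) {z | t < ‖∑ i, U (z i)‖ ^ 2} ≤
      ENNReal.ofReal (n * (∫ z, ‖U z‖ ^ 2 ∂μ) / t) := by
  have h := lintegral_norm_sum_sq_le hm hU h0 n
  rw [ENNReal.ofReal_div_of_pos (by positivity)]
  refine le_trans ?_ (ENNReal.div_le_div_right h _)
  refine le_trans (measure_mono ?_) (meas_ge_le_lintegral_div
    (Measurable.aemeasurable (by fun_prop))
    (by simpa using ht) ENNReal.ofReal_ne_top)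
  intro z hz
  exact ENNReal.ofReal_le_ofReal hz.le

end IID

/-! ### Densities of product Gaussians -/

section ProductDensity

variable {ι : Type*} [Fintype ι]

lemma lintegral_prod_indicator_gaussianPDF {v : ι → ℝ≥0} {s : ι → Set ℝ}
    (hs : ∀ i, MeasurableSet (s i)) :
    ∫⁻ x : ι → ℝ, ∏ i, (s i).indicator (gaussianPDF 0 (v i)) (x i) =
      ∏ i, ∫⁻ t in s i, gaussianPDF 0 (v i) t := by
  have hint : ∀ i, Integrable ((s i).indicator (gaussianPDFReal 0 (v i))) := fun i =>
    (integrable_gaussianPDFReal 0 (v i)).indicator (hs i)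
  have hnn : ∀ i t, 0 ≤ (s i).indicator (gaussianPDFReal 0 (v i)) t := fun i t =>
    Set.indicator_nonneg (fun t _ => gaussianPDFReal_nonneg 0 (v i) t) t
  have hind : ∀ i t, (s i).indicator (gaussianPDF 0 (v i)) t =
      ENNReal.ofReal ((s i).indicator (gaussianPDFReal 0 (v i)) t) := by
    intro i t
    by_cases ht : t ∈ s i <;> simp [ht, gaussianPDF]
  have hpr : Integrable fun x : ι → ℝ =>
      ∏ i, (s i).indicator (gaussianPDFReal 0 (v i)) (x i) := Integrable.fintype_prod hint
  simp_rw [hind, ← ENNReal.ofReal_prod_of_nonneg fun i _ => hnn i _]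
  rw [← ofReal_integral_eq_lintegral_ofReal hpr
    (Eventually.of_forall fun x => Finset.prod_nonneg fun i _ => hnn i _),
    integral_fintype_prod_volume_eq_prod,
    ENNReal.ofReal_prod_of_nonneg fun i _ => integral_nonneg (hnn i)]
  refine Finset.prod_congr rfl fun i _ => ?_
  rw [ofReal_integral_eq_lintegral_ofReal (hint i) (Eventually.of_forall (hnn i)),
    ← lintegral_indicator (hs i)]
  simp_rw [hind]

/-- A density with respect to Lebesgue measure allows the prior to be recentred at `a₀` by
translation. -/
lemma pi_gaussianReal_eq_withDensity {v : ι → ℝ≥0} (hv : ∀ i, v i ≠ 0) :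
    (Measure.pi fun i => gaussianReal 0 (v i)) =
      (volume : Measure (ι → ℝ)).withDensity fun x => ∏ i, gaussianPDF 0 (v i) (x i) := by
  refine Measure.pi_eq fun s hs => ?_
  rw [withDensity_apply _ (MeasurableSet.univ_pi hs),
    ← lintegral_indicator (MeasurableSet.univ_pi hs)]
  have h : ∀ x : ι → ℝ, (Set.univ.pi s).indicator (fun x => ∏ i, gaussianPDF 0 (v i) (x i)) x =
      ∏ i, (s i).indicator (gaussianPDF 0 (v i)) (x i) := by
    intro x
    by_cases hx : x ∈ Set.univ.pi s
    · rw [Set.indicator_of_mem hx]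
      exact Finset.prod_congr rfl fun i _ => by rw [Set.indicator_of_mem (hx i (Set.mem_univ i))]
    · rw [Set.indicator_of_notMem hx]
      simp only [Set.mem_pi, Set.mem_univ, true_imp_iff, not_forall] at hx
      obtain ⟨i, hi⟩ := hx
      exact (Finset.prod_eq_zero (Finset.mem_univ i) (Set.indicator_of_notMem hi _)).symm
  simp_rw [h]
  rw [lintegral_prod_indicator_gaussianPDF hs]
  exact Finset.prod_congr rfl fun i _ => (gaussianReal_apply 0 (hv i) (s i)).symm

end ProductDensity

/-! ### Posterior tails for log-quadratic densities -/

section Posterior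

variable {ι : Type*} [Fintype ι] {q : (ι → ℝ) → ℝ} {κ : ℝ} {b : ι → ℝ}

/-- Substitution h ↦ h/2, whose Jacobian gives the power of 2. -/
lemma lintegral_quarter_quadratic (hqs : ∀ (s : ℝ) h, q (s • h) = s ^ 2 * q h) :
    ∫⁻ h : ι → ℝ, ENNReal.ofReal (Real.exp (-(q h / 8))) =
      ENNReal.ofReal (2 ^ Fintype.card ι) *
        ∫⁻ h : ι → ℝ, ENNReal.ofReal (Real.exp (-(q h / 2))) := by
  have h2 : (2⁻¹ : ℝ) ≠ 0 := by norm_num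
  have hmap := Measure.map_addHaar_smul (volume : Measure (ι → ℝ)) h2
  have hemb : MeasurableEmbedding fun h : ι → ℝ => (2⁻¹ : ℝ) • h :=
    (Homeomorph.smulOfNeZero (2⁻¹ : ℝ) h2).measurableEmbedding
  have h1 := hemb.lintegral_map (μ := volume)
    (fun h : ι → ℝ => ENNReal.ofReal (Real.exp (-(q h / 2))))
  rw [hmap, lintegral_smul_measure] at h1
  simp_rw [hqs] at h1
  have h3 : ∀ h, -(2⁻¹ ^ 2 * q h / 2) = -(q h / 8) := fun h => by ring
  simp_rw [h3] at h1
  rw [← h1, Module.finrank_fintype_fun_eq_card, smul_eq_mul]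
  congr 2
  rw [inv_pow, inv_inv, abs_of_pos (by positivity)]

/-- Averaging over h and -h turns exp(b·h) into cosh(b·h) ≥ 1. This bounds the normalising constant
from below. -/
lemma lintegral_quadratic_le (hq : Measurable q) (hqs : ∀ (s : ℝ) h, q (s • h) = s ^ 2 * q h)
    (b : ι → ℝ) :
    ∫⁻ h : ι → ℝ, ENNReal.ofReal (Real.exp (-(q h / 2))) ≤
      ∫⁻ h : ι → ℝ, ENNReal.ofReal (Real.exp (∑ i, b i * h i - q h / 2)) := by
  have hm : Measurable fun h : ι → ℝ => ENNReal.ofReal (Real.exp (∑ i, b i * h i - q h / 2)) := by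
    fun_prop
  have hneg : ∫⁻ h : ι → ℝ, ENNReal.ofReal (Real.exp (∑ i, b i * h i - q h / 2)) =
      ∫⁻ h : ι → ℝ, ENNReal.ofReal (Real.exp (-∑ i, b i * h i - q h / 2)) := by
    rw [← lintegral_neg_eq_self]
    refine lintegral_congr fun h => ?_
    have : q (-h) = q h := by simpa using hqs (-1) h
    rw [this]
    simp
  have h2 : 2 * ∫⁻ h : ι → ℝ, ENNReal.ofReal (Real.exp (-(q h / 2))) ≤
      2 * ∫⁻ h : ι → ℝ, ENNReal.ofReal (Real.exp (∑ i, b i * h i - q h / 2)) := by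
    conv_rhs => rw [two_mul]
    nth_rewrite 2 [hneg]
    rw [← lintegral_add_left hm, ← lintegral_const_mul _ (by fun_prop)]
    refine lintegral_mono fun h => ?_
    rw [show (2 : ℝ≥0∞) = ENNReal.ofReal 2 by simp, ← ENNReal.ofReal_mul (by norm_num),
      ← ENNReal.ofReal_add (Real.exp_pos _).le (Real.exp_pos _).le]
    refine ENNReal.ofReal_le_ofReal ?_
    have hc := Real.one_le_cosh (∑ i, b i * h i)
    rw [Real.cosh_eq] at hc
    rw [sub_eq_add_neg, sub_eq_add_neg, Real.exp_add, Real.exp_add, ← add_mul]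
    exact mul_le_mul_of_nonneg_right (by linarith) (Real.exp_pos _).le
  exact (ENNReal.mul_le_mul_iff_right (by norm_num) (by norm_num)).1 h2

lemma linear_le_quadratic (hκ : 0 < κ) (hqκ : ∀ h, κ * ∑ i, h i ^ 2 ≤ q h) (h : ι → ℝ) :
    ∑ i, b i * h i ≤ (∑ i, b i ^ 2) / κ + q h / 4 := by
  have h1 : ∑ i, b i * h i ≤ ∑ i, (b i ^ 2 / κ + κ * h i ^ 2 / 4) := by
    refine Finset.sum_le_sum fun i _ => ?_
    have h2 : 0 ≤ (b i - κ * h i / 2) ^ 2 / κ := by positivity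
    have h3 : (b i - κ * h i / 2) ^ 2 / κ = b i ^ 2 / κ + κ * h i ^ 2 / 4 - b i * h i := by
      field_simp
      ring
    linarith
  rw [Finset.sum_add_distrib, ← Finset.sum_div, ← Finset.sum_div, ← Finset.mul_sum] at h1
  linarith [hqκ h]

/-- Of the exponent -q/2, one quarter of q absorbs the linear term, one eighth gives the factor
exp(-κr/8) on the tail, and the last eighth keeps the integral comparable to the Gaussian one. -/
lemma setLIntegral_quadratic_tail_le (hκ : 0 < κ) (hqκ : ∀ h, κ * ∑ i, h i ^ 2 ≤ q h)
    (hqs : ∀ (s : ℝ) h, q (s • h) = s ^ 2 * q h) (r : ℝ) :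
    ∫⁻ h : ι → ℝ in {h | r < ∑ i, h i ^ 2},
        ENNReal.ofReal (Real.exp (∑ i, b i * h i - q h / 2)) ≤
      ENNReal.ofReal (2 ^ Fintype.card ι * Real.exp ((∑ i, b i ^ 2) / κ - κ * r / 8)) *
        ∫⁻ h : ι → ℝ, ENNReal.ofReal (Real.exp (-(q h / 2))) := by
  have hS : MeasurableSet {h : ι → ℝ | r < ∑ i, h i ^ 2} :=
    measurableSet_lt measurable_const (by fun_prop)
  have h1 : ∫⁻ h : ι → ℝ in {h | r < ∑ i, h i ^ 2},
        ENNReal.ofReal (Real.exp (∑ i, b i * h i - q h / 2)) ≤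
      ∫⁻ h : ι → ℝ in {h | r < ∑ i, h i ^ 2},
        ENNReal.ofReal (Real.exp ((∑ i, b i ^ 2) / κ - κ * r / 8)) *
          ENNReal.ofReal (Real.exp (-(q h / 8))) := by
    refine setLIntegral_mono' hS fun h hh => ?_
    rw [← ENNReal.ofReal_mul (Real.exp_pos _).le, ← Real.exp_add]
    refine ENNReal.ofReal_le_ofReal (Real.exp_le_exp.2 ?_)
    have h2 := linear_le_quadratic (b := b) hκ hqκ h
    have h3 : κ * r ≤ q h := (mul_le_mul_of_nonneg_left (le_of_lt hh) hκ.le).trans (hqκ h)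
    linarith
  refine h1.trans ((setLIntegral_le_lintegral _ _).trans ?_)
  rw [lintegral_const_mul' _ _ ENNReal.ofReal_ne_top, lintegral_quarter_quadratic hqs,
    ← mul_assoc, ← ENNReal.ofReal_mul (Real.exp_pos _).le, mul_comm (Real.exp _)]

/-- Posterior tail bound for a product Gaussian prior and a log-quadratic likelihood. -/
lemma bayesPosterior_tail_le {v : ι → ℝ≥0} (hv : ∀ i, v i ≠ 0) {lik : (ι → ℝ) → ℝ≥0∞}
    {a₀ B : ι → ℝ} {c : ℝ} (hc : 0 < c) (hq : Measurable q)
    (hqs : ∀ (s : ℝ) h, q (s • h) = s ^ 2 * q h)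
    (hκ : 0 < κ) (hqκ : ∀ h, κ * ∑ i, h i ^ 2 ≤ q h)
    (hlik : ∀ h, lik (a₀ + h) = ENNReal.ofReal (c * Real.exp (∑ i, B i * h i - q h / 2)))
    (r : ℝ) :
    bayesPosterior (Measure.pi fun i => gaussianReal 0 (v i)) lik
        {a | r < ∑ i, (a i - a₀ i) ^ 2} ≤
      ENNReal.ofReal (2 ^ Fintype.card ι *
        Real.exp ((∑ i, (B i - a₀ i / v i) ^ 2) / κ - κ * r / 8)) := by
  -- q' and b are the quadratic and linear parts of prior times likelihood around `a₀`. The prior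
  -- part of q' is nonnegative, so κ is taken from the likelihood alone.
  let q' : (ι → ℝ) → ℝ := fun h => q h + ∑ i, h i ^ 2 / v i
  let b : ι → ℝ := fun i => B i - a₀ i / v i
  have hq' : Measurable q' := by fun_prop
  have hqs' : ∀ (s : ℝ) h, q' (s • h) = s ^ 2 * q' h := by
    intro s h
    simp only [q', hqs, mul_add, Finset.mul_sum]
    congr 1
    refine Finset.sum_congr rfl fun i _ => ?_
    simp only [Pi.smul_apply, smul_eq_mul]
    ring
  have hqκ' : ∀ h, κ * ∑ i, h i ^ 2 ≤ q' h := fun h =>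
    (hqκ h).trans (le_add_of_nonneg_right (Finset.sum_nonneg fun i _ => by positivity))
  have hpdf : ∀ h : ι → ℝ, ∏ i, gaussianPDF 0 (v i) ((a₀ + h) i) =
      ENNReal.ofReal ((∏ i, gaussianPDFReal 0 (v i) (a₀ i)) *
        Real.exp (-∑ i, a₀ i / v i * h i - (∑ i, h i ^ 2 / v i) / 2)) := by
    intro h
    simp only [gaussianPDF]
    rw [← ENNReal.ofReal_prod_of_nonneg fun i _ => gaussianPDFReal_nonneg _ _ _]
    congr 1
    rw [Finset.sum_div, ← Finset.sum_neg_distrib, ← Finset.sum_sub_distrib, Real.exp_sum,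
      ← Finset.prod_mul_distrib]
    refine Finset.prod_congr rfl fun i _ => ?_
    simp only [gaussianPDFReal, sub_zero, Pi.add_apply]
    conv_rhs => rw [mul_assoc, ← Real.exp_add]
    congr 2
    have : (v i : ℝ) ≠ 0 := by exact_mod_cast hv i
    field_simp
    ring
  set c' : ℝ := c * ∏ i, gaussianPDFReal 0 (v i) (a₀ i) with hc'
  have hc'0 : 0 < c' := mul_pos hc (Finset.prod_pos fun i _ => gaussianPDFReal_pos _ _ _ (hv i))
  have hden : ∀ h : ι → ℝ, (∏ i, gaussianPDF 0 (v i) ((a₀ + h) i)) * lik (a₀ + h) =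
      ENNReal.ofReal c' * ENNReal.ofReal (Real.exp (∑ i, b i * h i - q' h / 2)) := by
    intro h
    rw [hpdf, hlik, ← ENNReal.ofReal_mul, ← ENNReal.ofReal_mul hc'0.le]
    · congr 1
      have he : ∑ i, b i * h i - q' h / 2 =
          (∑ i, B i * h i - q h / 2) + (-∑ i, a₀ i / v i * h i - (∑ i, h i ^ 2 / v i) / 2) := by
        simp only [b, q', sub_mul, Finset.sum_sub_distrib]
        ring
      rw [he, Real.exp_add, hc']
      ring
    · exact mul_nonneg (Finset.prod_nonneg fun i _ => gaussianPDFReal_nonneg _ _ _)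
        (Real.exp_pos _).le
  -- Finiteness of the prior density permits the change of density without measurability of `lik`.
  have hlt : ∀ᵐ a : ι → ℝ, ∏ i, gaussianPDF 0 (v i) (a i) < ∞ :=
    Eventually.of_forall fun a => ENNReal.prod_lt_top fun i _ => gaussianPDF_lt_top
  have hmp : Measurable fun a : ι → ℝ => ∏ i, gaussianPDF 0 (v i) (a i) :=
    Finset.measurable_fun_prod _ fun i _ => (measurable_gaussianPDF _ _).comp (measurable_pi_apply i)
  have hS : MeasurableSet {a : ι → ℝ | r < ∑ i, (a i - a₀ i) ^ 2} :=
    measurableSet_lt measurable_const (by fun_prop)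
  have hS' : MeasurableSet {h : ι → ℝ | r < ∑ i, h i ^ 2} :=
    measurableSet_lt measurable_const (by fun_prop)
  have hD : ∫⁻ a, lik a ∂(Measure.pi fun i => gaussianReal 0 (v i)) =
      ENNReal.ofReal c' *
        ∫⁻ h : ι → ℝ, ENNReal.ofReal (Real.exp (∑ i, b i * h i - q' h / 2)) := by
    rw [pi_gaussianReal_eq_withDensity hv,
      lintegral_withDensity_eq_lintegral_mul_non_measurable _ hmp hlt,
      ← lintegral_add_left_eq_self _ a₀]
    simp only [Pi.mul_apply, hden]
    rw [lintegral_const_mul' _ _ ENNReal.ofReal_ne_top]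
  have hN : ∫⁻ a in {a | r < ∑ i, (a i - a₀ i) ^ 2}, lik a
        ∂(Measure.pi fun i => gaussianReal 0 (v i)) =
      ENNReal.ofReal c' * ∫⁻ h : ι → ℝ in {h | r < ∑ i, h i ^ 2},
        ENNReal.ofReal (Real.exp (∑ i, b i * h i - q' h / 2)) := by
    rw [pi_gaussianReal_eq_withDensity hv, restrict_withDensity hS,
      lintegral_withDensity_eq_lintegral_mul_non_measurable _ hmp (ae_restrict_of_ae hlt),
      ← lintegral_indicator hS, ← lintegral_add_left_eq_self _ a₀,
      ← lintegral_const_mul' _ _ ENNReal.ofReal_ne_top, ← lintegral_indicator hS']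
    refine lintegral_congr fun h => ?_
    by_cases hh : r < ∑ i, h i ^ 2
    · rw [Set.indicator_of_mem (by simpa using hh), Set.indicator_of_mem (by simpa using hh),
        Pi.mul_apply, hden]
    · rw [Set.indicator_of_notMem (by simpa using hh), Set.indicator_of_notMem (by simpa using hh)]
  rw [bayesPosterior, Measure.smul_apply, smul_eq_mul, withDensity_apply _ hS, hD, hN]
  set W := ∫⁻ h : ι → ℝ, ENNReal.ofReal (Real.exp (∑ i, b i * h i - q' h / 2))
  have hc1 : ENNReal.ofReal c' ≠ 0 := by simpa using hc'0
  rw [ENNReal.mul_inv (Or.inl hc1) (Or.inl ENNReal.ofReal_ne_top)]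
  set T := ∫⁻ h : ι → ℝ in {h | r < ∑ i, h i ^ 2},
        ENNReal.ofReal (Real.exp (∑ i, b i * h i - q' h / 2))
  set E := ENNReal.ofReal (2 ^ Fintype.card ι * Real.exp ((∑ i, b i ^ 2) / κ - κ * r / 8))
  have hT : T ≤ E * W :=
    (setLIntegral_quadratic_tail_le hκ hqκ' hqs' r).trans
      (mul_le_mul_right (lintegral_quadratic_le hq' hqs' b) _)
  calc (ENNReal.ofReal c')⁻¹ * W⁻¹ * (ENNReal.ofReal c' * T)
      = ((ENNReal.ofReal c')⁻¹ * ENNReal.ofReal c') * (W⁻¹ * T) := by ring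
    _ = W⁻¹ * T := by rw [ENNReal.inv_mul_cancel hc1 ENNReal.ofReal_ne_top, one_mul]
    _ ≤ W⁻¹ * (E * W) := mul_le_mul_right hT _
    _ = E * (W⁻¹ * W) := by ring
    -- An inequality suffices, so W need not be shown positive and finite.
    _ ≤ E * 1 := mul_le_mul_right (ENNReal.inv_mul_le_one W) _
    _ = E := mul_one E

/-- The total mass of a Bayes posterior is at most one. -/
lemma bayesPosterior_le_one {Θ : Type*} [MeasurableSpace Θ] (prior : Measure Θ)
    (lik : Θ → ℝ≥0∞) (s : Set Θ) : bayesPosterior prior lik s ≤ 1 := by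
  refine (measure_mono (Set.subset_univ s)).trans ?_
  rw [bayesPosterior, Measure.smul_apply, smul_eq_mul, withDensity_apply _ MeasurableSet.univ,
    Measure.restrict_univ]
  exact ENNReal.inv_mul_le_one _

end Posterior

/-! ### Sums of weighted feature vectors -/

section Weighted

variable {Z : Type*} [MeasurableSpace Z] {μ : Measure Z}
variable {H : Type*} [NormedAddCommGroup H] [InnerProductSpace ℝ H]

lemma memLp_smul_of_bounded [MeasurableSpace H] [BorelSpace H] [SecondCountableTopology H]
    {w : Z → ℝ} {Φ : Z → H} (hΦ : Measurable Φ) {D : ℝ}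
    (hD : ∀ z, ‖Φ z‖ ^ 2 ≤ D) {p : ℝ≥0∞} (hw : MemLp w p μ) :
    MemLp (fun z => w z • Φ z) p μ := by
  refine MemLp.of_le_mul (c := √D) hw (hw.1.smul hΦ.aestronglyMeasurable)
    (Eventually.of_forall fun z => ?_)
  rw [norm_smul, mul_comm]
  exact mul_le_mul_of_nonneg_right (Real.le_sqrt_of_sq_le (hD z)) (norm_nonneg _)

lemma integral_norm_smul_sq_le [MeasurableSpace H] [BorelSpace H]
    [SecondCountableTopology H] {w : Z → ℝ} {Φ : Z → H} (hΦ : Measurable Φ) {D : ℝ}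
    (hD : ∀ z, ‖Φ z‖ ^ 2 ≤ D) (hw : MemLp w 2 μ) :
    ∫ z, ‖w z • Φ z‖ ^ 2 ∂μ ≤ D * ∫ z, w z ^ 2 ∂μ := by
  rw [← integral_const_mul]
  refine integral_mono ((memLp_smul_of_bounded hΦ hD hw).integrable_norm_pow (by norm_num))
    (hw.integrable_sq.const_mul D) fun z => ?_
  simp only [norm_smul, mul_pow, Real.norm_eq_abs, sq_abs]
  rw [mul_comm]
  exact mul_le_mul_of_nonneg_right (hD z) (sq_nonneg _)

variable [IsProbabilityMeasure μ] [CompleteSpace H]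

lemma integral_norm_sub_integral_sq {V : Z → H} (hV : MemLp V 2 μ) :
    ∫ z, ‖V z - ∫ z', V z' ∂μ‖ ^ 2 ∂μ = ∫ z, ‖V z‖ ^ 2 ∂μ - ‖∫ z', V z' ∂μ‖ ^ 2 := by
  set m := ∫ z', V z' ∂μ
  have hi : Integrable V μ := hV.integrable (by norm_num)
  have hi2 : Integrable (fun z => ‖V z‖ ^ 2) μ := hV.integrable_norm_pow (by norm_num)
  have hin : Integrable (fun z => inner ℝ (V z) m) μ := hi.inner_const m
  have hz : ∫ z, inner ℝ (V z) m ∂μ = ‖m‖ ^ 2 := by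
    simp_rw [real_inner_comm m]
    rw [integral_inner hi, real_inner_self_eq_norm_sq]
  simp_rw [norm_sub_sq_real]
  have hi3 : Integrable (fun z => ‖V z‖ ^ 2 - 2 * inner ℝ (V z) m) μ := hi2.sub (hin.const_mul 2)
  rw [integral_add hi3 (integrable_const _), integral_sub hi2 (hin.const_mul 2),
    integral_const_mul, hz]
  simp only [integral_const, probReal_univ, smul_eq_mul, one_mul]
  ring

variable [MeasurableSpace H] [BorelSpace H] [SecondCountableTopology H]

/-- Markov bound for centred sums of weighted bounded features. -/
lemma measure_weighted_sum_gt_le {w : Z → ℝ} (hwm : Measurable w) {Φ : Z → H}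
    (hΦ : Measurable Φ) {D : ℝ} (hD : ∀ z, ‖Φ z‖ ^ 2 ≤ D) (hw : MemLp w 2 μ) (n : ℕ) {t : ℝ}
    (ht : 0 < t) :
    (Measure.pi fun _ : Fin n => μ)
        {z | t < ‖∑ i, (w (z i) • Φ (z i) - ∫ z', w z' • Φ z' ∂μ)‖ ^ 2} ≤
      ENNReal.ofReal (n * (D * ∫ z, w z ^ 2 ∂μ) / t) := by
  have hV := memLp_smul_of_bounded hΦ hD hw
  have h := measure_norm_sum_sq_ge_le (U := fun z => w z • Φ z - ∫ z', w z' • Φ z' ∂μ)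
    ((hwm.smul hΦ).sub_const _) (hV.sub (memLp_const _)) (by
      rw [integral_sub (hV.integrable (by norm_num)) (integrable_const _)]
      simp) n ht
  refine h.trans (ENNReal.ofReal_le_ofReal ?_)
  rw [integral_norm_sub_integral_sq hV]
  have := integral_norm_smul_sq_le hΦ hD hw
  gcongr
  have := sq_nonneg ‖∫ z', w z' • Φ z' ∂μ‖
  linarith

/-- Chebyshev bound for centred sums of weighted bounded features. -/
lemma measure_weighted_sum_gt_le_of_fourth {w : Z → ℝ} (hwm : Measurable w) {Φ : Z → H}
    (hΦ : Measurable Φ) {D : ℝ} (hD : ∀ z, ‖Φ z‖ ^ 2 ≤ D) (hw : MemLp w 4 μ)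
    {τ : ℝ} (hτ0 : 0 ≤ τ) (hτ : ∀ s : H, ∫ z, w z ^ 2 * inner ℝ s (Φ z) ^ 2 ∂μ ≤ τ * ‖s‖ ^ 2)
    (n : ℕ) {t : ℝ} (ht : 0 < t) :
    (Measure.pi fun _ : Fin n => μ)
        {z | n * (D * ∫ z, w z ^ 2 ∂μ) + t <
          ‖∑ i, (w (z i) • Φ (z i) - ∫ z', w z' • Φ z' ∂μ)‖ ^ 2} ≤
      ENNReal.ofReal (n * (8 * τ * (n * (D * ∫ z, w z ^ 2 ∂μ)) +
        16 * D ^ 2 * (∫ z, w z ^ 4 ∂μ + (∫ z, w z ^ 2 ∂μ) ^ 2)) / t ^ 2) := by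
  have hw2 : MemLp w 2 μ := hw.mono_exponent (by norm_num)
  have hV := memLp_smul_of_bounded hΦ hD hw
  have hV2 : MemLp (fun z => w z • Φ z) 2 μ := memLp_smul_of_bounded hΦ hD hw2
  have hD0 : 0 ≤ D := by
    obtain ⟨z⟩ := μ.nonempty_of_neZero
    exact (sq_nonneg _).trans (hD z)
  set m := ∫ z', w z' • Φ z' ∂μ with hm
  set A₂ := ∫ z, w z ^ 2 ∂μ
  set A₄ := ∫ z, w z ^ 4 ∂μ
  have hA₂ : 0 ≤ A₂ := integral_nonneg fun _ => sq_nonneg _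
  have hvar := integral_norm_sub_integral_sq hV2
  have hsq := integral_norm_smul_sq_le hΦ hD hw2
  have hm2 : ‖m‖ ^ 2 ≤ D * A₂ := by
    have h0 : 0 ≤ ∫ z, ‖w z • Φ z - m‖ ^ 2 ∂μ := integral_nonneg fun _ => sq_nonneg _
    rw [hvar] at h0
    linarith
  have hU2 : ∫ z, ‖w z • Φ z - m‖ ^ 2 ∂μ ≤ D * A₂ := by
    rw [hvar]
    linarith [sq_nonneg ‖m‖]
  have hU : MemLp (fun z => w z • Φ z - m) 4 μ := hV.sub (memLp_const _)
  have hw4i : Integrable (fun z => w z ^ 4) μ := by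
    have := hw.integrable_norm_pow (by norm_num)
    refine this.congr (Eventually.of_forall fun z => ?_)
    simp only [Real.norm_eq_abs]
    exact Even.pow_abs (by decide) _
  have hU4 : ∫ z, ‖w z • Φ z - m‖ ^ 4 ∂μ ≤ 8 * D ^ 2 * (A₄ + A₂ ^ 2) := by
    have h1 : ∫ z, ‖w z • Φ z - m‖ ^ 4 ∂μ ≤
        ∫ z, (8 * D ^ 2 * w z ^ 4 + 8 * (D * A₂) ^ 2) ∂μ := by
      refine integral_mono (hU.integrable_norm_pow (by norm_num))
        ((hw4i.const_mul _).add (integrable_const _)) fun z => ?_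
      have h2 : ‖w z • Φ z - m‖ ^ 4 ≤ (‖w z • Φ z‖ + ‖m‖) ^ 4 :=
        pow_le_pow_left₀ (norm_nonneg _) (norm_sub_le _ _) 4
      have h3 : (‖w z • Φ z‖ + ‖m‖) ^ 4 ≤ 8 * (‖w z • Φ z‖ ^ 4 + ‖m‖ ^ 4) := by
        have := add_pow_le (norm_nonneg (w z • Φ z)) (norm_nonneg m) 4
        norm_num at this
        linarith
      have h4 : ‖w z • Φ z‖ ^ 4 ≤ D ^ 2 * w z ^ 4 := by
        have : ‖w z • Φ z‖ ^ 4 = (‖Φ z‖ ^ 2) ^ 2 * w z ^ 4 := by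
          rw [norm_smul, mul_pow, Real.norm_eq_abs, Even.pow_abs (by decide)]
          ring
        rw [this]
        exact mul_le_mul_of_nonneg_right (pow_le_pow_left₀ (sq_nonneg _) (hD z) 2) (by positivity)
      have h5 : ‖m‖ ^ 4 ≤ (D * A₂) ^ 2 := by
        have := pow_le_pow_left₀ (sq_nonneg _) hm2 2
        calc ‖m‖ ^ 4 = (‖m‖ ^ 2) ^ 2 := by ring
          _ ≤ _ := this
      dsimp only
      linarith
    rw [integral_add (hw4i.const_mul _) (integrable_const _), integral_const_mul] at h1
    simp only [integral_const, probReal_univ, smul_eq_mul, one_mul] at h1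
    calc _ ≤ _ := h1
      _ = _ := by ring
  -- Centring only lowers the variance in each direction.
  have hτ' : ∀ s : H, ∫ z, inner ℝ s (w z • Φ z - m) ^ 2 ∂μ ≤ τ * ‖s‖ ^ 2 := by
    intro s
    have hX : MemLp (fun z => inner ℝ s (w z • Φ z)) 2 μ := hV2.const_inner s
    have hXi : Integrable (fun z => inner ℝ s (w z • Φ z)) μ := hX.integrable (by norm_num)
    have h1 := integral_norm_sub_integral_sq hX
    have h2 : ∫ z, inner ℝ s (w z • Φ z) ∂μ = inner ℝ s m :=
      integral_inner (hV2.integrable (by norm_num)) s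
    rw [h2] at h1
    simp only [Real.norm_eq_abs, sq_abs] at h1
    simp_rw [inner_sub_right]
    rw [h1]
    have h3 := hτ s
    simp_rw [inner_smul_right, mul_pow]
    linarith [sq_nonneg (inner ℝ s m : ℝ)]
  have h := measure_norm_sum_sq_gt_le (U := fun z => w z • Φ z - m)
    ((hwm.smul hΦ).sub_const _) hU (by
      rw [integral_sub (hV.integrable (by norm_num)) (integrable_const _)]
      simp [hm]) hτ0 hτ' n ht
  refine (measure_mono fun z hz => ?_).trans (h.trans (ENNReal.ofReal_le_ofReal ?_))
  · simp only [Set.mem_ofPred_eq] at hz ⊢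
    refine lt_of_le_of_lt ?_ hz
    gcongr
  · refine div_le_div_of_nonneg_right (mul_le_mul_of_nonneg_left (add_le_add ?_ ?_)
      n.cast_nonneg) (sq_nonneg t)
    · gcongr
    · linarith

end Weighted

/-! ### The regression model -/

section Model

variable {d : ℕ} {σ : ℝ≥0} {f₀ : SphereD d → ℝ}

lemma measurable_obsMap (hf : Measurable f₀) :
    Measurable fun p : SphereD d × ℝ => (p.1, f₀ p.1 + p.2) := by fun_prop

lemma isProbabilityMeasure_obsLaw (hf : Measurable f₀) : IsProbabilityMeasure (obsLaw σ f₀) :=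
  Measure.isProbabilityMeasure_map (measurable_obsMap hf).aemeasurable

lemma integral_obsLaw (hf : Measurable f₀) {F : SphereD d × ℝ → ℝ} (hF : Measurable F) :
    ∫ z, F z ∂(obsLaw σ f₀) =
      ∫ p, F (p.1, f₀ p.1 + p.2) ∂((unifSphere d).prod (gaussianReal 0 (σ ^ 2))) :=
  integral_map (measurable_obsMap hf).aemeasurable hF.aestronglyMeasurable

lemma map_fst_obsLaw (hf : Measurable f₀) : (obsLaw σ f₀).map Prod.fst = unifSphere d := by
  rw [obsLaw, Measure.map_map measurable_fst (measurable_obsMap hf)]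
  have : Prod.fst ∘ (fun p : SphereD d × ℝ => (p.1, f₀ p.1 + p.2)) = Prod.fst := rfl
  rw [this, Measure.map_fst_prod]
  simp

lemma measurePreserving_fst_obsLaw (hf : Measurable f₀) :
    MeasurePreserving Prod.fst (obsLaw σ f₀) (unifSphere d) :=
  ⟨measurable_fst, map_fst_obsLaw hf⟩

lemma integral_sq_gaussianReal (v : ℝ≥0) : ∫ e, e ^ 2 ∂(gaussianReal 0 v) = v := by
  have h := variance_eq_integral (μ := gaussianReal 0 v) (X := id) aemeasurable_id
  rw [variance_id_gaussianReal] at h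
  simpa using h.symm

/-- Shifted noise `p(x) + ε` as a function of the observation `(x, y)`. -/
def shiftedNoise (f₀ p : SphereD d → ℝ) (z : SphereD d × ℝ) : ℝ := p z.1 + (z.2 - f₀ z.1)

lemma measurable_shiftedNoise (hf : Measurable f₀) {p : SphereD d → ℝ} (hp : Measurable p) :
    Measurable (shiftedNoise f₀ p) := by
  unfold shiftedNoise
  fun_prop

lemma memLp_shiftedNoise (hf : Measurable f₀) {p : SphereD d → ℝ} (hp : Measurable p)
    {T : ℝ} (hT : ∀ x, |p x| ≤ T) : MemLp (shiftedNoise f₀ p) 4 (obsLaw σ f₀) := by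
  rw [obsLaw, memLp_map_measure_iff (measurable_shiftedNoise hf hp).aestronglyMeasurable
    (measurable_obsMap hf).aemeasurable]
  have h : shiftedNoise f₀ p ∘ (fun p : SphereD d × ℝ => (p.1, f₀ p.1 + p.2)) =
      (fun z => p z.1) + fun z => z.2 := by
    ext z
    simp [shiftedNoise]
  rw [h]
  refine MemLp.add ?_ ?_
  · exact MemLp.of_bound (hp.comp measurable_fst).aestronglyMeasurable T
      (Eventually.of_forall fun z => hT z.1)
  · have : MemLp id 4 (gaussianReal 0 (σ ^ 2)) := memLp_id_gaussianReal 4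
    exact this.comp_snd _

lemma integral_shiftedNoise_mul (hf : Measurable f₀) {p u : SphereD d → ℝ} (hp : Measurable p)
    {T : ℝ} (hT : ∀ x, |p x| ≤ T) (hu : Measurable u) (hui : Integrable u (unifSphere d)) :
    ∫ z, shiftedNoise f₀ p z * u z.1 ∂(obsLaw σ f₀) = ∫ x, p x * u x ∂(unifSphere d) := by
  rw [integral_obsLaw hf (F := fun z => shiftedNoise f₀ p z * u z.1)
    ((measurable_shiftedNoise hf hp).mul (hu.comp measurable_fst))]
  have hpu : Integrable (fun x => p x * u x) (unifSphere d) :=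
    hui.bdd_mul hp.aestronglyMeasurable (Eventually.of_forall hT)
  have he : Integrable (fun e : ℝ => e) (gaussianReal 0 (σ ^ 2)) :=
    (memLp_id_gaussianReal 1).integrable (by norm_num)
  have h : ∀ z : SphereD d × ℝ, shiftedNoise f₀ p (z.1, f₀ z.1 + z.2) * u z.1 =
      p z.1 * u z.1 * 1 + u z.1 * z.2 := by
    intro z
    simp only [shiftedNoise]
    ring
  simp_rw [h]
  have hi1 := hpu.mul_prod (integrable_const (1 : ℝ) (μ := gaussianReal 0 (σ ^ 2)))
  have hi2 := hui.mul_prod he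
  rw [integral_add hi1 hi2, integral_prod_mul (fun x => p x * u x) fun _ => (1 : ℝ),
    integral_prod_mul u fun e : ℝ => e, integral_id_gaussianReal]
  simp

/-- The noise is centred and independent of the design: the cross term vanishes and the noise adds
σ². -/
lemma integral_shiftedNoise_sq_mul (hf : Measurable f₀) {p u : SphereD d → ℝ} (hp : Measurable p)
    {T : ℝ} (hT : ∀ x, |p x| ≤ T) (hu : Measurable u) (hui : Integrable u (unifSphere d)) :
    ∫ z, shiftedNoise f₀ p z ^ 2 * u z.1 ∂(obsLaw σ f₀) =
      ∫ x, (p x ^ 2 + σ ^ 2) * u x ∂(unifSphere d) := by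
  rw [integral_obsLaw hf (F := fun z => shiftedNoise f₀ p z ^ 2 * u z.1)
    (((measurable_shiftedNoise hf hp).pow_const 2).mul (hu.comp measurable_fst))]
  have hpu : Integrable (fun x => p x * u x) (unifSphere d) :=
    hui.bdd_mul hp.aestronglyMeasurable (Eventually.of_forall hT)
  have hppu : Integrable (fun x => p x * (p x * u x)) (unifSphere d) :=
    hpu.bdd_mul hp.aestronglyMeasurable (Eventually.of_forall hT)
  have he : Integrable (fun e : ℝ => e) (gaussianReal 0 (σ ^ 2)) :=
    (memLp_id_gaussianReal 1).integrable (by norm_num)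
  have he2 : Integrable (fun e : ℝ => e ^ 2) (gaussianReal 0 (σ ^ 2)) :=
    (memLp_id_gaussianReal 2).integrable_sq
  have h : ∀ z : SphereD d × ℝ, shiftedNoise f₀ p (z.1, f₀ z.1 + z.2) ^ 2 * u z.1 =
      (p z.1 * (p z.1 * u z.1) * 1 + 2 * (p z.1 * u z.1 * z.2)) + u z.1 * z.2 ^ 2 := by
    intro z
    simp only [shiftedNoise]
    ring
  simp_rw [h]
  have hi1 := hppu.mul_prod (integrable_const (1 : ℝ) (μ := gaussianReal 0 (σ ^ 2)))
  have hi2 := (hpu.mul_prod he).const_mul 2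
  have hi3 := hui.mul_prod he2
  have hi12 : Integrable (fun z : SphereD d × ℝ => p z.1 * (p z.1 * u z.1) * 1 +
      2 * (p z.1 * u z.1 * z.2)) ((unifSphere d).prod (gaussianReal 0 (σ ^ 2))) := hi1.add hi2
  rw [integral_add hi12 hi3, integral_add hi1 hi2, integral_const_mul,
    integral_prod_mul (fun x => p x * (p x * u x)) fun _ => (1 : ℝ),
    integral_prod_mul (fun x => p x * u x) fun e : ℝ => e, integral_id_gaussianReal,
    integral_prod_mul u fun e : ℝ => e ^ 2, integral_sq_gaussianReal]
  simp only [add_mul, ← mul_assoc, ← pow_two]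
  rw [integral_add, integral_const_mul]
  · simp [pow_two, mul_comm, mul_assoc]
  · simpa [pow_two, mul_assoc] using hppu
  · exact hui.const_mul _

end Model

/-! ### Concentration of the score and of the Gram matrix -/

section Score

variable {d : ℕ} {Y : (ℓ : ℕ) → Fin (harmonicMult d ℓ) → SphereD d → ℝ} {σ : ℝ≥0}
  {f₀ : SphereD d → ℝ} {L n : ℕ}

/-- The vector of harmonics of degree at most `L` at a point. -/
def harmonicVec (Y : (ℓ : ℕ) → Fin (harmonicMult d ℓ) → SphereD d → ℝ) (L : ℕ) (x : SphereD d) :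
    EuclideanSpace ℝ (TruncIndex d L) :=
  WithLp.toLp 2 fun i => truncFamily Y L i x

lemma IsHarmonicBasis.measurable_truncFamily (hY : IsHarmonicBasis d Y) (L : ℕ)
    (i : TruncIndex d L) : Measurable (truncFamily Y L i) :=
  (hY.continuous_truncFamily L i).measurable

lemma IsHarmonicBasis.measurable_harmonicVec (hY : IsHarmonicBasis d Y) (L : ℕ) :
    Measurable (harmonicVec Y L) :=
  (WithLp.measurable_toLp 2 _).comp (measurable_pi_lambda _ fun i => hY.measurable_truncFamily L i)

lemma IsHarmonicBasis.norm_harmonicVec_sq_le (hY : IsHarmonicBasis d Y) (L : ℕ)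
    (x : SphereD d) : ‖harmonicVec Y L x‖ ^ 2 ≤ Fintype.card (TruncIndex d L) := by
  rw [EuclideanSpace.norm_sq_eq]
  simpa [harmonicVec] using hY.sum_sq_truncFamily_le L x

lemma inner_harmonicVec (s : EuclideanSpace ℝ (TruncIndex d L)) (x : SphereD d) :
    inner ℝ s (harmonicVec Y L x) = ∑ i, s i * truncFamily Y L i x := by
  rw [PiLp.inner_apply]
  simp [harmonicVec, mul_comm]

lemma IsHarmonicBasis.integral_inner_harmonicVec_sq (hY : IsHarmonicBasis d Y)
    (s : EuclideanSpace ℝ (TruncIndex d L)) :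
    ∫ x, inner ℝ s (harmonicVec Y L x) ^ 2 ∂(unifSphere d) = ‖s‖ ^ 2 := by
  simp_rw [inner_harmonicVec]
  rw [integral_sq_sum_ortho (hY.continuous_truncFamily L) (hY.truncFamily_integral_mul L),
    EuclideanSpace.norm_sq_eq]
  simp

/-- Orthonormality makes the directional second moment of the features ‖s‖², so a bounded p gives a
constant free of the dimension. This is the τ of the Chebyshev bound. -/
lemma IsHarmonicBasis.integral_shiftedNoise_sq_mul_inner_le (hY : IsHarmonicBasis d Y)
    (hf : Measurable f₀) {p : SphereD d → ℝ} (hp : Measurable p) {T : ℝ} (hT : ∀ x, |p x| ≤ T)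
    (s : EuclideanSpace ℝ (TruncIndex d L)) :
    ∫ z, shiftedNoise f₀ p z ^ 2 * inner ℝ s (harmonicVec Y L z.1) ^ 2 ∂(obsLaw σ f₀) ≤
      (T ^ 2 + σ ^ 2) * ‖s‖ ^ 2 := by
  have hc : Continuous fun x => inner ℝ s (harmonicVec Y L x) ^ 2 := by
    simp_rw [inner_harmonicVec]
    exact (continuous_finsetSum _ fun i _ =>
      continuous_const.mul (hY.continuous_truncFamily L i)).pow 2
  have hi := integrable_of_continuous hc
  rw [integral_shiftedNoise_sq_mul hf hp hT hc.measurable hi,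
    ← hY.integral_inner_harmonicVec_sq, ← integral_const_mul]
  have hbd : ∀ x, p x ^ 2 ≤ T ^ 2 := fun x => sq_le_sq' (abs_le.1 (hT x)).1 (abs_le.1 (hT x)).2
  refine integral_mono ?_ (hi.const_mul _) fun x => ?_
  · refine hi.bdd_mul (c := T ^ 2 + σ ^ 2)
      ((hp.pow_const 2).add_const _).aestronglyMeasurable
      (Eventually.of_forall fun x => ?_)
    rw [Real.norm_of_nonneg (by positivity)]
    linarith [hbd x]
  · exact mul_le_mul_of_nonneg_right (by linarith [hbd x]) (sq_nonneg _)

/-- Concentration of the bounded part of the score. -/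
lemma IsHarmonicBasis.measure_score_bounded_le (hY : IsHarmonicBasis d Y)
    (hf : Measurable f₀) {p : SphereD d → ℝ} (hp : Measurable p) {T A K N : ℝ}
    (hT : ∀ x, |p x| ≤ T) (hA : ∫ x, p x ^ 2 ∂(unifSphere d) + σ ^ 2 ≤ A) (hn : 0 < n)
    (hN : 0 < N) (hK : (Fintype.card (TruncIndex d L) : ℝ) ≤ K * N) :
    dataLaw σ f₀ n {z | n * N * (K * A + 1) < ‖∑ k, (shiftedNoise f₀ p (z k) •
        harmonicVec Y L (z k).1 -
          ∫ z', shiftedNoise f₀ p z' • harmonicVec Y L z'.1 ∂(obsLaw σ f₀))‖ ^ 2} ≤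
      ENNReal.ofReal (8 * (T ^ 2 + σ ^ 2) * K * A / N + 16 * K ^ 2 *
        (∫ z, shiftedNoise f₀ p z ^ 4 ∂(obsLaw σ f₀) + A ^ 2) / n) := by
  have := isProbabilityMeasure_obsLaw (σ := σ) hf
  set D : ℝ := ((Fintype.card (TruncIndex d L) : ℕ) : ℝ)
  have hD0 : 0 ≤ D := Nat.cast_nonneg _
  have hn' : (0 : ℝ) < n := by exact_mod_cast hn
  have hA₂ : ∫ z, shiftedNoise f₀ p z ^ 2 ∂(obsLaw σ f₀) ≤ A := by
    refine le_trans (le_of_eq ?_) hA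
    have h := integral_shiftedNoise_sq_mul (σ := σ) hf hp hT (u := fun _ => 1) measurable_const
      (integrable_const _)
    simp only [mul_one] at h
    rw [h, integral_add]
    · simp
    · exact (MemLp.of_bound hp.aestronglyMeasurable T (Eventually.of_forall hT)).integrable_sq
    · exact integrable_const _
  have hA₂0 : 0 ≤ ∫ z, shiftedNoise f₀ p z ^ 2 ∂(obsLaw σ f₀) :=
    integral_nonneg fun _ => sq_nonneg _
  have hA0 : 0 ≤ A := hA₂0.trans hA₂
  have hA₄0 : 0 ≤ ∫ z, shiftedNoise f₀ p z ^ 4 ∂(obsLaw σ f₀) :=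
    integral_nonneg fun _ => by positivity
  have h := measure_weighted_sum_gt_le_of_fourth (μ := obsLaw σ f₀)
    (measurable_shiftedNoise hf hp) ((hY.measurable_harmonicVec L).comp measurable_fst)
    (fun z => hY.norm_harmonicVec_sq_le L z.1) (memLp_shiftedNoise hf hp hT)
    (τ := T ^ 2 + σ ^ 2) (by positivity)
    (fun s => hY.integral_shiftedNoise_sq_mul_inner_le hf hp hT s) n (t := n * N) (by positivity)
  refine (measure_mono fun z hz => ?_).trans (h.trans (ENNReal.ofReal_le_ofReal ?_))
  · simp only [Set.mem_ofPred_eq] at hz ⊢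
    refine lt_of_le_of_lt ?_ hz
    have h1 : D * ∫ z, shiftedNoise f₀ p z ^ 2 ∂(obsLaw σ f₀) ≤ K * N * A :=
      mul_le_mul hK hA₂ hA₂0 (hD0.trans hK)
    calc _ ≤ n * (K * N * A) + n * N := by gcongr
      _ = _ := by ring
  · set A₂ := ∫ z, shiftedNoise f₀ p z ^ 2 ∂(obsLaw σ f₀)
    set A₄ := ∫ z, shiftedNoise f₀ p z ^ 4 ∂(obsLaw σ f₀)
    have hKN : 0 ≤ K * N := hD0.trans hK
    calc n * (8 * (T ^ 2 + σ ^ 2) * (n * (D * A₂)) + 16 * D ^ 2 * (A₄ + A₂ ^ 2)) / (n * N) ^ 2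
        ≤ n * (8 * (T ^ 2 + σ ^ 2) * (n * ((K * N) * A)) +
            16 * (K * N) ^ 2 * (A₄ + A ^ 2)) / (n * N) ^ 2 := by
          gcongr
      _ = 8 * (T ^ 2 + σ ^ 2) * K * A / N + 16 * K ^ 2 * (A₄ + A ^ 2) / n := by
          field_simp

/-- Markov bound for the remaining part of the score. -/
lemma IsHarmonicBasis.measure_score_remainder_le (hY : IsHarmonicBasis d Y)
    (hf : Measurable f₀) {r : SphereD d → ℝ} (hr : Measurable r)
    (hr2 : MemLp r 2 (unifSphere d)) {K N : ℝ} (hn : 0 < n)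
    (hN : 0 < N) (hK : (Fintype.card (TruncIndex d L) : ℝ) ≤ K * N) :
    dataLaw σ f₀ n {z | n * N < ‖∑ k, (r (z k).1 • harmonicVec Y L (z k).1 -
          ∫ z', r z'.1 • harmonicVec Y L z'.1 ∂(obsLaw σ f₀))‖ ^ 2} ≤
      ENNReal.ofReal (K * ∫ x, r x ^ 2 ∂(unifSphere d)) := by
  have := isProbabilityMeasure_obsLaw (σ := σ) hf
  have hn' : (0 : ℝ) < n := by exact_mod_cast hn
  have hmp := measurePreserving_fst_obsLaw (σ := σ) hf
  have h := measure_weighted_sum_gt_le (μ := obsLaw σ f₀) (hr.comp measurable_fst)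
    ((hY.measurable_harmonicVec L).comp measurable_fst)
    (fun z => hY.norm_harmonicVec_sq_le L z.1) (hr2.comp_measurePreserving hmp) n
    (t := n * N) (by positivity)
  refine h.trans (ENNReal.ofReal_le_ofReal ?_)
  have h1 : ∫ z, (r ∘ Prod.fst) z ^ 2 ∂(obsLaw σ f₀) = ∫ x, r x ^ 2 ∂(unifSphere d) := by
    rw [← map_fst_obsLaw (σ := σ) hf, integral_map measurable_fst.aemeasurable
      (hr.pow_const 2).aestronglyMeasurable]
    rfl
  rw [h1]
  have h0 : 0 ≤ ∫ x, r x ^ 2 ∂(unifSphere d) := integral_nonneg fun _ => sq_nonneg _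
  calc _ ≤ n * (K * N * ∫ x, r x ^ 2 ∂(unifSphere d)) / (n * N) := by gcongr
    _ = _ := by field_simp

/-- The vector of products of pairs of harmonics at a point. -/
def harmonicPairVec (Y : (ℓ : ℕ) → Fin (harmonicMult d ℓ) → SphereD d → ℝ) (L : ℕ)
    (x : SphereD d) : EuclideanSpace ℝ (TruncIndex d L × TruncIndex d L) :=
  WithLp.toLp 2 fun i => truncFamily Y L i.1 x * truncFamily Y L i.2 x

lemma harmonicPairVec_apply (x : SphereD d) (i : TruncIndex d L × TruncIndex d L) :
    harmonicPairVec Y L x i = truncFamily Y L i.1 x * truncFamily Y L i.2 x := rfl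

lemma IsHarmonicBasis.measurable_harmonicPairVec (hY : IsHarmonicBasis d Y) (L : ℕ) :
    Measurable (harmonicPairVec Y L) :=
  (WithLp.measurable_toLp 2 _).comp (measurable_pi_lambda _ fun i =>
    (hY.measurable_truncFamily L i.1).mul (hY.measurable_truncFamily L i.2))

lemma IsHarmonicBasis.norm_harmonicPairVec_sq_le (hY : IsHarmonicBasis d Y) (L : ℕ)
    (x : SphereD d) : ‖harmonicPairVec Y L x‖ ^ 2 ≤ (Fintype.card (TruncIndex d L) : ℝ) ^ 2 := by
  have h : ‖harmonicPairVec Y L x‖ ^ 2 = (∑ i, truncFamily Y L i x ^ 2) ^ 2 := by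
    rw [EuclideanSpace.norm_sq_eq, pow_two (∑ i, _), Finset.sum_mul_sum, Fintype.sum_prod_type]
    simp [harmonicPairVec, mul_pow]
  rw [h]
  exact pow_le_pow_left₀ (Finset.sum_nonneg fun _ _ => sq_nonneg _) (hY.sum_sq_truncFamily_le L x) 2

/-- The deviation of the (unnormalised) Gram matrix from its mean. -/
def gramDeviation (Y : (ℓ : ℕ) → Fin (harmonicMult d ℓ) → SphereD d → ℝ) (σ : ℝ≥0)
    (f₀ : SphereD d → ℝ) (L : ℕ) (z : Fin n → SphereD d × ℝ) :
    EuclideanSpace ℝ (TruncIndex d L × TruncIndex d L) :=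
  ∑ k, ((1 : ℝ) • harmonicPairVec Y L (z k).1 -
    ∫ z', (1 : ℝ) • harmonicPairVec Y L z'.1 ∂(obsLaw σ f₀))

lemma IsHarmonicBasis.measure_gramDeviation_le (hY : IsHarmonicBasis d Y) (hf : Measurable f₀)
    (hn : 0 < n) {K N : ℝ} (hK : (Fintype.card (TruncIndex d L) : ℝ) ≤ K * N) :
    dataLaw σ f₀ n {z | (n : ℝ) ^ 2 / 4 < ‖gramDeviation Y σ f₀ L z‖ ^ 2} ≤
      ENNReal.ofReal (4 * (K * N) ^ 2 / n) := by
  have := isProbabilityMeasure_obsLaw (σ := σ) hf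
  have hn' : (0 : ℝ) < n := by exact_mod_cast hn
  have h := measure_weighted_sum_gt_le (μ := obsLaw σ f₀) (w := fun _ => 1) measurable_const
    ((hY.measurable_harmonicPairVec L).comp measurable_fst)
    (fun z => hY.norm_harmonicPairVec_sq_le L z.1) (memLp_const _) n
    (t := (n : ℝ) ^ 2 / 4) (by positivity)
  refine h.trans (ENNReal.ofReal_le_ofReal ?_)
  have h1 : ((Fintype.card (TruncIndex d L) : ℝ)) ^ 2 ≤ (K * N) ^ 2 :=
    pow_le_pow_left₀ (Nat.cast_nonneg _) hK 2
  simp only [one_pow, integral_const, probReal_univ, smul_eq_mul, mul_one]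
  calc _ ≤ n * (K * N) ^ 2 / ((n : ℝ) ^ 2 / 4) := by gcongr
    _ = _ := by field_simp

lemma EuclideanSpace.integral_apply {Z ι : Type*} [MeasurableSpace Z] [Fintype ι]
    {μ : Measure Z} {V : Z → EuclideanSpace ℝ ι} (hV : Integrable V μ) (i : ι) :
    (∫ z, V z ∂μ) i = ∫ z, V z i ∂μ :=
  ((EuclideanSpace.proj (𝕜 := ℝ) i).integral_comp_comm hV).symm

/-- The difference ∑_k f_h(x_k)² - n|h|² is the inner product of h ⊗ h with the Gram deviation.
Since ‖h ⊗ h‖ = |h|², Cauchy–Schwarz bounds it by n|h|²/2. -/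
lemma IsHarmonicBasis.half_norm_sq_le_design (hY : IsHarmonicBasis d Y) (hf : Measurable f₀)
    {z : Fin n → SphereD d × ℝ}
    (hz : ‖gramDeviation Y σ f₀ L z‖ ^ 2 ≤ (n : ℝ) ^ 2 / 4) (h : TruncIndex d L → ℝ) :
    n / 2 * ∑ i, h i ^ 2 ≤ ∑ k, harmonicSum Y h (z k).1 ^ 2 := by
  have := isProbabilityMeasure_obsLaw (σ := σ) hf
  set R := gramDeviation Y σ f₀ L z with hR
  have hR1 : ‖R‖ ≤ n / 2 := by
    refine abs_le_of_sq_le_sq' ?_ (by positivity) |>.2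
    calc ‖R‖ ^ 2 ≤ (n : ℝ) ^ 2 / 4 := hz
      _ = (n / 2) ^ 2 := by ring
  have hVi : Integrable (fun z' : SphereD d × ℝ => (1 : ℝ) • harmonicPairVec Y L z'.1)
      (obsLaw σ f₀) :=
    (memLp_smul_of_bounded (w := fun _ => (1 : ℝ))
      ((hY.measurable_harmonicPairVec L).comp measurable_fst)
      (fun z => hY.norm_harmonicPairVec_sq_le L z.1) (memLp_const 1)).integrable le_rfl
  have hRe : ∀ i j, R (i, j) =
      ∑ k, truncFamily Y L i (z k).1 * truncFamily Y L j (z k).1 - n * if i = j then 1 else 0 := by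
    intro i j
    have hm : (∫ z' : SphereD d × ℝ, (1 : ℝ) • harmonicPairVec Y L z'.1 ∂(obsLaw σ f₀)) (i, j) =
        if i = j then 1 else 0 := by
      rw [EuclideanSpace.integral_apply hVi]
      have h1 := integral_map (μ := obsLaw σ f₀) measurable_fst.aemeasurable
        (f := fun x => truncFamily Y L i x * truncFamily Y L j x)
        ((hY.measurable_truncFamily L i).mul (hY.measurable_truncFamily L j)).aestronglyMeasurable
      rw [map_fst_obsLaw hf, hY.truncFamily_integral_mul] at h1
      rw [h1]
      simp [harmonicPairVec_apply]
    simp only [one_smul] at hm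
    rw [hR, gramDeviation]
    simp [hm, harmonicPairVec_apply, Finset.sum_sub_distrib]
  let hh : EuclideanSpace ℝ (TruncIndex d L × TruncIndex d L) :=
    WithLp.toLp 2 fun i => h i.1 * h i.2
  have hhn : ‖hh‖ = ∑ i, h i ^ 2 := by
    have h0 : 0 ≤ ∑ i, h i ^ 2 := Finset.sum_nonneg fun _ _ => sq_nonneg _
    have h1 : ‖hh‖ ^ 2 = (∑ i, h i ^ 2) ^ 2 := by
      rw [EuclideanSpace.norm_sq_eq, pow_two (∑ i, _), Finset.sum_mul_sum, Fintype.sum_prod_type]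
      simp [hh, mul_pow]
    exact (pow_left_inj₀ (norm_nonneg _) h0 two_ne_zero).1 h1
  have hin : inner ℝ hh R = ∑ k, harmonicSum Y h (z k).1 ^ 2 - n * ∑ i, h i ^ 2 := by
    rw [PiLp.inner_apply, Fintype.sum_prod_type]
    have h1 : ∀ i j, inner ℝ (hh (i, j)) (R (i, j)) =
        ∑ k, (h i * truncFamily Y L i (z k).1) * (h j * truncFamily Y L j (z k).1) -
          n * if i = j then h i * h j else 0 := by
      intro i j
      rw [hRe]
      simp only [hh, RCLike.inner_apply, conj_trivial, sub_mul, Finset.sum_mul]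
      congr 1
      · exact Finset.sum_congr rfl fun k _ => by ring
      · split_ifs <;> ring
    simp_rw [h1, Finset.sum_sub_distrib]
    congr 1
    · have h2 : ∀ k, harmonicSum Y h (z k).1 ^ 2 = ∑ i, ∑ j,
          (h i * truncFamily Y L i (z k).1) * (h j * truncFamily Y L j (z k).1) := by
        intro k
        rw [pow_two, harmonicSum, Finset.sum_mul_sum]
        rfl
      simp_rw [h2]
      rw [Finset.sum_comm (s := Finset.univ (α := Fin n))]
      exact Finset.sum_congr rfl fun i _ => Finset.sum_comm
    · simp [← Finset.mul_sum, pow_two]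
  have hcs := abs_real_inner_le_norm hh R
  rw [hhn] at hcs
  have h0 : 0 ≤ ∑ i, h i ^ 2 := Finset.sum_nonneg fun _ _ => sq_nonneg _
  have h3 : (∑ i, h i ^ 2) * ‖R‖ ≤ (∑ i, h i ^ 2) * (n / 2) := mul_le_mul_of_nonneg_left hR1 h0
  have h4 := (abs_le.1 hcs).1
  rw [hin] at h4
  linarith

end Score

/-! ### Posterior tails in the two models -/

section PosteriorTails

variable {d : ℕ} {Y : (ℓ : ℕ) → Fin (harmonicMult d ℓ) → SphereD d → ℝ} {σ : ℝ≥0}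
  {f₀ : SphereD d → ℝ} {L n : ℕ}

lemma harmonicSum_add (a h : TruncIndex d L → ℝ) (x : SphereD d) :
    harmonicSum Y (a + h) x = harmonicSum Y a x + harmonicSum Y h x := by
  simp [harmonicSum, add_mul, Finset.sum_add_distrib]

lemma harmonicSum_smul (s : ℝ) (h : TruncIndex d L → ℝ) (x : SphereD d) :
    harmonicSum Y (s • h) x = s * harmonicSum Y h x := by
  simp [harmonicSum, Finset.mul_sum, mul_assoc]

lemma sum_sq_sub_le {ι : Type*} [Fintype ι] (u v : ι → ℝ) :
    ∑ i, (u i - v i) ^ 2 ≤ 2 * ∑ i, u i ^ 2 + 2 * ∑ i, v i ^ 2 := by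
  rw [Finset.mul_sum, Finset.mul_sum, ← Finset.sum_add_distrib]
  exact Finset.sum_le_sum fun i _ => by nlinarith [sq_nonneg (u i + v i)]

/-- The exponent in the posterior tail bounds. -/
def tailExponent (σ : ℝ≥0) (n : ℕ) (score bias r : ℝ) : ℝ :=
  (2 * (score / (σ : ℝ) ^ 4) + 2 * bias) / (n / (2 * (σ : ℝ) ^ 2)) -
    n / (2 * (σ : ℝ) ^ 2) * r / 8

lemma regressionPosterior_tail_le (hσ : 0 < σ) (hn : 0 < n) {C : ℕ → ℝ≥0} (hC : ∀ ℓ, C ℓ ≠ 0)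
    {z : Fin n → SphereD d × ℝ}
    (hz : ∀ h : TruncIndex d L → ℝ, n / 2 * ∑ i, h i ^ 2 ≤ ∑ k, harmonicSum Y h (z k).1 ^ 2)
    (a₀ : TruncIndex d L → ℝ) (r : ℝ) :
    regressionPosterior Y σ C L z {a | r < ∑ i, (a i - a₀ i) ^ 2} ≤
      ENNReal.ofReal (2 ^ Fintype.card (TruncIndex d L) * Real.exp (tailExponent σ n
        (∑ i, (∑ k, ((z k).2 - harmonicSum Y a₀ (z k).1) * truncFamily Y L i (z k).1) ^ 2)
        (∑ i, (a₀ i / C i.1) ^ 2) r)) := by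
  have hσ' : (0 : ℝ) < σ := by exact_mod_cast hσ
  have hn' : (0 : ℝ) < n := by exact_mod_cast hn
  have hσ2 : σ ^ 2 ≠ 0 := pow_ne_zero 2 hσ.ne'
  let S : TruncIndex d L → ℝ := fun i =>
    ∑ k, ((z k).2 - harmonicSum Y a₀ (z k).1) * truncFamily Y L i (z k).1
  have h := bayesPosterior_tail_le (v := fun i : TruncIndex d L => C i.1) (fun i => hC i.1)
    (lik := regressionLik Y σ z) (a₀ := a₀) (B := fun i => S i / (σ : ℝ) ^ 2)
    (c := ∏ k, gaussianPDFReal (harmonicSum Y a₀ (z k).1) (σ ^ 2) (z k).2)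
    (q := fun h => (∑ k, harmonicSum Y h (z k).1 ^ 2) / (σ : ℝ) ^ 2)
    -- The factor 2 is the loss allowed by the lower bound `hz` on the design.
    (κ := n / (2 * (σ : ℝ) ^ 2))
    (Finset.prod_pos fun k _ => gaussianPDFReal_pos _ _ _ hσ2)
    (by unfold harmonicSum; fun_prop)
    (fun s h => by
      simp only [harmonicSum_smul, mul_pow, ← Finset.mul_sum]
      ring)
    (by positivity)
    (fun h => by
      rw [le_div_iff₀ (by positivity)]
      refine le_trans (le_of_eq ?_) (hz h)
      field_simp)
    (fun h => by
      rw [regressionLik]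
      simp only [gaussianPDF]
      rw [← ENNReal.ofReal_prod_of_nonneg fun i _ => gaussianPDFReal_nonneg _ _ _]
      congr 1
      have he : ∑ i, S i / (σ : ℝ) ^ 2 * h i -
          (∑ k, harmonicSum Y h (z k).1 ^ 2) / (σ : ℝ) ^ 2 / 2 =
          ∑ k, (((z k).2 - harmonicSum Y a₀ (z k).1) * harmonicSum Y h (z k).1 / (σ : ℝ) ^ 2 -
            harmonicSum Y h (z k).1 ^ 2 / (σ : ℝ) ^ 2 / 2) := by
        rw [Finset.sum_sub_distrib, Finset.sum_div, Finset.sum_div]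
        congr 1
        have h1 : ∀ k, ((z k).2 - harmonicSum Y a₀ (z k).1) * harmonicSum Y h (z k).1 /
            (σ : ℝ) ^ 2 = ∑ i, ((z k).2 - harmonicSum Y a₀ (z k).1) *
              truncFamily Y L i (z k).1 / (σ : ℝ) ^ 2 * h i := by
          intro k
          rw [show harmonicSum Y h (z k).1 = ∑ i, h i * truncFamily Y L i (z k).1 from rfl,
            Finset.mul_sum, Finset.sum_div]
          exact Finset.sum_congr rfl fun i _ => by ring
        simp_rw [h1]
        rw [Finset.sum_comm]
        refine Finset.sum_congr rfl fun i _ => ?_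
        simp only [S]
        rw [Finset.sum_div, Finset.sum_mul]
      rw [he, Real.exp_sum, ← Finset.prod_mul_distrib]
      refine Finset.prod_congr rfl fun k _ => ?_
      rw [harmonicSum_add]
      simp only [gaussianPDFReal]
      conv_rhs => rw [mul_assoc, ← Real.exp_add]
      congr 2
      push_cast
      field_simp
      ring) r
  refine h.trans (ENNReal.ofReal_le_ofReal ?_)
  refine mul_le_mul_of_nonneg_left (Real.exp_le_exp.2 ?_) (by positivity)
  refine sub_le_sub_right (div_le_div_of_nonneg_right ?_ (by positivity)) _
  refine (sum_sq_sub_le _ _).trans (le_of_eq ?_)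
  congr 2
  rw [Finset.sum_div]
  exact Finset.sum_congr rfl fun i _ => by rw [div_pow, ← pow_mul]

lemma sequencePosterior_tail_le (hσ : 0 < σ) (hn : 0 < n) {C : ℕ → ℝ≥0} (hC : ∀ ℓ, C ℓ ≠ 0)
    (z : Fin n → SphereD d × ℝ) (a₀ : TruncIndex d L → ℝ) (r : ℝ) :
    sequencePosterior Y σ C L z {a | r < ∑ i, (a i - a₀ i) ^ 2} ≤
      ENNReal.ofReal (2 ^ Fintype.card (TruncIndex d L) * Real.exp (tailExponent σ n
        (∑ i, (∑ k, (z k).2 * truncFamily Y L i (z k).1 - n * a₀ i) ^ 2)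
        (∑ i, (a₀ i / C i.1) ^ 2) r)) := by
  have hσ' : (0 : ℝ) < σ := by exact_mod_cast hσ
  have hn' : (0 : ℝ) < n := by exact_mod_cast hn
  have hσ2 : σ ^ 2 / (n : ℝ≥0) ≠ 0 := by
    have : (n : ℝ≥0) ≠ 0 := by exact_mod_cast hn.ne'
    exact div_ne_zero (pow_ne_zero 2 hσ.ne') this
  let S : TruncIndex d L → ℝ := fun i => ∑ k, (z k).2 * truncFamily Y L i (z k).1 - n * a₀ i
  have h := bayesPosterior_tail_le (v := fun i : TruncIndex d L => C i.1) (fun i => hC i.1)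
    (lik := sequenceLik Y σ z) (a₀ := a₀) (B := fun i => S i / (σ : ℝ) ^ 2)
    (c := ∏ i : TruncIndex d L, gaussianPDFReal (a₀ i) (σ ^ 2 / n) (empCoeff Y z i.1 i.2))
    (q := fun h => n * (∑ i, h i ^ 2) / (σ : ℝ) ^ 2)
    -- Here q equals n|h|²/σ² exactly; the smaller κ makes the exponent the same as in the
    -- regression model.
    (κ := n / (2 * (σ : ℝ) ^ 2))
    (Finset.prod_pos fun k _ => gaussianPDFReal_pos _ _ _ hσ2)
    (by fun_prop)
    (fun s h => by
      simp only [Pi.smul_apply, smul_eq_mul, mul_pow, ← Finset.mul_sum]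
      ring)
    (by positivity)
    (fun h => by
      have h0 : 0 ≤ ∑ i, h i ^ 2 := Finset.sum_nonneg fun _ _ => sq_nonneg _
      rw [le_div_iff₀ (by positivity)]
      have : n / (2 * (σ : ℝ) ^ 2) * (∑ i, h i ^ 2) * (σ : ℝ) ^ 2 = n * (∑ i, h i ^ 2) / 2 := by
        field_simp
      rw [this]
      linarith [mul_nonneg hn'.le h0])
    (fun h => by
      rw [sequenceLik]
      simp only [gaussianPDF]
      rw [← ENNReal.ofReal_prod_of_nonneg fun i _ => gaussianPDFReal_nonneg _ _ _]
      congr 1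
      have he : ∑ i, S i / (σ : ℝ) ^ 2 * h i - n * (∑ i, h i ^ 2) / (σ : ℝ) ^ 2 / 2 =
          ∑ i, (S i / (σ : ℝ) ^ 2 * h i - n * h i ^ 2 / (σ : ℝ) ^ 2 / 2) := by
        rw [Finset.sum_sub_distrib, Finset.mul_sum, Finset.sum_div, Finset.sum_div]
      rw [he, Real.exp_sum, ← Finset.prod_mul_distrib]
      refine Finset.prod_congr rfl fun i _ => ?_
      simp only [gaussianPDFReal, Pi.add_apply]
      conv_rhs => rw [mul_assoc, ← Real.exp_add]
      congr 2
      have hS : S i = n * (empCoeff Y z i.1 i.2 - a₀ i) := by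
        simp only [S, empCoeff, truncFamily]
        field_simp
      rw [hS]
      push_cast
      field_simp
      ring) r
  refine h.trans (ENNReal.ofReal_le_ofReal ?_)
  refine mul_le_mul_of_nonneg_left (Real.exp_le_exp.2 ?_) (by positivity)
  refine sub_le_sub_right (div_le_div_of_nonneg_right ?_ (by positivity)) _
  refine (sum_sq_sub_le _ _).trans (le_of_eq ?_)
  congr 2
  rw [Finset.sum_div]
  exact Finset.sum_congr rfl fun i _ => by rw [div_pow, ← pow_mul]

end PosteriorTails

/-! ### Bounds for a fixed sample size -/

section FixedSample

variable {d : ℕ} {Y : (ℓ : ℕ) → Fin (harmonicMult d ℓ) → SphereD d → ℝ} {σ : ℝ≥0}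
  {f₀ : SphereD d → ℝ} {L n : ℕ}

lemma IsHarmonicBasis.integral_smul_harmonicVec_apply (hY : IsHarmonicBasis d Y)
    (hf : Measurable f₀) {w : SphereD d × ℝ → ℝ} (hw : MemLp w 2 (obsLaw σ f₀))
    (i : TruncIndex d L) :
    (∫ z, w z • harmonicVec Y L z.1 ∂(obsLaw σ f₀)) i =
      ∫ z, w z * truncFamily Y L i z.1 ∂(obsLaw σ f₀) := by
  have := isProbabilityMeasure_obsLaw (σ := σ) hf
  have hi : Integrable (fun z => w z • harmonicVec Y L z.1) (obsLaw σ f₀) :=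
    (memLp_smul_of_bounded ((hY.measurable_harmonicVec L).comp measurable_fst)
      (fun z => hY.norm_harmonicVec_sq_le L z.1) hw).integrable (by norm_num)
  rw [EuclideanSpace.integral_apply hi]
  rfl

/-- On the good event the score is small. -/
lemma IsHarmonicBasis.score_le (hY : IsHarmonicBasis d Y)
    (hf : Measurable f₀) {p r u : SphereD d → ℝ} (hp : Measurable p) {T B₁ B₂ : ℝ}
    (hT : ∀ x, |p x| ≤ T) (hr : Measurable r) (hr2 : MemLp r 2 (unifSphere d))
    (hu : ∀ x, p x + r x = f₀ x - u x) {z : Fin n → SphereD d × ℝ}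
    (h1 : ‖∑ k, (shiftedNoise f₀ p (z k) • harmonicVec Y L (z k).1 -
      ∫ z', shiftedNoise f₀ p z' • harmonicVec Y L z'.1 ∂(obsLaw σ f₀))‖ ^ 2 ≤ B₁)
    (h2 : ‖∑ k, (r (z k).1 • harmonicVec Y L (z k).1 -
      ∫ z', r z'.1 • harmonicVec Y L z'.1 ∂(obsLaw σ f₀))‖ ^ 2 ≤ B₂) :
    ∑ i, (∑ k, ((z k).2 - u (z k).1) * truncFamily Y L i (z k).1 -
      n * ∫ x, (f₀ x - u x) * truncFamily Y L i x ∂(unifSphere d)) ^ 2 ≤ 2 * B₁ + 2 * B₂ := by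
  have := isProbabilityMeasure_obsLaw (σ := σ) hf
  have hmp := measurePreserving_fst_obsLaw (σ := σ) hf
  set V₁ := ∑ k, (shiftedNoise f₀ p (z k) • harmonicVec Y L (z k).1 -
      ∫ z', shiftedNoise f₀ p z' • harmonicVec Y L z'.1 ∂(obsLaw σ f₀)) with hV₁
  set V₂ := ∑ k, (r (z k).1 • harmonicVec Y L (z k).1 -
      ∫ z', r z'.1 • harmonicVec Y L z'.1 ∂(obsLaw σ f₀)) with hV₂
  have hw : MemLp (shiftedNoise f₀ p) 2 (obsLaw σ f₀) :=
    (memLp_shiftedNoise hf hp hT).mono_exponent (by norm_num)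
  have hp2 : MemLp p 2 (unifSphere d) :=
    MemLp.of_bound hp.aestronglyMeasurable T (Eventually.of_forall hT)
  -- The weight splits as y - u = (p + ε) + r. The sum V₁ + V₂ is written as V₁ - (-V₂) to fit
  -- `sum_sq_sub_le`.
  have hcoord : ∀ i, ∑ k, ((z k).2 - u (z k).1) * truncFamily Y L i (z k).1 -
      n * ∫ x, (f₀ x - u x) * truncFamily Y L i x ∂(unifSphere d) = V₁ i - (-V₂) i := by
    intro i
    have hψ := hY.continuous_truncFamily L i
    have hm1 := hY.integral_smul_harmonicVec_apply hf hw i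
    rw [integral_shiftedNoise_mul hf hp hT hψ.measurable (integrable_of_continuous hψ)] at hm1
    have hm2 := hY.integral_smul_harmonicVec_apply hf (hr2.comp_measurePreserving hmp) i
    have hm3 : ∫ z, (r ∘ Prod.fst) z * truncFamily Y L i z.1 ∂(obsLaw σ f₀) =
        ∫ x, r x * truncFamily Y L i x ∂(unifSphere d) := by
      have h := integral_map (μ := obsLaw σ f₀) (f := fun x => r x * truncFamily Y L i x)
        measurable_fst.aemeasurable (hr.mul hψ.measurable).aestronglyMeasurable
      rw [map_fst_obsLaw hf] at h
      exact h.symm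
    rw [hm3] at hm2
    simp only [Function.comp_apply] at hm2
    have hsum : ∫ x, (f₀ x - u x) * truncFamily Y L i x ∂(unifSphere d) =
        ∫ x, p x * truncFamily Y L i x ∂(unifSphere d) +
          ∫ x, r x * truncFamily Y L i x ∂(unifSphere d) := by
      have hψ2 := memLp_of_continuous hψ 2
      have i1 : Integrable (fun x => p x * truncFamily Y L i x) (unifSphere d) :=
        hp2.integrable_mul hψ2
      have i2 : Integrable (fun x => r x * truncFamily Y L i x) (unifSphere d) :=
        hr2.integrable_mul hψ2
      rw [← integral_add i1 i2]
      refine integral_congr_ae (Eventually.of_forall fun x => ?_)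
      simp only [← hu]
      ring
    have hv : ∀ x, (harmonicVec Y L x) i = truncFamily Y L i x := fun x => rfl
    have e1 : V₁ i = ∑ k, shiftedNoise f₀ p (z k) * truncFamily Y L i (z k).1 -
        n * ∫ x, p x * truncFamily Y L i x ∂(unifSphere d) := by
      rw [hV₁]
      simp [hm1, hv, Finset.sum_sub_distrib]
    have e2 : V₂ i = ∑ k, r (z k).1 * truncFamily Y L i (z k).1 -
        n * ∫ x, r x * truncFamily Y L i x ∂(unifSphere d) := by
      rw [hV₂]
      simp [hm2, hv, Finset.sum_sub_distrib]
    have e3 : ∑ k, ((z k).2 - u (z k).1) * truncFamily Y L i (z k).1 =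
        ∑ k, shiftedNoise f₀ p (z k) * truncFamily Y L i (z k).1 +
          ∑ k, r (z k).1 * truncFamily Y L i (z k).1 := by
      rw [← Finset.sum_add_distrib]
      refine Finset.sum_congr rfl fun k _ => ?_
      have := hu (z k).1
      rw [← add_mul]
      congr 1
      simp only [shiftedNoise]
      linarith
    rw [hsum, e3, PiLp.neg_apply, e1, e2]
    ring
  simp_rw [hcoord]
  refine (sum_sq_sub_le (fun i => V₁ i) fun i => (-V₂) i).trans ?_
  have n1 : ∑ i, V₁ i ^ 2 = ‖V₁‖ ^ 2 := by simp [EuclideanSpace.norm_sq_eq]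
  have n2 : ∑ i, (-V₂) i ^ 2 = ‖V₂‖ ^ 2 := by simp [EuclideanSpace.norm_sq_eq]
  rw [n1, n2]
  linarith

lemma eLpNorm_two_eq_sqrt {h : SphereD d → ℝ} (hh : MemLp h 2 (unifSphere d)) :
    eLpNorm h 2 (unifSphere d) = ENNReal.ofReal (√(∫ x, h x ^ 2 ∂(unifSphere d))) := by
  rw [hh.eLpNorm_eq_integral_rpow_norm (by norm_num) (by norm_num), Real.sqrt_eq_rpow]
  simp

/-- Functions far from `f₀` have coefficients far from those of `f₀`. -/
lemma IsHarmonicBasis.farSet_subset (hY : IsHarmonicBasis d Y)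
    (hf2 : MemLp f₀ 2 (unifSphere d)) {a₀ : TruncIndex d L → ℝ} {G M ρ : ℝ} (hρ : 0 ≤ ρ)
    (hM : 0 ≤ M) (hG : ∫ x, (f₀ x - harmonicSum Y a₀ x) ^ 2 ∂(unifSphere d) ≤ G * ρ ^ 2)
    (hGM : 4 * G ≤ M ^ 2) :
    farSet Y L f₀ (M * ρ) ⊆ {a | M ^ 2 * ρ ^ 2 / 4 < ∑ i, (a i - a₀ i) ^ 2} := by
  intro a ha
  have hS := memLp_of_continuous (hY.continuous_harmonicSum a) 2
  have hS₀ := memLp_of_continuous (hY.continuous_harmonicSum a₀) 2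
  have hda := memLp_of_continuous (hY.continuous_harmonicSum (a - a₀)) 2
  have hg : MemLp (fun x => f₀ x - harmonicSum Y a₀ x) 2 (unifSphere d) := hf2.sub hS₀
  have hfar : MemLp (fun x => harmonicSum Y a x - f₀ x) 2 (unifSphere d) := hS.sub hf2
  have h1 : ENNReal.ofReal (M * ρ) <
      eLpNorm (fun x => harmonicSum Y a x - f₀ x) 2 (unifSphere d) := ha
  rw [eLpNorm_two_eq_sqrt hfar] at h1
  have h2 : M * ρ < √(∫ x, (harmonicSum Y a x - f₀ x) ^ 2 ∂(unifSphere d)) :=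
    (ENNReal.ofReal_lt_ofReal_iff_of_nonneg (by positivity)).1 h1
  have h3 : (M * ρ) ^ 2 < ∫ x, (harmonicSum Y a x - f₀ x) ^ 2 ∂(unifSphere d) :=
    (Real.lt_sqrt (by positivity)).1 h2
  have h4 : ∫ x, (harmonicSum Y a x - f₀ x) ^ 2 ∂(unifSphere d) ≤
      ∫ x, (2 * harmonicSum Y (a - a₀) x ^ 2 + 2 * (f₀ x - harmonicSum Y a₀ x) ^ 2)
        ∂(unifSphere d) := by
    refine integral_mono hfar.integrable_sq
      ((hda.integrable_sq.const_mul 2).add (hg.integrable_sq.const_mul 2)) fun x => ?_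
    have : harmonicSum Y a x = harmonicSum Y a₀ x + harmonicSum Y (a - a₀) x := by
      rw [← harmonicSum_add, add_sub_cancel]
    dsimp only
    rw [this]
    nlinarith [sq_nonneg (harmonicSum Y (a - a₀) x + (f₀ x - harmonicSum Y a₀ x))]
  have h5 : ∫ x, harmonicSum Y (a - a₀) x ^ 2 ∂(unifSphere d) = ∑ i, (a i - a₀ i) ^ 2 :=
    integral_sq_sum_ortho (hY.continuous_truncFamily L) (hY.truncFamily_integral_mul L) (a - a₀)
  rw [integral_add (hda.integrable_sq.const_mul 2) (hg.integrable_sq.const_mul 2),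
    integral_const_mul, integral_const_mul, h5] at h4
  -- The truncation error takes at most half of M²ρ², leaving 2|a - a₀|² > M²ρ²/2.
  have h6 : 4 * G * ρ ^ 2 ≤ M ^ 2 * ρ ^ 2 := mul_le_mul_of_nonneg_right hGM (sq_nonneg _)
  change M ^ 2 * ρ ^ 2 / 4 < ∑ i, (a i - a₀ i) ^ 2
  nlinarith

/-- Neither F nor the bad event has to be measurable, so measurability of the posterior mass in the
data is never needed. -/
lemma lintegral_le_add_measure {Ω : Type*} [MeasurableSpace Ω] {P : Measure Ω}
    (hP : P Set.univ ≤ 1) {F : Ω → ℝ≥0∞} (hF : ∀ z, F z ≤ 1) {bad : Set Ω} {e : ℝ≥0∞}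
    (h : ∀ z ∉ bad, F z ≤ e) : ∫⁻ z, F z ∂P ≤ e + P bad := by
  calc ∫⁻ z, F z ∂P ≤ ∫⁻ z, (e + bad.indicator (fun _ => 1) z) ∂P := by
        refine lintegral_mono fun z => ?_
        by_cases hz : z ∈ bad
        · rw [Set.indicator_of_mem hz]
          exact (hF z).trans le_add_self
        · rw [Set.indicator_of_notMem hz, add_zero]
          exact h z hz
    _ = e * P Set.univ + ∫⁻ z, bad.indicator (fun _ => 1) z ∂P := by
        rw [lintegral_add_left measurable_const, lintegral_const]
    _ ≤ e * 1 + 1 * P bad := add_le_add (mul_le_mul_right hP e) (lintegral_indicator_const_le bad 1)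
    _ = e + P bad := by rw [mul_one, one_mul]

/-- Every term of the exponent is a multiple of R = nρ²: at most K from 2^D, 8(KA + 2)/σ² from the
score, 4σ²Kb from the prior, and -M²/(64σ²) from the tail. The condition on M makes the total at
most -1. -/
lemma tail_le_exp_neg (hσ : 0 < σ) (hn : 0 < n) {D : ℕ} {K N A Kb R M ρ score bias : ℝ}
    (hD : (D : ℝ) ≤ K * N) (hNR : N ≤ R) (hK : 0 ≤ K) (hA : 0 ≤ A) (hR : n * ρ ^ 2 = R)
    (hscore : score ≤ 2 * (n * N * (K * A + 1)) + 2 * (n * N)) (hbias : bias ≤ Kb * (n * R))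
    (hR0 : 0 ≤ R)
    (hM : 64 * (σ : ℝ) ^ 2 * (1 + K + 8 * (K * A + 2) / (σ : ℝ) ^ 2 + 4 * (σ : ℝ) ^ 2 * Kb) ≤
      M ^ 2) :
    2 ^ D * Real.exp (tailExponent σ n score bias (M ^ 2 * ρ ^ 2 / 4)) ≤ Real.exp (-R) := by
  have hσ' : (0 : ℝ) < σ := by exact_mod_cast hσ
  have hn' : (0 : ℝ) < n := by exact_mod_cast hn
  have h2 : (2 : ℝ) ^ D ≤ Real.exp (K * R) := by
    have h21 : (2 : ℝ) ≤ Real.exp 1 := by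
      have := Real.add_one_le_exp 1
      linarith
    calc (2 : ℝ) ^ D ≤ Real.exp 1 ^ D := pow_le_pow_left₀ (by norm_num) h21 D
      _ = Real.exp D := by rw [← Real.exp_nat_mul, mul_one]
      _ ≤ Real.exp (K * R) :=
        Real.exp_le_exp.2 (hD.trans (mul_le_mul_of_nonneg_left hNR hK))
  have h3 : tailExponent σ n score bias (M ^ 2 * ρ ^ 2 / 4) ≤
      (2 * ((2 * (n * R * (K * A + 1)) + 2 * (n * R)) / (σ : ℝ) ^ 4) + 2 * (Kb * (n * R))) /
        (n / (2 * (σ : ℝ) ^ 2)) - n / (2 * (σ : ℝ) ^ 2) * (M ^ 2 * ρ ^ 2 / 4) / 8 := by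
    unfold tailExponent
    have hKA : 0 ≤ K * A + 1 := by positivity
    have : score ≤ 2 * (n * R * (K * A + 1)) + 2 * (n * R) := by
      refine hscore.trans ?_
      gcongr
    gcongr
  have h4 : (2 * ((2 * (n * R * (K * A + 1)) + 2 * (n * R)) / (σ : ℝ) ^ 4) + 2 * (Kb * (n * R))) /
        (n / (2 * (σ : ℝ) ^ 2)) - n / (2 * (σ : ℝ) ^ 2) * (M ^ 2 * ρ ^ 2 / 4) / 8 =
      R * (8 * (K * A + 2) / (σ : ℝ) ^ 2 + 4 * (σ : ℝ) ^ 2 * Kb - M ^ 2 / (64 * (σ : ℝ) ^ 2)) := by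
    rw [← hR]
    field_simp
    ring
  rw [h4] at h3
  have h5 : 1 + K + 8 * (K * A + 2) / (σ : ℝ) ^ 2 + 4 * (σ : ℝ) ^ 2 * Kb ≤
      M ^ 2 / (64 * (σ : ℝ) ^ 2) := by
    rw [le_div_iff₀ (by positivity)]
    linarith
  calc 2 ^ D * Real.exp (tailExponent σ n score bias (M ^ 2 * ρ ^ 2 / 4))
      ≤ Real.exp (K * R) * Real.exp (R * (8 * (K * A + 2) / (σ : ℝ) ^ 2 +
          4 * (σ : ℝ) ^ 2 * Kb - M ^ 2 / (64 * (σ : ℝ) ^ 2))) :=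
        mul_le_mul h2 (Real.exp_le_exp.2 h3) (Real.exp_pos _).le (Real.exp_pos _).le
    _ ≤ Real.exp (-R) := by
        rw [← Real.exp_add]
        refine Real.exp_le_exp.2 ?_
        nlinarith [mul_le_mul_of_nonneg_left h5 hR0]

lemma dataLaw_univ_le_one (hf : Measurable f₀) : dataLaw σ f₀ n Set.univ ≤ 1 := by
  have := isProbabilityMeasure_obsLaw (σ := σ) hf
  have : IsProbabilityMeasure (dataLaw σ f₀ n) := by
    unfold dataLaw
    infer_instance
  exact prob_le_one

/-- Bias of the prior: the size of the prior score at the truncated truth. -/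
def priorBias (Y : (ℓ : ℕ) → Fin (harmonicMult d ℓ) → SphereD d → ℝ) (C : ℕ → ℝ≥0)
    (f₀ : SphereD d → ℝ) (L : ℕ) : ℝ :=
  ∑ i : TruncIndex d L, (truncCoeff Y L f₀ i / C i.1) ^ 2

/-- Expected posterior mass of the far set, regression likelihood. -/
lemma IsHarmonicBasis.lintegral_regressionPosterior_le (hY : IsHarmonicBasis d Y) (hσ : 0 < σ)
    (hn : 0 < n) {C : ℕ → ℝ≥0} (hC : ∀ ℓ, C ℓ ≠ 0) (hf : Measurable f₀)
    (hf2 : MemLp f₀ 2 (unifSphere d)) {K N A Kb R M ρ G : ℝ}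
    (hK : 0 ≤ K) (hN : 0 < N) (hD : (Fintype.card (TruncIndex d L) : ℝ) ≤ K * N) (hNR : N ≤ R)
    (hA : (σ : ℝ) ^ 2 ≤ A) (hρ : 0 ≤ ρ) (hR : n * ρ ^ 2 = R)
    (hbias : priorBias Y C f₀ L ≤ Kb * (n * R))
    (hG : ∫ x, (f₀ x - harmonicSum Y (truncCoeff Y L f₀) x) ^ 2 ∂(unifSphere d) ≤ G * ρ ^ 2)
    (hM0 : 0 ≤ M) (hGM : 4 * G ≤ M ^ 2)
    (hM : 64 * (σ : ℝ) ^ 2 * (1 + K + 8 * (K * A + 2) / (σ : ℝ) ^ 2 + 4 * (σ : ℝ) ^ 2 * Kb) ≤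
      M ^ 2) :
    ∫⁻ z, regressionPosterior Y σ C L z (farSet Y L f₀ (M * ρ)) ∂(dataLaw σ f₀ n) ≤
      ENNReal.ofReal (Real.exp (-R)) + (ENNReal.ofReal (4 * (K * N) ^ 2 / n) +
        (ENNReal.ofReal (8 * (σ : ℝ) ^ 2 * K * A / N + 16 * K ^ 2 *
          (∫ z, shiftedNoise f₀ (fun _ => 0) z ^ 4 ∂(obsLaw σ f₀) + A ^ 2) / n) +
          ENNReal.ofReal (K * (G * ρ ^ 2)))) := by
  set a₀ := truncCoeff Y L f₀
  let g : SphereD d → ℝ := fun x => f₀ x - harmonicSum Y a₀ x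
  have hgm : Measurable g := hf.sub (hY.continuous_harmonicSum a₀).measurable
  have hg2 : MemLp g 2 (unifSphere d) :=
    hf2.sub (memLp_of_continuous (hY.continuous_harmonicSum a₀) 2)
  have hA0 : 0 ≤ A := (sq_nonneg _).trans hA
  -- With p = 0 the bounded part is pure noise and the remainder is the truncation error, whose L²
  -- norm is itself of order ρ.
  have hE1 := hY.measure_score_bounded_le (σ := σ) (n := n) (p := fun _ => 0) (T := 0) (A := A) hf
    measurable_const (by simp) (by simpa using hA) hn hN hD
  have hE2 := hY.measure_score_remainder_le (σ := σ) (n := n) hf hgm hg2 hn hN hD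
  have hE3 := hY.measure_gramDeviation_le (σ := σ) (n := n) hf hn hD
  rw [zero_pow two_ne_zero, zero_add] at hE1
  refine (lintegral_le_add_measure (dataLaw_univ_le_one hf)
    (fun z => bayesPosterior_le_one _ _ _) (fun z hz => ?_)).trans
      (add_le_add_right ((measure_union_le _ _).trans (add_le_add hE3
        ((measure_union_le _ _).trans (add_le_add hE1 (hE2.trans (ENNReal.ofReal_le_ofReal
          (mul_le_mul_of_nonneg_left hG hK))))))) _)
  simp only [Set.mem_union, Set.mem_ofPred_eq, not_or, not_lt] at hz
  obtain ⟨hz3, hz1, hz2⟩ := hz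
  refine (measure_mono (hY.farSet_subset hf2 hρ hM0 hG hGM)).trans
    ((regressionPosterior_tail_le hσ hn hC (hY.half_norm_sq_le_design hf hz3) a₀ _).trans
      (ENNReal.ofReal_le_ofReal (tail_le_exp_neg hσ hn hD hNR hK hA0 hR ?_ hbias
        (hN.le.trans hNR) hM)))
  have hs := hY.score_le hf (p := fun _ => 0) (T := 0) (u := harmonicSum Y a₀) measurable_const
    (by simp) hgm hg2 (fun x => by simp [g]) hz1 hz2
  -- The truncation error is orthogonal to the low-degree harmonics, so the score is already
  -- centred.
  have hzero : ∀ i : TruncIndex d L,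
      ∫ x, (f₀ x - harmonicSum Y a₀ x) * truncFamily Y L i x ∂(unifSphere d) = 0 := by
    intro i
    have := hY.harmonicCoeff_sub_harmonicSum hf2 L i.1 i.2
    rw [if_pos (Nat.lt_succ_iff.1 i.1.2)] at this
    exact this
  simpa only [hzero, mul_zero, sub_zero] using hs

/-- Expected posterior mass of the far set, likelihood in harmonic coordinates. -/
lemma IsHarmonicBasis.lintegral_sequencePosterior_le (hY : IsHarmonicBasis d Y) (hσ : 0 < σ)
    (hn : 0 < n) {C : ℕ → ℝ≥0} (hC : ∀ ℓ, C ℓ ≠ 0) (hf : Measurable f₀)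
    (hf2 : MemLp f₀ 2 (unifSphere d)) {p : SphereD d → ℝ} (hp : Measurable p)
    {T K N A Kb R M ρ G : ℝ} (hT : ∀ x, |p x| ≤ T)
    (hK : 0 ≤ K) (hN : 0 < N) (hD : (Fintype.card (TruncIndex d L) : ℝ) ≤ K * N) (hNR : N ≤ R)
    (hA : ∫ x, p x ^ 2 ∂(unifSphere d) + (σ : ℝ) ^ 2 ≤ A) (hρ : 0 ≤ ρ) (hR : n * ρ ^ 2 = R)
    (hbias : priorBias Y C f₀ L ≤ Kb * (n * R))
    (hG : ∫ x, (f₀ x - harmonicSum Y (truncCoeff Y L f₀) x) ^ 2 ∂(unifSphere d) ≤ G * ρ ^ 2)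
    (hM0 : 0 ≤ M) (hGM : 4 * G ≤ M ^ 2)
    (hM : 64 * (σ : ℝ) ^ 2 * (1 + K + 8 * (K * A + 2) / (σ : ℝ) ^ 2 + 4 * (σ : ℝ) ^ 2 * Kb) ≤
      M ^ 2) :
    ∫⁻ z, sequencePosterior Y σ C L z (farSet Y L f₀ (M * ρ)) ∂(dataLaw σ f₀ n) ≤
      ENNReal.ofReal (Real.exp (-R)) +
        (ENNReal.ofReal (8 * (T ^ 2 + (σ : ℝ) ^ 2) * K * A / N + 16 * K ^ 2 *
          (∫ z, shiftedNoise f₀ p z ^ 4 ∂(obsLaw σ f₀) + A ^ 2) / n) +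
          ENNReal.ofReal (K * ∫ x, (f₀ x - p x) ^ 2 ∂(unifSphere d))) := by
  set a₀ := truncCoeff Y L f₀
  let r : SphereD d → ℝ := fun x => f₀ x - p x
  have hrm : Measurable r := hf.sub hp
  have hr2 : MemLp r 2 (unifSphere d) :=
    hf2.sub (MemLp.of_bound hp.aestronglyMeasurable T (Eventually.of_forall hT))
  have hA0 : 0 ≤ A := le_trans (add_nonneg (integral_nonneg fun _ => sq_nonneg _) (sq_nonneg _)) hA
  have hE1 := hY.measure_score_bounded_le (σ := σ) (n := n) hf hp hT hA hn hN hD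
  have hE2 := hY.measure_score_remainder_le (σ := σ) (n := n) hf hrm hr2 hn hN hD
  refine (lintegral_le_add_measure (dataLaw_univ_le_one hf)
    (fun z => bayesPosterior_le_one _ _ _) (fun z hz => ?_)).trans
      (add_le_add_right ((measure_union_le _ _).trans (add_le_add hE1 hE2)) _)
  simp only [Set.mem_union, Set.mem_ofPred_eq, not_or, not_lt] at hz
  obtain ⟨hz1, hz2⟩ := hz
  refine (measure_mono (hY.farSet_subset hf2 hρ hM0 hG hGM)).trans
    ((sequencePosterior_tail_le hσ hn hC z a₀ _).trans
      (ENNReal.ofReal_le_ofReal (tail_le_exp_neg hσ hn hD hNR hK hA0 hR ?_ hbias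
        (hN.le.trans hNR) hM)))
  have hs := hY.score_le hf hp hT (u := fun _ => 0) hrm hr2 (fun x => by simp [r]) hz1 hz2
  -- The empirical coefficients are unbiased for `a₀`, which centres the score.
  have hco : ∀ i, ∫ x, f₀ x * truncFamily Y L i x ∂(unifSphere d) = a₀ i := fun _ => rfl
  simpa only [sub_zero, hco] using hs

end FixedSample

/-! ### Rates -/

section Rates

variable {d : ℕ} {Y : (ℓ : ℕ) → Fin (harmonicMult d ℓ) → SphereD d → ℝ} {σ : ℝ≥0}

lemma sq_le_one_add_lbEigenvalue (hd : 1 ≤ d) (ℓ : ℕ) : (ℓ : ℝ) ^ 2 ≤ 1 + lbEigenvalue d ℓ := by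
  have h1 : (1 : ℝ) ≤ d := by exact_mod_cast hd
  have h0 : (0 : ℝ) ≤ ℓ := ℓ.cast_nonneg
  unfold lbEigenvalue
  nlinarith

lemma one_add_lbEigenvalue_le (d ℓ : ℕ) :
    1 + lbEigenvalue d ℓ ≤ (d + 1) * ((ℓ : ℝ) + 1) ^ 2 := by
  have h1 : (0 : ℝ) ≤ d := d.cast_nonneg
  have h0 : (0 : ℝ) ≤ ℓ := ℓ.cast_nonneg
  unfold lbEigenvalue
  nlinarith [mul_nonneg h1 h0, mul_nonneg h1 (mul_nonneg h0 h0)]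

/-- The lower bound on C_ℓ turns 1/C_ℓ² into the weight (1 + λ_ℓ)^(2α); the excess 2α - β over the
Sobolev weight is paid at the top degree L. -/
lemma priorBias_le (hd : 1 ≤ d) {α β c₁ : ℝ} (hα : 0 ≤ α) (hβα : β ≤ α) {C : ℕ → ℝ≥0}
    (hc : 0 < c₁) (hC : ∀ ℓ, c₁ * (1 + lbEigenvalue d ℓ) ^ (-α) ≤ (C ℓ : ℝ))
    {f : SphereD d → ℝ} (hf : MemSobolevSphere Y β f) (L : ℕ) :
    priorBias Y C f L ≤ (c₁ ^ 2)⁻¹ * ((1 + lbEigenvalue d L) ^ (2 * α - β) * ∑' ℓ : ℕ,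
        (1 + lbEigenvalue d ℓ) ^ β * ∑ m : Fin (harmonicMult d ℓ), harmonicCoeff Y f ℓ m ^ 2) := by
  refine le_trans ?_ (mul_le_mul_of_nonneg_left
    (sum_weight_truncCoeff_le hd (γ := 2 * α)
      (hβα.trans (le_mul_of_one_le_left hα one_le_two)) hf L) (by positivity))
  rw [Finset.mul_sum]
  refine Finset.sum_le_sum fun i _ => ?_
  have hpos : 0 < 1 + lbEigenvalue d i.1 := by
    have := lbEigenvalue_nonneg hd i.1
    linarith
  have hlow : 0 < c₁ * (1 + lbEigenvalue d i.1) ^ (-α) := mul_pos hc (Real.rpow_pos_of_pos hpos _)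
  have hsq : (1 + lbEigenvalue d i.1) ^ (2 * α) = (((1 + lbEigenvalue d i.1) ^ (-α)) ^ 2)⁻¹ := by
    rw [← Real.rpow_natCast, ← Real.rpow_mul hpos.le, ← Real.rpow_neg hpos.le]
    congr 1
    push_cast
    ring
  calc (truncCoeff Y L f i / C i.1) ^ 2 = truncCoeff Y L f i ^ 2 / (C i.1 : ℝ) ^ 2 := div_pow _ _ _
    _ ≤ truncCoeff Y L f i ^ 2 / (c₁ * (1 + lbEigenvalue d i.1) ^ (-α)) ^ 2 := by
        gcongr
        exact hC i.1
    _ = _ := by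
        rw [hsq, mul_pow, div_eq_mul_inv, mul_inv]
        ring

/-- The dimension, the truncation error and the prior bias have the orders needed for
contraction at rate `n ^ (-β / (2 * α + d))`. -/
lemma IsHarmonicBasis.exists_rate_constants (hY : IsHarmonicBasis d Y) (hd : 1 ≤ d)
    {α β c₁ : ℝ} (hα : (d : ℝ) / 2 < α) (hβ : 0 < β) (hβα : β ≤ α) {C : ℕ → ℝ≥0}
    (hc : 0 < c₁) (hC : ∀ ℓ, c₁ * (1 + lbEigenvalue d ℓ) ^ (-α) ≤ (C ℓ : ℝ))
    {f : SphereD d → ℝ} (hf : MemSobolevSphere Y β f) {L : ℕ → ℕ}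
    (hL : (fun n : ℕ => (L n : ℝ)) =Θ[atTop] fun n : ℕ => (n : ℝ) ^ (1 / (2 * α + d))) :
    ∃ K G Kb : ℝ, 0 ≤ K ∧ ∀ᶠ n : ℕ in atTop, 0 < n ∧
      (Fintype.card (TruncIndex d (L n)) : ℝ) ≤ K * (n : ℝ) ^ (d / (2 * α + d)) ∧
      (n : ℝ) ^ (d / (2 * α + d)) ≤ n * ((n : ℝ) ^ (-β / (2 * α + d))) ^ 2 ∧
      priorBias Y C f (L n) ≤ Kb * (n * (n * ((n : ℝ) ^ (-β / (2 * α + d))) ^ 2)) ∧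
      ∫ x, (f x - harmonicSum Y (truncCoeff Y (L n) f) x) ^ 2 ∂(unifSphere d) ≤
        G * ((n : ℝ) ^ (-β / (2 * α + d))) ^ 2 := by
  have hd1 : (1 : ℝ) ≤ d := by exact_mod_cast hd
  set s : ℝ := 2 * α + d with hs
  have hs0 : 0 < s := by linarith
  set S : ℝ := ∑' ℓ : ℕ, (1 + lbEigenvalue d ℓ) ^ β *
    ∑ m : Fin (harmonicMult d ℓ), harmonicCoeff Y f ℓ m ^ 2 with hS
  have hpos : ∀ ℓ, 0 < 1 + lbEigenvalue d ℓ := fun ℓ => by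
    have := lbEigenvalue_nonneg hd ℓ
    linarith
  have hS0 : 0 ≤ S := tsum_nonneg fun ℓ =>
    mul_nonneg (Real.rpow_pos_of_pos (hpos ℓ) _).le (Finset.sum_nonneg fun _ _ => sq_nonneg _)
  obtain ⟨k₂, hk₂, hup⟩ := hL.1.exists_pos
  obtain ⟨k, hk, hlo⟩ := hL.2.exists_pos
  -- With t = n^(1/(2α+d)) ≥ 1, one has t/k ≤ L and L + 1 ≤ (k₂ + 1)t. The lower bound controls the
  -- truncation error, the upper one the dimension and the prior bias.
  refine ⟨2 * (k₂ + 1) ^ d, (k⁻¹ ^ 2) ^ (-β) * S,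
    (c₁ ^ 2)⁻¹ * (((d + 1) * (k₂ + 1) ^ 2) ^ (2 * α - β) * S), by positivity, ?_⟩
  filter_upwards [hup.bound, hlo.bound, eventually_ge_atTop 1] with n h1 h2 hn
  have hn1 : (1 : ℝ) ≤ n := by exact_mod_cast hn
  have hn0 : (0 : ℝ) < n := by linarith
  set t : ℝ := (n : ℝ) ^ (1 / s) with ht
  have ht1 : 1 ≤ t := Real.one_le_rpow hn1 (by positivity)
  have ht0 : 0 < t := by linarith
  have hpow : ∀ u : ℝ, (n : ℝ) ^ (u / s) = t ^ u := fun u => by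
    rw [ht, ← Real.rpow_mul hn0.le]
    congr 1
    ring
  have hnt : (n : ℝ) = t ^ s := by rw [← hpow, div_self hs0.ne', Real.rpow_one]
  rw [Real.norm_of_nonneg (Nat.cast_nonneg _), Real.norm_of_nonneg ht0.le] at h1 h2
  have hρ2 : ((n : ℝ) ^ (-β / s)) ^ 2 = t ^ (-(2 * β)) := by
    rw [hpow, ← Real.rpow_natCast, ← Real.rpow_mul ht0.le]
    congr 1
    push_cast
    ring
  have hsq : ∀ u : ℝ, (t ^ 2) ^ u = t ^ (2 * u) := fun u => by
    rw [← Real.rpow_natCast, ← Real.rpow_mul ht0.le]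
    norm_num
  have hL1 : (L n : ℝ) + 1 ≤ (k₂ + 1) * t := by linarith
  have hLlo : k⁻¹ * t ≤ L n := by
    rw [inv_mul_le_iff₀ hk]
    exact h2
  refine ⟨hn, ?_, ?_, ?_, ?_⟩
  · have hcard : (Fintype.card (TruncIndex d (L n)) : ℝ) ≤ 2 * ((L n : ℝ) + 1) ^ d := by
      exact_mod_cast hY.card_truncIndex_le (L n)
    rw [hpow, Real.rpow_natCast, mul_assoc, ← mul_pow]
    refine hcard.trans ?_
    gcongr
  · rw [hρ2, hpow]
    nth_rewrite 1 [hnt]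
    rw [← Real.rpow_add ht0]
    -- In powers of t this is d ≤ 2α + d - 2β, that is β ≤ α.
    exact Real.rpow_le_rpow_of_exponent_le ht1 (by linarith)
  · refine (priorBias_le hd (by linarith) hβα hc hC hf (L n)).trans ?_
    rw [mul_assoc (c₁ ^ 2)⁻¹, mul_right_comm _ S]
    refine mul_le_mul_of_nonneg_left (mul_le_mul_of_nonneg_right ?_ hS0) (by positivity)
    calc (1 + lbEigenvalue d (L n)) ^ (2 * α - β)
        ≤ ((d + 1) * (k₂ + 1) ^ 2 * t ^ 2) ^ (2 * α - β) := by
          refine Real.rpow_le_rpow (hpos _).le ((one_add_lbEigenvalue_le d (L n)).trans ?_)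
            (by linarith)
          rw [mul_assoc, ← mul_pow]
          gcongr
      _ = ((d + 1) * (k₂ + 1) ^ 2) ^ (2 * α - β) * t ^ (2 * (2 * α - β)) := by
          rw [Real.mul_rpow (by positivity) (by positivity), hsq]
      _ ≤ _ := by
          rw [hρ2]
          nth_rewrite 1 2 [hnt]
          rw [← Real.rpow_add ht0, ← Real.rpow_add ht0]
          refine mul_le_mul_of_nonneg_left ?_ (by positivity)
          -- The exponents compare as 4α - 2β ≤ 2(2α + d) - 2β.
          exact Real.rpow_le_rpow_of_exponent_le ht1 (by linarith)
  · refine (hY.integral_sq_sub_harmonicSum_le hd hβ hf (L n)).trans ?_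
    rw [hρ2, mul_right_comm]
    refine mul_le_mul_of_nonneg_right ?_ hS0
    calc (1 + lbEigenvalue d (L n)) ^ (-β) ≤ (k⁻¹ ^ 2 * t ^ 2) ^ (-β) := by
          refine Real.rpow_le_rpow_of_nonpos (by positivity) ?_ (by linarith)
          rw [← mul_pow]
          exact (pow_le_pow_left₀ (by positivity) hLlo 2).trans (sq_le_one_add_lbEigenvalue hd _)
      _ = (k⁻¹ ^ 2) ^ (-β) * t ^ (-(2 * β)) := by
          rw [Real.mul_rpow (by positivity) (by positivity), hsq, mul_neg]

/-- Square-integrable functions are approximated by bounded ones of no larger norm. -/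
lemma exists_bounded_approx {f : SphereD d → ℝ} (hf : Measurable f)
    (hf2 : MemLp f 2 (unifSphere d)) {ε : ℝ} (hε : 0 < ε) :
    ∃ (p : SphereD d → ℝ) (T : ℝ), Measurable p ∧ (∀ x, |p x| ≤ T) ∧
      ∫ x, p x ^ 2 ∂(unifSphere d) ≤ ∫ x, f x ^ 2 ∂(unifSphere d) ∧
      ∫ x, (f x - p x) ^ 2 ∂(unifSphere d) ≤ ε := by
  -- Setting f to zero where |f| > T gives both p² ≤ f² and (f - p)² ≤ f², the latter being the
  -- dominating bound.
  let p : ℕ → SphereD d → ℝ := fun T => {x | |f x| ≤ T}.indicator f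
  have hms : ∀ T : ℕ, MeasurableSet {x | |f x| ≤ (T : ℝ)} := fun T =>
    measurableSet_le hf.abs measurable_const
  have hpm : ∀ T, Measurable (p T) := fun T => hf.indicator (hms T)
  have hpT : ∀ (T : ℕ) x, |p T x| ≤ T := fun T x => by
    by_cases h : |f x| ≤ (T : ℝ)
    · simpa only [p, Set.indicator_of_mem (show x ∈ {x | |f x| ≤ (T : ℝ)} from h)] using h
    · simp [p, h]
  have hpf : ∀ T x, p T x ^ 2 ≤ f x ^ 2 := fun T x => by
    by_cases h : |f x| ≤ (T : ℝ)
    · simp [p, h]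
    · simp [p, h, sq_nonneg]
  have hlim : Tendsto (fun T : ℕ => ∫ x, (f x - p T x) ^ 2 ∂(unifSphere d)) atTop (nhds 0) := by
    have := tendsto_integral_of_dominated_convergence (μ := unifSphere d)
      (F := fun (T : ℕ) x => (f x - p T x) ^ 2) (f := fun _ => 0) (fun x => f x ^ 2)
      (fun T => ((hf.sub (hpm T)).pow_const 2).aestronglyMeasurable) hf2.integrable_sq
      (fun T => Eventually.of_forall fun x => ?_) (Eventually.of_forall fun x => ?_)
    · simpa using this
    · rw [Real.norm_of_nonneg (sq_nonneg _)]
      by_cases h : |f x| ≤ (T : ℝ)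
      · simp [p, h, sq_nonneg]
      · simp [p, h]
    · refine tendsto_const_nhds.congr' ?_
      obtain ⟨T₀, hT₀⟩ := exists_nat_ge |f x|
      filter_upwards [eventually_ge_atTop T₀] with T hT
      have : |f x| ≤ (T : ℝ) := hT₀.trans (by exact_mod_cast hT)
      simp [p, this]
  obtain ⟨T, hT⟩ := (hlim.eventually (ge_mem_nhds hε)).exists
  refine ⟨p T, T, hpm T, hpT T, ?_, hT⟩
  exact integral_mono ((MemLp.of_bound (hpm T).aestronglyMeasurable T
    (Eventually.of_forall (hpT T))).integrable_sq) hf2.integrable_sq (hpf T)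

lemma tendsto_natCast_rpow_div_atTop {u s : ℝ} (h : 0 < u / s) :
    Tendsto (fun n : ℕ => (n : ℝ) ^ (u / s)) atTop atTop :=
  (tendsto_rpow_atTop h).comp tendsto_natCast_atTop_atTop

/-- This is the probability bound for the Gram event; with e = d/(2α+d) the condition on e is α >
d/2. -/
lemma tendsto_ratio_rpow {e : ℝ} (he : 2 * e < 1) (K : ℝ) :
    Tendsto (fun n : ℕ => 4 * (K * (n : ℝ) ^ e) ^ 2 / n) atTop (nhds 0) := by
  have h := ((tendsto_rpow_neg_atTop (y := 1 - 2 * e) (by linarith)).comp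
    (tendsto_natCast_atTop_atTop (R := ℝ))).const_mul (4 * K ^ 2)
  rw [mul_zero] at h
  refine h.congr' ?_
  filter_upwards [eventually_gt_atTop 0] with n hn
  have hn0 : (0 : ℝ) < n := by exact_mod_cast hn
  have : (n : ℝ) ^ (-(1 - 2 * e)) = ((n : ℝ) ^ e) ^ 2 / n := by
    rw [← Real.rpow_natCast, ← Real.rpow_mul hn0.le, ← Real.rpow_sub_one hn0.ne']
    congr 1
    push_cast
    ring
  rw [Function.comp_apply, this]
  ring

lemma tendsto_variance_terms {N : ℕ → ℝ} (hN : Tendsto N atTop atTop) (a b : ℝ) :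
    Tendsto (fun n : ℕ => a / N n + b / n) atTop (nhds 0) := by
  have h1 : Tendsto (fun n : ℕ => a / N n) atTop (nhds 0) := hN.const_div_atTop a
  have h2 : Tendsto (fun n : ℕ => b / (n : ℝ)) atTop (nhds 0) :=
    tendsto_natCast_atTop_atTop.const_div_atTop b
  simpa using h1.add h2

/-- Posterior contraction for a measurable regression function. -/
lemma IsHarmonicBasis.posterior_contraction (hY : IsHarmonicBasis d Y) (hd : 1 ≤ d)
    (hσ : 0 < σ) {α β c₁ : ℝ} (hα : (d : ℝ) / 2 < α) (hβ : 0 < β) (hβα : β ≤ α) {C : ℕ → ℝ≥0}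
    (hc : 0 < c₁) (hC : ∀ ℓ, c₁ * (1 + lbEigenvalue d ℓ) ^ (-α) ≤ (C ℓ : ℝ))
    {f₀ : SphereD d → ℝ} (hf : Measurable f₀) (hf₀ : MemSobolevSphere Y β f₀) {L : ℕ → ℕ}
    (hL : (fun n : ℕ => (L n : ℝ)) =Θ[atTop] fun n : ℕ => (n : ℝ) ^ (1 / (2 * α + d))) :
    ∃ M₀ : ℝ, 0 < M₀ ∧ ∀ M : ℝ, M₀ ≤ M →
      Tendsto (fun n : ℕ => ∫⁻ z, regressionPosterior Y σ C (L n) z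
          (farSet Y (L n) f₀ (M * (n : ℝ) ^ (-β / (2 * α + d)))) ∂(dataLaw σ f₀ n))
        atTop (nhds 0) ∧
      Tendsto (fun n : ℕ => ∫⁻ z, sequencePosterior Y σ C (L n) z
          (farSet Y (L n) f₀ (M * (n : ℝ) ^ (-β / (2 * α + d)))) ∂(dataLaw σ f₀ n))
        atTop (nhds 0) := by
  have hd1 : (1 : ℝ) ≤ d := by exact_mod_cast hd
  have hs0 : 0 < 2 * α + d := by linarith
  have hC0 : ∀ ℓ, C ℓ ≠ 0 := fun ℓ h => by
    have hpos : 0 < 1 + lbEigenvalue d ℓ := by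
      have := lbEigenvalue_nonneg hd ℓ
      linarith
    have := (mul_pos hc (Real.rpow_pos_of_pos hpos (-α))).trans_le (hC ℓ)
    simp [h] at this
  obtain ⟨K, G, Kb, hK, hev⟩ := hY.exists_rate_constants hd hα hβ hβα hc hC hf₀ hL
  -- This A dominates the second moment of the weight for every cut-off p of f₀, so the threshold on
  -- M is fixed before p is chosen.
  set A : ℝ := ∫ x, f₀ x ^ 2 ∂(unifSphere d) + (σ : ℝ) ^ 2 with hA
  have hAσ : (σ : ℝ) ^ 2 ≤ A := le_add_of_nonneg_left (integral_nonneg fun _ => sq_nonneg _)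
  set B : ℝ := 64 * (σ : ℝ) ^ 2 *
    (1 + K + 8 * (K * A + 2) / (σ : ℝ) ^ 2 + 4 * (σ : ℝ) ^ 2 * Kb) with hB
  have hN : Tendsto (fun n : ℕ => (n : ℝ) ^ (d / (2 * α + d))) atTop atTop :=
    tendsto_natCast_rpow_div_atTop (by positivity)
  have hR : Tendsto (fun n : ℕ => (n : ℝ) * ((n : ℝ) ^ (-β / (2 * α + d))) ^ 2) atTop atTop :=
    tendsto_atTop_mono' _ (hev.mono fun n h => h.2.2.1) hN
  have hexp := Real.tendsto_exp_neg_atTop_nhds_zero.comp hR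
  have hρ : Tendsto (fun n : ℕ => (n : ℝ) ^ (-β / (2 * α + d))) atTop (nhds 0) := by
    simpa only [neg_div, Function.comp_def] using (tendsto_rpow_neg_atTop
      (div_pos hβ hs0)).comp (tendsto_natCast_atTop_atTop (R := ℝ))
  -- The summand 1 gives M ≤ M², so lower bounds on M pass to M².
  refine ⟨1 + |4 * G| + |B|, by positivity, fun M hM => ?_⟩
  have hM1 : 1 ≤ M := by linarith [abs_nonneg (4 * G), abs_nonneg B]
  have hMsq : M ≤ M ^ 2 := by nlinarith
  have hMG : 4 * G ≤ M ^ 2 := by linarith [le_abs_self (4 * G), abs_nonneg B]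
  have hMB : B ≤ M ^ 2 := by linarith [le_abs_self B, abs_nonneg (4 * G)]
  have hM0 : 0 ≤ M := by linarith
  constructor
  · have hlim : Tendsto (fun n : ℕ =>
        ENNReal.ofReal (Real.exp (-(n * ((n : ℝ) ^ (-β / (2 * α + d))) ^ 2))) +
        (ENNReal.ofReal (4 * (K * (n : ℝ) ^ (d / (2 * α + d))) ^ 2 / n) +
        (ENNReal.ofReal (8 * (σ : ℝ) ^ 2 * K * A / (n : ℝ) ^ (d / (2 * α + d)) + 16 * K ^ 2 *
          (∫ z, shiftedNoise f₀ (fun _ => 0) z ^ 4 ∂(obsLaw σ f₀) + A ^ 2) / n) +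
          ENNReal.ofReal (K * (G * ((n : ℝ) ^ (-β / (2 * α + d))) ^ 2))))) atTop (nhds 0) := by
      have h1 := ENNReal.tendsto_ofReal hexp
      have h2 := ENNReal.tendsto_ofReal (tendsto_ratio_rpow (e := d / (2 * α + d)) (by
        rw [← mul_div_assoc, div_lt_one hs0]
        linarith) K)
      have h3 := ENNReal.tendsto_ofReal (tendsto_variance_terms hN (8 * (σ : ℝ) ^ 2 * K * A)
        (16 * K ^ 2 * (∫ z, shiftedNoise f₀ (fun _ => 0) z ^ 4 ∂(obsLaw σ f₀) + A ^ 2)))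
      have h4 := ENNReal.tendsto_ofReal (((hρ.pow 2).const_mul G).const_mul K)
      simpa using h1.add (h2.add (h3.add h4))
    refine tendsto_of_tendsto_of_tendsto_of_le_of_le' tendsto_const_nhds hlim
      (Eventually.of_forall fun _ => zero_le) ?_
    filter_upwards [hev] with n ⟨hn, hD, hNR, hbias, hG⟩
    have hn0 : (0 : ℝ) < n := by exact_mod_cast hn
    exact hY.lintegral_regressionPosterior_le hσ hn hC0 hf hf₀.1 hK
      (Real.rpow_pos_of_pos hn0 _) hD hNR hAσ (Real.rpow_pos_of_pos hn0 _).le rfl hbias hG hM0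
      hMG hMB
  · rw [ENNReal.tendsto_nhds_zero]
    intro ε hε
    obtain ⟨δ, hδ0, hδ⟩ := ENNReal.lt_iff_exists_nnreal_btwn.1 hε
    have hδ0 : (0 : ℝ) < δ := by exact_mod_cast hδ0
    -- The Markov term K‖f₀ - p‖² does not decay in n, so p is chosen from ε; T and the fourth
    -- moment of p + ε are then constants, and the variance terms tend to 0. K + 1 avoids dividing
    -- by zero.
    obtain ⟨p, T, hp, hT, hpA, hpε⟩ := exists_bounded_approx hf hf₀.1
      (ε := δ / (3 * (K + 1))) (by positivity)
    have hvar := tendsto_variance_terms hN (8 * (T ^ 2 + (σ : ℝ) ^ 2) * K * A)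
      (16 * K ^ 2 * (∫ z, shiftedNoise f₀ p z ^ 4 ∂(obsLaw σ f₀) + A ^ 2))
    have hδ3 : (0 : ℝ) < δ / 3 := by positivity
    filter_upwards [hev, hvar.eventually (ge_mem_nhds hδ3), hexp.eventually (ge_mem_nhds hδ3)]
      with n ⟨hn, hD, hNR, hbias, hG⟩ hv he
    have hn0 : (0 : ℝ) < n := by exact_mod_cast hn
    have hr : K * ∫ x, (f₀ x - p x) ^ 2 ∂(unifSphere d) ≤ δ / 3 := by
      calc K * ∫ x, (f₀ x - p x) ^ 2 ∂(unifSphere d) ≤ (K + 1) * (δ / (3 * (K + 1))) :=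
            mul_le_mul (by linarith) hpε (integral_nonneg fun _ => sq_nonneg _) (by positivity)
        _ = δ / 3 := by field_simp
    refine (hY.lintegral_sequencePosterior_le hσ hn hC0 hf hf₀.1 hp hT hK
      (Real.rpow_pos_of_pos hn0 _) hD hNR (add_le_add_left hpA _)
      (Real.rpow_pos_of_pos hn0 _).le rfl hbias hG hM0 hMG hMB).trans ?_
    refine le_trans (add_le_add (ENNReal.ofReal_le_ofReal he)
      (add_le_add (ENNReal.ofReal_le_ofReal hv) (ENNReal.ofReal_le_ofReal hr))) ?_
    rw [← ENNReal.ofReal_add hδ3.le hδ3.le, ← ENNReal.ofReal_add hδ3.le (by positivity)]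
    refine le_trans (le_of_eq ?_) hδ.le
    rw [show (δ : ℝ) / 3 + (δ / 3 + δ / 3) = δ by ring, ENNReal.ofReal_coe_nnreal]

/-! ### Invariance under almost everywhere modification of the regression function -/

lemma obsLaw_congr {f g : SphereD d → ℝ} (h : f =ᵐ[unifSphere d] g) : obsLaw σ f = obsLaw σ g := by
  refine Measure.map_congr ?_
  filter_upwards [(Measure.quasiMeasurePreserving_fst
    (ν := gaussianReal 0 (σ ^ 2))).ae_eq_comp h] with z hz
  simp only [Function.comp_apply] at hz
  rw [hz]

lemma harmonicCoeff_congr {f g : SphereD d → ℝ} (h : f =ᵐ[unifSphere d] g) :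
    harmonicCoeff Y f = harmonicCoeff Y g := by
  funext ℓ m
  exact integral_congr_ae (h.mono fun x hx => by simp only [hx])

lemma MemSobolevSphere.congr_ae {β : ℝ} {f g : SphereD d → ℝ} (hf : MemSobolevSphere Y β f)
    (h : f =ᵐ[unifSphere d] g) : MemSobolevSphere Y β g := by
  refine ⟨hf.1.ae_eq h, ?_⟩
  rw [← harmonicCoeff_congr h]
  exact hf.2

lemma farSet_congr {f g : SphereD d → ℝ} (h : f =ᵐ[unifSphere d] g) (L : ℕ) (r : ℝ) :
    farSet Y L f r = farSet Y L g r := by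
  ext a
  have : eLpNorm (fun x => harmonicSum Y a x - f x) 2 (unifSphere d) =
      eLpNorm (fun x => harmonicSum Y a x - g x) 2 (unifSphere d) :=
    eLpNorm_congr_ae (h.mono fun x hx => by simp only [hx])
  simp only [farSet, Set.mem_ofPred_eq, this]

end Rates

end

theorem theorem3p1 (d : ℕ) (hd : 1 ≤ d)
    (Y : (ℓ : ℕ) → Fin (harmonicMult d ℓ) → SphereD d → ℝ) (hY : IsHarmonicBasis d Y)
    (σ : ℝ≥0) (hσ : 0 < σ)
    (α β : ℝ) (hα : (d : ℝ) / 2 < α) (hβ : 0 < β) (hβα : β ≤ α)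
    (C : ℕ → ℝ≥0)
    (hC : ∃ c₁ c₂ : ℝ, 0 < c₁ ∧ 0 < c₂ ∧ ∀ ℓ : ℕ,
      c₁ * (1 + lbEigenvalue d ℓ) ^ (-α) ≤ (C ℓ : ℝ) ∧
        (C ℓ : ℝ) ≤ c₂ * (1 + lbEigenvalue d ℓ) ^ (-α))
    (f₀ : SphereD d → ℝ) (hf₀ : MemSobolevSphere Y β f₀)
    (L : ℕ → ℕ)
    (hL : (fun n : ℕ => (L n : ℝ)) =Θ[atTop] fun n : ℕ => (n : ℝ) ^ (1 / (2 * α + d))) :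
    ∃ M₀ : ℝ, 0 < M₀ ∧ ∀ M : ℝ, M₀ ≤ M →
      Tendsto (fun n : ℕ => ∫⁻ z, regressionPosterior Y σ C (L n) z
          (farSet Y (L n) f₀ (M * (n : ℝ) ^ (-β / (2 * α + d)))) ∂(dataLaw σ f₀ n))
        atTop (nhds 0) ∧
      Tendsto (fun n : ℕ => ∫⁻ z, sequencePosterior Y σ C (L n) z
          (farSet Y (L n) f₀ (M * (n : ℝ) ^ (-β / (2 * α + d)))) ∂(dataLaw σ f₀ n))
        atTop (nhds 0) := by
  obtain ⟨c₁, _, hc, _, hC⟩ := hC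
  -- f₀ is only almost everywhere strongly measurable; a measurable version has the same data law,
  -- harmonic coefficients and far sets.
  have hae := hf₀.1.1.ae_eq_mk
  have h := hY.posterior_contraction hd hσ hα hβ hβα hc (fun ℓ => (hC ℓ).1)
    hf₀.1.1.stronglyMeasurable_mk.measurable (hf₀.congr_ae hae) hL
  simpa only [dataLaw, ← obsLaw_congr hae, ← farSet_congr hae] using h
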